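/- Let $n\ge 1$ and work over $\mathbb{Q}(v)$. **The algebra $\hat{\mathcal K}$.** For $d\ge 0$ let $\Theta_d$ be the set of $n\times n$ matrices with entries in $\mathbb N$ and entry sum $d$. For a finite field $\mathbb F_q$ of odd characteristic, $GL(\mathbb F_q^d)$ acts on pairs $(V,V')$ of flags $0=V_0\subseteq V_1\subseteq\dots\subseteq V_n=\mathbb F_q^d$; the orbits are the sets $\mathcal O_A$ $(A\in\Theta_d)$ of the pairs with $\dim\frac{V_{i-1}+V_i\cap V'_j}{V_{i-1}+V_i\cap V'_{j-1}}=a_{ij}$ for all $i,j$. Let $\mathcal S_d$ be the algebra with basis $e_A$ $(A\in\Theta_d)$ and product $e_A*e_B=\sum_C g_{A,B}^C(v^2)\,e_C$, where $g_{A,B}^C$ is the polynomial such that, for every odd prime power $q$ and every $(V,V')\in\mathcal O_C$, $g_{A,B}^C(q)$ is the number of flags $V''$ with $(V,V'')\in\mathcal O_A$ and $(V'',V')\in\mathcal O_B$. Put $[A]=v^{-\sum_{i\ge k,\,j<l}a_{ij}a_{kl}}\,e_A$. Let $\widetilde\Theta$ be the set of integer $n\times n$ matrices with nonnegative off-diagonal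 entries, and ${}_pA=A+pI$. Write $\mathrm{ro}(A)$ and $\mathrm{co}(A)$ for the vectors of row sums and of column sums of $A$. For $A,B\in\widetilde\Theta$ with $\mathrm{co}(A)=\mathrm{ro}(B)$ there is a unique finite family of polynomials $G_Z(v,v')\in\mathbb{Q}(v)[v']$ $(Z\in\widetilde\Theta)$ with $[{}_pA]*[{}_pB]=\sum_Z G_Z(v,v^{-p})[{}_pZ]$ for all large $p$; put $[A]\cdot[B]=\sum_Z G_Z(v,1)[Z]$, and $[A]\cdot[B]=0$ if $\mathrm{co}(A)\neq\mathrm{ro}(B)$. Let $\hat{\mathcal K}$ be the $\mathbb{Q}(v)$-algebra of all formal sums $\sum_{A\in\widetilde\Theta}\xi_A[A]$ which, for every $\mathbf t\in\mathbb Z^n$, have only finitely many nonzero terms with $\mathrm{ro}(A)=\mathbf t$ and only finitely many with $\mathrm{co}(A)=\mathbf t$, with the product extending $[A]\cdot[B]$; its unit is $\sum_{\lambda\in\mathbb Z^n}[D_\lambda]$, where $D_\lambda$ is the diagonal matrix with diagonal $\lambda$. **The subalgebra $\mathcal U$.** For a matrix $\hat A$ with nonnegative integer entries and zero diagonal, and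 $\mathbf j\in\mathbb Z^n$, put $\hat A(\mathbf j)=\sum_{\lambda\in\mathbb Z^n}v^{\lambda_1j_1+\dots+\lambda_nj_n}[\hat A+D_\lambda]$. Let $\underline i$ be the $i$-th unit vector, and in $\hat{\mathcal K}$ put $\overline t_{ij}=-(v^{-1}-v)E_{ij}(\underline i)$ for $i<j$, $\overline t_{ii}=0(\underline i)$, and $\overline t_{ij}=0$ for $i>j$. Let $\mathcal U$ be the unital subalgebra of $\hat{\mathcal K}$ generated by all $\overline t_{ij}$. **The algebra $U_v(gl_n)^+$.** Let $U_v(gl_n)$ be the $\mathbb{Q}(v)$-algebra with generators $t_{ij},\overline t_{ij}$ $(1\le i,j\le n)$ and relations $t_{ij}=\overline t_{ji}=0$ for $i<j$ and, for all $i,a,j,b$ (with $\delta_P=1$ if $P$ holds and $0$ otherwise), $$v^{\delta_{ij}}t_{ia}t_{jb}-v^{\delta_{ab}}t_{jb}t_{ia}=(v-v^{-1})(\delta_{b<a}-\delta_{i<j})\,t_{ja}t_{ib},$$ $$v^{\delta_{ij}}\overline t_{ia}\overline t_{jb}-v^{\delta_{ab}}\overline t_{jb}\overline t_{ia}=(v-v^{-1})(\delta_{b<a}-\delta_{i<j})\,\overline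 t_{ja}\overline t_{ib},$$ $$v^{\delta_{ij}}\overline t_{ia}t_{jb}-v^{\delta_{ab}}t_{jb}\overline t_{ia}=(v-v^{-1})(\delta_{b<a}\,t_{ja}\overline t_{ib}-\delta_{i<j}\,\overline t_{ja}t_{ib}),$$ and let $U_v(gl_n)^+$ be its subalgebra generated by the $\overline t_{ij}$. **Theorem.** $\mathcal U\cong U_v(gl_n)^+$ as unital $\mathbb{Q}(v)$-algebras. More precisely: 1. there is an algebra isomorphism $U_v(gl_n)^+\to\mathcal U$ which sends $\overline t_{ij}$ to $\overline t_{n+1-j,\,n+1-i}$ for all $i,j$; 2. $\mathcal U$ is presented by the generators $\overline t_{ij}$ with the relations $\overline t_{ij}=0$ for $i>j$ and, for all $i,a,j,b$, $$v^{-\delta_{ij}}\overline t_{ia}\overline t_{jb}-v^{-\delta_{ab}}\overline t_{jb}\overline t_{ia}=(v^{-1}-v)(\delta_{b<a}-\delta_{i<j})\,\overline t_{ja}\overline t_{ib}.$$ -/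

import Mathlib

open Polynomial

noncomputable section

/-- The ground field `ℚ(v)`. -/
abbrev Kv : Type := RatFunc ℚ

/-- The indeterminate `v` of `ℚ(v)`. -/
def vv : Kv := RatFunc.X

/-! ### Flags over finite fields and the structure constants of the algebras `S_d` -/

/-- An `n`-step flag `0 = V_0 ⊆ V_1 ⊆ ⋯ ⊆ V_n = F^d`. -/
structure NStepFlag (F : Type) [Field F] (n d : ℕ) where
  space : Fin (n + 1) → Submodule F (Fin d → F)
  mono : Monotone space
  bot : space 0 = ⊥
  top : space (Fin.last n) = ⊤

/-- The matrix of a pair of flags: its `(i, j)` entry is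
`dim (V_{i-1} + V_i ∩ V'_j) / (V_{i-1} + V_i ∩ V'_{j-1})` (with 1-based indices).
Two pairs of flags are in the same `GL(F^d)`-orbit iff they have the same matrix, so that the
orbit `O_A` is the set of the pairs whose matrix is `A`. -/
def relPos {F : Type} [Field F] {n d : ℕ} (V V' : NStepFlag F n d) :
    Matrix (Fin n) (Fin n) ℤ := fun i j =>
  (Module.finrank F
      ↥(V.space i.castSucc ⊔ (V.space i.succ ⊓ V'.space j.succ)) : ℤ) -
    (Module.finrank F
      ↥(V.space i.castSucc ⊔ (V.space i.succ ⊓ V'.space j.castSucc)) : ℤ)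

/-- The vector of row sums `ro(A)`. -/
def rowSum {n : ℕ} (A : Matrix (Fin n) (Fin n) ℤ) : Fin n → ℤ := fun i => ∑ j, A i j

/-- The vector of column sums `co(A)`. -/
def colSum {n : ℕ} (A : Matrix (Fin n) (Fin n) ℤ) : Fin n → ℤ := fun j => ∑ i, A i j

/-- `A ∈ Θ_d`: the entries are natural numbers with sum `d`. -/
def IsTheta {n : ℕ} (d : ℕ) (A : Matrix (Fin n) (Fin n) ℤ) : Prop :=
  (∀ i j, 0 ≤ A i j) ∧ ∑ i, ∑ j, A i j = (d : ℤ)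

/-- `d(A) - r(A) = ∑_{i ≥ k, j < l} a_{ij} a_{kl}`, so that `[A] = v^{-(d(A) - r(A))} e_A`. -/
def dimDiff {n : ℕ} (A : Matrix (Fin n) (Fin n) ℤ) : ℤ :=
  ∑ i, ∑ j, ∑ k, ∑ l, if k ≤ i ∧ j < l then A i j * A k l else 0

/-- `P(q)` is the coefficient of `e_C` in the convolution product `e_A * e_B` over the field with
`q` elements, for every odd prime power `q`: for `(V, V') ∈ O_C` it is the number of the flags
`V''` with `(V, V'') ∈ O_A` and `(V'', V') ∈ O_B`. -/
def IsStructurePoly {n : ℕ} (d : ℕ) (A B C : Matrix (Fin n) (Fin n) ℤ) (P : ℤ[X]) : Prop :=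
  ∀ (F : Type) [Field F] [Finite F], ringChar F ≠ 2 →
    ∀ V V' : NStepFlag F n d, relPos V V' = C →
      P.eval (Nat.card F : ℤ) =
        (Nat.card {V'' : NStepFlag F n d // relPos V V'' = A ∧ relPos V'' V' = B} : ℤ)

/-- `x ∈ ℚ(v)` is the coefficient of `[C]` in the product `[A] * [B]` in `S_d`
(where `q = v²`, and `A`, `B`, `C` are in `Θ_d`). -/
def IsSchurCoeff {n : ℕ} (d : ℕ) (A B C : Matrix (Fin n) (Fin n) ℤ) (x : Kv) : Prop :=
  ∃ P : ℤ[X], IsStructurePoly d A B C P ∧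
    x = vv ^ (dimDiff C - dimDiff A - dimDiff B) * Polynomial.aeval (vv ^ 2) P

/-! ### Stabilization: the algebras `K` and `K̂` -/

/-- The set `Θ̃` of the integer matrices whose off-diagonal entries are nonnegative. -/
def ThetaTilde (n : ℕ) : Type :=
  {A : Matrix (Fin n) (Fin n) ℤ // ∀ i j, i ≠ j → 0 ≤ A i j}

/-- The matrix `_pA = A + p I`. -/
def shift {n : ℕ} (p : ℕ) (A : ThetaTilde n) : Matrix (Fin n) (Fin n) ℤ :=
  A.1 + (p : ℤ) • (1 : Matrix (Fin n) (Fin n) ℤ)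

/-- The finite family `G = (G_Z)` of polynomials in `v'` over `ℚ(v)` satisfies
`[_pA] * [_pB] = ∑_Z G_Z(v, v^{-p}) [_pZ]` (in `S_d`, where `d` is the sum of the entries of
`_pA`) for all large `p`. -/
def IsStableProduct {n : ℕ} (A B : ThetaTilde n) (G : ThetaTilde n →₀ Kv[X]) : Prop :=
  ∃ p₀ : ℕ, ∀ p ≥ p₀, ∃ d : ℕ,
    IsTheta d (shift p A) ∧ IsTheta d (shift p B) ∧
    (∀ Z ∈ G.support, IsTheta d (shift p Z)) ∧
    ∀ Z : ThetaTilde n, IsTheta d (shift p Z) →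
      IsSchurCoeff d (shift p A) (shift p B) (shift p Z) ((G Z).eval (vv ^ (-(p : ℤ))))

open Classical in
/-- The product `[A] · [B] = ∑_Z G_Z(v, 1) [Z]` in `K` if `co(A) = ro(B)`, and `0` otherwise.
(The family `G` exists by the stabilization property and is unique.) -/
def basisMul {n : ℕ} (A B : ThetaTilde n) : ThetaTilde n →₀ Kv :=
  if h : colSum A.1 = rowSum B.1 ∧ ∃ G, IsStableProduct A B G then
    h.2.choose.mapRange (Polynomial.eval 1) Polynomial.eval_zero
  else 0

/-- The bilinear product of `K`, extended to finite `ℚ(v)`-linear combinations of the `[A]`. -/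
def kMul {n : ℕ} :
    (ThetaTilde n →₀ Kv) →ₗ[Kv] (ThetaTilde n →₀ Kv) →ₗ[Kv] (ThetaTilde n →₀ Kv) :=
  Finsupp.lsum Kv fun A => LinearMap.toSpanSingleton Kv _ (Finsupp.lsum Kv fun B =>
    LinearMap.toSpanSingleton Kv (ThetaTilde n →₀ Kv) (basisMul A B))

/-- The space of the formal sums `∑ ξ_A [A]` that have, for every `t ∈ ℤ^n`, only finitely many
terms with `ro(A) = t` and only finitely many terms with `co(A) = t`. -/
def locallyFinite (n : ℕ) : Submodule Kv (ThetaTilde n → Kv) where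
  carrier := {ξ | ∀ t : Fin n → ℤ,
    {A : ThetaTilde n | rowSum A.1 = t ∧ ξ A ≠ 0}.Finite ∧
    {A : ThetaTilde n | colSum A.1 = t ∧ ξ A ≠ 0}.Finite}
  zero_mem' := by intro t; simp
  add_mem' := by
    intro ξ η hξ hη t
    constructor
    · refine ((hξ t).1.union (hη t).1).subset ?_
      rintro A ⟨h1, h2⟩
      by_cases h : ξ A = 0
      · right; refine ⟨h1, fun h' => h2 ?_⟩; simp [h, h']
      · left; exact ⟨h1, h⟩
    · refine ((hξ t).2.union (hη t).2).subset ?_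
      rintro A ⟨h1, h2⟩
      by_cases h : ξ A = 0
      · right; refine ⟨h1, fun h' => h2 ?_⟩; simp [h, h']
      · left; exact ⟨h1, h⟩
  smul_mem' := by
    intro c ξ hξ t
    constructor
    · refine (hξ t).1.subset ?_
      rintro A ⟨h1, h2⟩
      exact ⟨h1, fun h => h2 (by simp [h])⟩
    · refine (hξ t).2.subset ?_
      rintro A ⟨h1, h2⟩
      exact ⟨h1, fun h => h2 (by simp [h])⟩

/-- The completion `K̂` as a type. -/
def KHat (n : ℕ) : Type := ↥(locallyFinite n)

instance (n : ℕ) : AddCommGroup (KHat n) := inferInstanceAs (AddCommGroup ↥(locallyFinite n))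

instance (n : ℕ) : Module Kv (KHat n) := inferInstanceAs (Module Kv ↥(locallyFinite n))

open Classical in
/-- The finite sum of the terms `ξ_A [A]` with `ro(A) = t`. -/
def rowPart {n : ℕ} (t : Fin n → ℤ) : KHat n →ₗ[Kv] (ThetaTilde n →₀ Kv) where
  toFun ξ := Finsupp.onFinset (ξ.2 t).1.toFinset (fun A => if rowSum A.1 = t then ξ.1 A else 0)
    (by intro A h; simp only [ne_eq, ite_eq_right_iff, Classical.not_imp] at h; simpa using h)
  map_add' ξ η := by
    ext A
    change (if _ then ξ.1 A + η.1 A else 0) = (if _ then _ else _) + (if _ then _ else _)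
    split_ifs <;> simp
  map_smul' c ξ := by
    ext A
    change (if _ then c * ξ.1 A else 0) = c * (if _ then _ else _)
    split_ifs <;> simp

open Classical in
/-- The finite sum of the terms `ξ_A [A]` with `co(A) = t`. -/
def colPart {n : ℕ} (t : Fin n → ℤ) : KHat n →ₗ[Kv] (ThetaTilde n →₀ Kv) where
  toFun ξ := Finsupp.onFinset (ξ.2 t).2.toFinset (fun A => if colSum A.1 = t then ξ.1 A else 0)
    (by intro A h; simp only [ne_eq, ite_eq_right_iff, Classical.not_imp] at h; simpa using h)
  map_add' ξ η := by
    ext A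
    change (if _ then ξ.1 A + η.1 A else 0) = (if _ then _ else _) + (if _ then _ else _)
    split_ifs <;> simp
  map_smul' c ξ := by
    ext A
    change (if _ then c * ξ.1 A else 0) = c * (if _ then _ else _)
    split_ifs <;> simp

/-- The coefficient of `[C]` in the product `∑_{A, B} ξ_A η_B [A] · [B]`. As `[A] · [B]` involves
only matrices `C` with `ro(C) = ro(A)` and `co(C) = co(B)`, only the finitely many terms with
`ro(A) = ro(C)` and `co(B) = co(C)` matter. -/
def mulCoeff {n : ℕ} (ξ η : KHat n) (C : ThetaTilde n) : Kv :=
  kMul (rowPart (rowSum C.1) ξ) (colPart (colSum C.1) η) C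

theorem exists_of_mulCoeff_ne_zero {n : ℕ} (ξ η : KHat n) (C : ThetaTilde n)
    (h : mulCoeff ξ η C ≠ 0) :
    ∃ A B : ThetaTilde n, rowSum A.1 = rowSum C.1 ∧ ξ.1 A ≠ 0 ∧ colSum A.1 = rowSum B.1 ∧
      colSum B.1 = colSum C.1 ∧ η.1 B ≠ 0 ∧ C ∈ (basisMul A B).support := by
  classical
  by_contra hne
  apply h
  unfold mulCoeff kMul
  rw [Finsupp.lsum_apply, Finsupp.sum, LinearMap.sum_apply, Finsupp.finsetSum_apply]
  refine Finset.sum_eq_zero fun A hA => ?_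
  simp only [LinearMap.toSpanSingleton_apply, LinearMap.smul_apply, Finsupp.lsum_apply,
    Finsupp.sum, Finsupp.smul_apply, Finsupp.finsetSum_apply]
  rw [Finset.sum_eq_zero, smul_zero]
  intro B hB
  have hA' : (if rowSum A.1 = rowSum C.1 then ξ.1 A else 0) ≠ 0 := Finsupp.mem_support_iff.1 hA
  have hB' : (if colSum B.1 = colSum C.1 then η.1 B else 0) ≠ 0 := Finsupp.mem_support_iff.1 hB
  simp only [ne_eq, ite_eq_right_iff, Classical.not_imp] at hA' hB'
  by_cases hc : basisMul A B C = 0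
  · rw [hc, smul_zero]
  · refine (hne ⟨A, B, hA'.1, hA'.2, ?_, hB'.1, hB'.2, Finsupp.mem_support_iff.2 hc⟩).elim
    by_contra hAB
    exact hc (by rw [basisMul, dif_neg (fun h => hAB h.1)]; rfl)

theorem mulCoeff_mem {n : ℕ} (ξ η : KHat n) : mulCoeff ξ η ∈ locallyFinite n := by
  classical
  intro t
  constructor
  · refine ((ξ.2 t).1.biUnion fun A _ => (η.2 (colSum A.1)).1.biUnion fun B _ =>
      (basisMul A B).support.finite_toSet).subset ?_
    rintro C ⟨h1, h2⟩
    obtain ⟨A, B, a1, a2, a3, a4, a5, a6⟩ := exists_of_mulCoeff_ne_zero ξ η C h2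
    simp only [Set.mem_iUnion]
    exact ⟨A, ⟨a1.trans h1, a2⟩, B, ⟨a3.symm, a5⟩, a6⟩
  · refine ((η.2 t).2.biUnion fun B _ => (ξ.2 (rowSum B.1)).2.biUnion fun A _ =>
      (basisMul A B).support.finite_toSet).subset ?_
    rintro C ⟨h1, h2⟩
    obtain ⟨A, B, a1, a2, a3, a4, a5, a6⟩ := exists_of_mulCoeff_ne_zero ξ η C h2
    simp only [Set.mem_iUnion]
    exact ⟨B, ⟨a4.trans h1, a5⟩, A, ⟨a3, a2⟩, a6⟩

/-- The product of `K̂`. -/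
instance (n : ℕ) : Mul (KHat n) := ⟨fun ξ η => ⟨mulCoeff ξ η, mulCoeff_mem ξ η⟩⟩

theorem KHat.ext {n : ℕ} {ξ η : KHat n} (h : ∀ C, ξ.1 C = η.1 C) : ξ = η :=
  Subtype.ext (funext h)

instance (n : ℕ) : NonUnitalNonAssocRing (KHat n) :=
  { (inferInstance : AddCommGroup (KHat n)), (inferInstance : Mul (KHat n)) with
    left_distrib := fun ξ η ζ => KHat.ext fun C => by
      change mulCoeff ξ (η + ζ) C = mulCoeff ξ η C + mulCoeff ξ ζ C
      simp [mulCoeff]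
    right_distrib := fun ξ η ζ => KHat.ext fun C => by
      change mulCoeff (ξ + η) ζ C = mulCoeff ξ ζ C + mulCoeff η ζ C
      simp [mulCoeff]
    zero_mul := fun ξ => KHat.ext fun C => by
      change mulCoeff 0 ξ C = 0
      simp [mulCoeff]
    mul_zero := fun ξ => KHat.ext fun C => by
      change mulCoeff ξ 0 C = 0
      simp [mulCoeff] }

instance (n : ℕ) : IsScalarTower Kv (KHat n) (KHat n) := ⟨fun c ξ η => KHat.ext fun C => by
  change mulCoeff (c • ξ) η C = c * mulCoeff ξ η C
  simp [mulCoeff]⟩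

instance (n : ℕ) : SMulCommClass Kv (KHat n) (KHat n) := ⟨fun c ξ η => KHat.ext fun C => by
  change c * mulCoeff ξ η C = mulCoeff ξ (c • η) C
  simp [mulCoeff]⟩

/-! ### The elements `Â(j)` and the subalgebra `U` -/

/-- `Θ⁰`: the matrices in `Θ̃` with zero diagonal. -/
def ThetaZero (n : ℕ) : Type := {A : ThetaTilde n // ∀ i, A.1 i i = 0}

theorem hatElem_mem {n : ℕ} (A : ThetaZero n) (j : Fin n → ℤ) :
    (fun B : ThetaTilde n => if B.1 = A.1.1 + Matrix.diagonal (fun i => B.1 i i)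
      then vv ^ (∑ i, B.1 i i * j i) else 0) ∈ locallyFinite n := by
  intro t
  constructor
  · refine Set.Subsingleton.finite ?_
    rintro B ⟨h1, h2⟩ C ⟨h3, h4⟩
    have hB : B.1 = A.1.1 + Matrix.diagonal (fun i => B.1 i i) := by
      by_contra h; exact h2 (if_neg h)
    have hC : C.1 = A.1.1 + Matrix.diagonal (fun i => C.1 i i) := by
      by_contra h; exact h4 (if_neg h)
    have key : ∀ i, B.1 i i = C.1 i i := by
      intro i
      have h5 : rowSum B.1 i = rowSum C.1 i := by rw [h1, h3]
      rw [hB, hC] at h5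
      simpa [rowSum, Finset.sum_add_distrib, Matrix.diagonal_apply] using h5
    exact Subtype.ext (by rw [hB, hC]; simp only [key])
  · refine Set.Subsingleton.finite ?_
    rintro B ⟨h1, h2⟩ C ⟨h3, h4⟩
    have hB : B.1 = A.1.1 + Matrix.diagonal (fun i => B.1 i i) := by
      by_contra h; exact h2 (if_neg h)
    have hC : C.1 = A.1.1 + Matrix.diagonal (fun i => C.1 i i) := by
      by_contra h; exact h4 (if_neg h)
    have key : ∀ i, B.1 i i = C.1 i i := by
      intro i
      have h5 : colSum B.1 i = colSum C.1 i := by rw [h1, h3]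
      rw [hB, hC] at h5
      simpa [colSum, Finset.sum_add_distrib, Matrix.diagonal_apply] using h5
    exact Subtype.ext (by rw [hB, hC]; simp only [key])

/-- `Â(j) = ∑_{λ ∈ ℤ^n} v^{λ_1 j_1 + ⋯ + λ_n j_n} [Â + D_λ]`, for `Â ∈ Θ⁰` and `j ∈ ℤ^n`. -/
def hatElem {n : ℕ} (A : ThetaZero n) (j : Fin n → ℤ) : KHat n :=
  ⟨fun B => if B.1 = A.1.1 + Matrix.diagonal (fun i => B.1 i i)
    then vv ^ (∑ i, B.1 i i * j i) else 0, hatElem_mem A j⟩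

/-- The zero matrix as an element of `Θ⁰`. -/
def zeroMat (n : ℕ) : ThetaZero n := ⟨⟨0, by intro i j _; simp⟩, by intro i; simp⟩

/-- The matrix unit `E_{ij}`, `i ≠ j`, as an element of `Θ⁰`. -/
def unitMat {n : ℕ} (i j : Fin n) (h : i ≠ j) : ThetaZero n :=
  ⟨⟨Matrix.single i j 1, by
    intro a b _
    rw [Matrix.single_apply]
    split_ifs <;> simp⟩, by
    intro a
    change Matrix.single i j (1 : ℤ) a a = 0
    rw [Matrix.single_apply, if_neg]
    rintro ⟨rfl, rfl⟩
    exact h rfl⟩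

/-- The unit `∑_λ [D_λ]` of `K̂`. -/
instance (n : ℕ) : One (KHat n) := ⟨hatElem (zeroMat n) 0⟩

/-- The elements `t̄_{ij} = -(v⁻¹ - v) E_{ij}(i)` for `i < j`, `t̄_{ii} = 0(i)`, and `t̄_{ij} = 0`
for `i > j`, of `K̂`; the argument `(i)` is the `i`-th unit vector of `ℤ^n`. -/
def tBar {n : ℕ} (i j : Fin n) : KHat n :=
  if h : i < j then (-(vv⁻¹ - vv)) • hatElem (unitMat i j h.ne) (Pi.single i 1)
  else if i = j then hatElem (zeroMat n) (Pi.single i 1)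
  else 0

/-- The (unital) subalgebra `U` of `K̂` generated by the `t̄_{ij}`. -/
def calU (n : ℕ) : NonUnitalSubalgebra Kv (KHat n) :=
  NonUnitalAlgebra.adjoin Kv (insert 1 (Set.range fun p : Fin n × Fin n => tBar p.1 p.2))

/-! ### The algebra `U_v(gl_n)` in its RTT presentation and its positive part -/

/-- `δ_p`: equal to `1` if `p` holds, and to `0` otherwise. -/
def delta (p : Prop) [Decidable p] : Kv := if p then 1 else 0

/-- `q^{δ_{ij}}`. -/
def powDelta {n : ℕ} (q : Kv) (i j : Fin n) : Kv := if i = j then q else 1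

/-- The generators `t_{ij}` and `t̄_{ij}` of `U_v(gl_n)`. -/
inductive RTTGen (n : ℕ) : Type
  | t (i j : Fin n) : RTTGen n
  | tbar (i j : Fin n) : RTTGen n

namespace RTTGen

/-- `t_{ij}` in the free algebra. -/
def T {n : ℕ} (i j : Fin n) : FreeAlgebra Kv (RTTGen n) := FreeAlgebra.ι Kv (t i j)

/-- `t̄_{ij}` in the free algebra. -/
def Tb {n : ℕ} (i j : Fin n) : FreeAlgebra Kv (RTTGen n) := FreeAlgebra.ι Kv (tbar i j)

end RTTGen

open RTTGen in
/-- The defining relations of `U_v(gl_n)`. -/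
inductive UvRel (n : ℕ) : FreeAlgebra Kv (RTTGen n) → FreeAlgebra Kv (RTTGen n) → Prop
  | t_zero (i j : Fin n) (h : i < j) : UvRel n (T i j) 0
  | tbar_zero (i j : Fin n) (h : i < j) : UvRel n (Tb j i) 0
  | tt (i a j b : Fin n) : UvRel n
      (powDelta vv i j • (T i a * T j b) - powDelta vv a b • (T j b * T i a))
      (((vv - vv⁻¹) * (delta (b < a) - delta (i < j))) • (T j a * T i b))
  | bb (i a j b : Fin n) : UvRel n
      (powDelta vv i j • (Tb i a * Tb j b) - powDelta vv a b • (Tb j b * Tb i a))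
      (((vv - vv⁻¹) * (delta (b < a) - delta (i < j))) • (Tb j a * Tb i b))
  | bt (i a j b : Fin n) : UvRel n
      (powDelta vv i j • (Tb i a * T j b) - powDelta vv a b • (T j b * Tb i a))
      ((vv - vv⁻¹) • (delta (b < a) • (T j a * Tb i b) - delta (i < j) • (Tb j a * T i b)))

/-- The algebra `U_v(gl_n)` over `ℚ(v)`. -/
abbrev UvGl (n : ℕ) : Type := RingQuot (UvRel n)

/-- The generator `t̄_{ij}` of `U_v(gl_n)`. -/
def UvGl.tbar {n : ℕ} (i j : Fin n) : UvGl n := RingQuot.mkAlgHom Kv (UvRel n) (RTTGen.Tb i j)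

/-- The positive part `U_v(gl_n)⁺`: the subalgebra generated by the `t̄_{ij}`. -/
def UPlus (n : ℕ) : Subalgebra Kv (UvGl n) :=
  Algebra.adjoin Kv (Set.range fun p : Fin n × Fin n => UvGl.tbar p.1 p.2)

/-- `t̄_{ij}` as an element of the positive part. -/
def UPlus.tbar {n : ℕ} (i j : Fin n) : UPlus n :=
  ⟨UvGl.tbar i j, Algebra.subset_adjoin ⟨(i, j), rfl⟩⟩

/-- The RTT relations, with parameter `q`, between generators `x_{ij}` with `x_{ij} = 0` for
`i > j`. -/
inductive RTTPlusRel (n : ℕ) (q : Kv) :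
    FreeAlgebra Kv (Fin n × Fin n) → FreeAlgebra Kv (Fin n × Fin n) → Prop
  | zero (i j : Fin n) (h : i < j) : RTTPlusRel n q (FreeAlgebra.ι Kv (j, i)) 0
  | rtt (i a j b : Fin n) : RTTPlusRel n q
      (powDelta q i j • (FreeAlgebra.ι Kv (i, a) * FreeAlgebra.ι Kv (j, b)) -
        powDelta q a b • (FreeAlgebra.ι Kv (j, b) * FreeAlgebra.ι Kv (i, a)))
      (((q - q⁻¹) * (delta (b < a) - delta (i < j))) •
        (FreeAlgebra.ι Kv (j, a) * FreeAlgebra.ι Kv (i, b)))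

/-- The algebra presented by the RTT relations of the positive part, with parameter `q`. -/
abbrev RTTPlus (n : ℕ) (q : Kv) : Type := RingQuot (RTTPlusRel n q)

/-- The generator `x_{ij}`. -/
def RTTPlus.gen {n : ℕ} (q : Kv) (i j : Fin n) : RTTPlus n q :=
  RingQuot.mkAlgHom Kv (RTTPlusRel n q) (FreeAlgebra.ι Kv (i, j))

end

/-!
The off-diagonal part of an upper triangular matrix is a multiplicity function on the pairs
`i < j`, that is, a Kostant partition, and `U` lies in an extended Hall algebra whose basis consists
of the sums of the `v ^ (ro(Z) · m) e_Z` over all upper triangular `Z` with a given off-diagonal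
part.

The relative position of two flags is determined by the dimensions of the intersections
`V_i ∩ V'_j`, so counting the one-dimensional enlargements of a step of a flag gives the product of
an arbitrary basis element and a simple root element. Such a product is a quantum integer
`1 + q + ⋯ + q ^ m` times one new basis element, plus terms of smaller measure. By induction all
structure constants are polynomials in `q`: the quantum integers are monic, and the divisibility by
a monic polynomial can be tested at infinitely many values, here at the odd primes. For upper
triangular matrices the structure constants of the `e_Z` do not depend on the diagonals, and the
powers of `v` in `[Z]` contribute the same factor to the products at every shift `p`, whence the
stabilization.

The commutators of the simple root elements produce all root elements, and the relations between
root elements are the RTT relations of the `t̄_{ij}` at the parameter `v⁻¹`. These relations allow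
every word to be rewritten as a combination of ordered monomials, and in the extended Hall algebra
the ordered monomials are nonzero multiples of distinct basis elements. So the algebra presented by
the relations embeds in the extended Hall algebra, which embeds in the completion because the
characters `λ ↦ v ^ (λ · m)` of `ℤ ^ n` are linearly independent. Finally the reflection
`(i, j) ↦ (n + 1 - j, n + 1 - i)` turns the relations at `v⁻¹` into those at `v`, and `t_{ij} ↦ 0`
retracts `U_v(gl_n)` onto the algebra that they present.
-/

noncomputable section

variable {n : ℕ}

/-- The positive roots of `gl_n`, that is, the pairs `i < j` of indices. -/
abbrev PosRoot (n : ℕ) : Type := {p : Fin n × Fin n // p.1 < p.2}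

/-- The finite multisets of positive roots, encoded by their multiplicities. They are the
off-diagonal parts of the upper triangular matrices in `Θ̃`, and index the basis of the Hall
algebra. -/
abbrev KostantPartition (n : ℕ) : Type := PosRoot n → ℕ

/-- The positive root `(i, j)`. -/
abbrev posRoot (i j : Fin n) (h : i < j) : PosRoot n := ⟨(i, j), h⟩

/-- The multiset that consists of the root `p` only, that is, the matrix unit at `p`. -/
abbrev ofRoot (p : PosRoot n) : KostantPartition n := Pi.single p 1

/-- The `(i, j)` entry of the strictly upper triangular matrix `A`. -/
def entry (A : KostantPartition n) (i j : Fin n) : ℕ := if h : i < j then A (posRoot i j h) else 0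

theorem entry_of_lt (A : KostantPartition n) {i j : Fin n} (h : i < j) :
    entry A i j = A (posRoot i j h) :=
  dif_pos h

theorem entry_of_not_lt (A : KostantPartition n) {i j : Fin n} (h : ¬ i < j) : entry A i j = 0 :=
  dif_neg h

theorem entry_add (A B : KostantPartition n) (i j : Fin n) :
    entry (A + B) i j = entry A i j + entry B i j := by
  unfold entry; split_ifs <;> simp

@[simp] theorem entry_zero (i j : Fin n) : entry (0 : KostantPartition n) i j = 0 := by
  unfold entry; split_ifs <;> simp

theorem entry_single (p : PosRoot n) (c : ℕ) (i j : Fin n) :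
    entry (Pi.single p c) i j = if i = p.1.1 ∧ j = p.1.2 then c else 0 := by
  obtain ⟨⟨a, b⟩, hab⟩ := p
  by_cases h : i < j
  · simp [entry_of_lt _ h, Pi.single_apply, Subtype.ext_iff, Prod.ext_iff]
  · rw [entry_of_not_lt _ h, if_neg]
    rintro ⟨rfl, rfl⟩
    exact h hab

theorem KostantPartition.ext_entry {A B : KostantPartition n}
    (h : ∀ i j, i < j → entry A i j = entry B i j) : A = B := by
  funext p
  simpa only [entry_of_lt _ p.2] using h p.1.1 p.1.2 p.2

/-- `Z` is upper triangular with off-diagonal part `A`. -/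
def HasOffDiag (Z : Matrix (Fin n) (Fin n) ℤ) (A : KostantPartition n) : Prop :=
  ∀ i j, i ≠ j → Z i j = entry A i j

theorem HasOffDiag.eq_zero_of_lt {Z : Matrix (Fin n) (Fin n) ℤ} {A : KostantPartition n}
    (h : HasOffDiag Z A) {i j : Fin n} (hji : j < i) : Z i j = 0 := by
  rw [h i j hji.ne', entry_of_not_lt _ hji.not_gt, Nat.cast_zero]

theorem HasOffDiag.unique {Z : Matrix (Fin n) (Fin n) ℤ} {A B : KostantPartition n}
    (hA : HasOffDiag Z A) (hB : HasOffDiag Z B) : A = B :=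
  KostantPartition.ext_entry fun i j h =>
    Nat.cast_injective ((hA i j h.ne).symm.trans (hB i j h.ne))

/-- The dimension vector of a multiset of roots: the root `(k, l)` counts at every `t` with
`k < t ≤ l`. -/
def dimVec (A : KostantPartition n) (t : Fin (n + 1)) : ℤ :=
  ∑ k : Fin n, ∑ l : Fin n, if k.castSucc < t ∧ t ≤ l.castSucc then (entry A k l : ℤ) else 0

theorem dimVec_zero (t : Fin (n + 1)) : dimVec (0 : KostantPartition n) t = 0 := by simp [dimVec]

/-! ### Relative positions of flags -/

theorem sum_ite_castSucc_lt_sub {G : Type*} [AddCommGroup G] (f : Fin (n + 1) → G)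
    (j : Fin (n + 1)) :
    (∑ l : Fin n, if l.castSucc < j then f l.succ - f l.castSucc else 0) = f j - f 0 := by
  induction n with
  | zero =>
    obtain rfl : j = 0 := Subsingleton.elim (α := Fin 1) _ _
    simp
  | succ n ih =>
    rw [Fin.sum_univ_castSucc]
    induction j using Fin.lastCases with
    | last =>
      have := ih (fun t => f t.castSucc) (Fin.last n)
      simp only [Fin.castSucc_lt_last, if_true, Fin.succ_castSucc, Fin.succ_last] at this ⊢
      rw [this, Fin.castSucc_zero, add_comm, sub_add_sub_cancel]
    | cast j =>
      have := ih (fun t => f t.castSucc) j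
      simp only [Fin.castSucc_lt_castSucc_iff, Fin.succ_castSucc] at this ⊢
      rw [this, if_neg (Fin.le_last j).not_gt, add_zero, Fin.castSucc_zero]

theorem sum_succ_sub_castSucc {G : Type*} [AddCommGroup G] (f : Fin (n + 1) → G) :
    ∑ l : Fin n, (f l.succ - f l.castSucc) = f (Fin.last n) - f 0 := by
  simpa only [Fin.castSucc_lt_last, if_true] using sum_ite_castSucc_lt_sub f (Fin.last n)

section Flags

variable {F : Type} [Field F] {d : ℕ} {V V' : NStepFlag F n d} {A : KostantPartition n}

theorem NStepFlag.ext (h : ∀ i, V.space i = V'.space i) : V = V' := by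
  obtain ⟨f, _, _, _⟩ := V
  obtain ⟨g, _, _, _⟩ := V'
  obtain rfl : f = g := funext h
  rfl

/-- `dim (V_i ∩ V'_j)`, as an integer. -/
def interDim (V V' : NStepFlag F n d) (i j : Fin (n + 1)) : ℤ :=
  Module.finrank F ↥(V.space i ⊓ V'.space j)

variable (V V')

theorem interDim_last_right (i : Fin (n + 1)) :
    interDim V V' i (Fin.last n) = Module.finrank F (V.space i) := by
  rw [interDim, V'.top, inf_top_eq]

theorem interDim_last_left (i : Fin (n + 1)) :
    interDim V V' (Fin.last n) i = Module.finrank F (V'.space i) := by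
  rw [interDim, V.top, top_inf_eq]

theorem interDim_zero_left (i : Fin (n + 1)) : interDim V V' 0 i = 0 := by
  rw [interDim, V.bot, bot_inf_eq, finrank_bot, Nat.cast_zero]

theorem interDim_zero_right (i : Fin (n + 1)) : interDim V V' i 0 = 0 := by
  rw [interDim, V'.bot, inf_bot_eq, finrank_bot, Nat.cast_zero]

theorem finrank_sup_inf_eq (i : Fin n) (W : Submodule F (Fin d → F)) :
    (Module.finrank F ↥(V.space i.castSucc ⊔ (V.space i.succ ⊓ W)) : ℤ) =
      Module.finrank F (V.space i.castSucc) + Module.finrank F ↥(V.space i.succ ⊓ W) -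
        Module.finrank F ↥(V.space i.castSucc ⊓ W) := by
  have h := Submodule.finrank_sup_add_finrank_inf_eq (V.space i.castSucc) (V.space i.succ ⊓ W)
  rw [← inf_assoc, inf_eq_left.2 (V.mono Fin.castSucc_lt_succ.le)] at h
  omega

theorem relPos_eq (i j : Fin n) :
    relPos V V' i j = (interDim V V' i.succ j.succ - interDim V V' i.castSucc j.succ) -
      (interDim V V' i.succ j.castSucc - interDim V V' i.castSucc j.castSucc) := by
  simp only [relPos, finrank_sup_inf_eq, interDim]
  ring

theorem relPos_nonneg (i j : Fin n) : 0 ≤ relPos V V' i j := by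
  rw [relPos, sub_nonneg, Nat.cast_le]
  exact Submodule.finrank_mono
    (sup_le_sup_left (inf_le_inf_left _ (V'.mono Fin.castSucc_lt_succ.le)) _)

theorem interDim_eq_sum (i j : Fin (n + 1)) :
    interDim V V' i j = ∑ k : Fin n, ∑ l : Fin n,
      if k.castSucc < i ∧ l.castSucc < j then relPos V V' k l else 0 := by
  have sum_row : ∀ k : Fin n,
      (∑ l : Fin n, if k.castSucc < i ∧ l.castSucc < j then relPos V V' k l else 0) =
        if k.castSucc < i then interDim V V' k.succ j - interDim V V' k.castSucc j else 0 := by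
    intro k
    by_cases hk : k.castSucc < i
    · simp only [hk, true_and, if_true, relPos_eq]
      rw [sum_ite_castSucc_lt_sub (fun l => interDim V V' k.succ l - interDim V V' k.castSucc l) j,
        interDim_zero_right, interDim_zero_right, sub_zero, sub_zero]
    · simp [hk]
  simp only [sum_row]
  rw [sum_ite_castSucc_lt_sub (fun k => interDim V V' k j), interDim_zero_left, sub_zero]

theorem finrank_left_eq_sum (t : Fin (n + 1)) :
    (Module.finrank F (V.space t) : ℤ) = ∑ k : Fin n, ∑ l : Fin n,
      if k.castSucc < t then relPos V V' k l else 0 := by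
  rw [← interDim_last_right V V', interDim_eq_sum]
  simp only [Fin.castSucc_lt_last, and_true]

theorem finrank_right_eq_sum (t : Fin (n + 1)) :
    (Module.finrank F (V'.space t) : ℤ) = ∑ k : Fin n, ∑ l : Fin n,
      if l.castSucc < t then relPos V V' k l else 0 := by
  rw [← interDim_last_left V V', interDim_eq_sum]
  simp only [Fin.castSucc_lt_last, true_and]

theorem rowSum_relPos (i : Fin n) :
    rowSum (relPos V V') i =
      (Module.finrank F (V.space i.succ) : ℤ) - Module.finrank F (V.space i.castSucc) := by
  simp only [rowSum, relPos_eq]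
  rw [sum_succ_sub_castSucc (fun l => interDim V V' i.succ l - interDim V V' i.castSucc l)]
  simp only [interDim_zero_right, interDim_last_right, sub_zero]

theorem colSum_relPos (j : Fin n) :
    colSum (relPos V V') j =
      (Module.finrank F (V'.space j.succ) : ℤ) - Module.finrank F (V'.space j.castSucc) := by
  have h := sum_succ_sub_castSucc (fun k => interDim V V' k j.succ - interDim V V' k j.castSucc)
  simp only [interDim_zero_left, interDim_last_left, sub_zero] at h
  rw [← h]
  refine Finset.sum_congr rfl fun k _ => ?_
  rw [relPos_eq]
  ring

theorem relPos_self_of_ne {i j : Fin n} (hij : i ≠ j) : relPos V V i j = 0 := by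
  rcases hij.lt_or_gt with h | h
  · have hle : i.succ ≤ j.castSucc := Fin.succ_le_castSucc_iff.2 h
    rw [relPos, inf_eq_left.2 (V.mono (hle.trans Fin.castSucc_lt_succ.le)),
      inf_eq_left.2 (V.mono hle), sub_self]
  · have hle : V.space j.succ ≤ V.space i.castSucc := V.mono (Fin.succ_le_castSucc_iff.2 h)
    rw [relPos, sup_eq_left.2 (inf_le_right.trans hle),
      sup_eq_left.2 (inf_le_right.trans ((V.mono Fin.castSucc_lt_succ.le).trans hle)), sub_self]

variable {V V'}

theorem HasOffDiag.space_le (h : HasOffDiag (relPos V V') A) (t : Fin (n + 1)) :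
    V'.space t ≤ V.space t := by
  have hdim : interDim V V' t t = Module.finrank F (V'.space t) := by
    rw [finrank_right_eq_sum V V', interDim_eq_sum]
    refine Finset.sum_congr rfl fun k _ => Finset.sum_congr rfl fun l _ => ?_
    by_cases hl : l.castSucc < t
    · by_cases hk : k.castSucc < t
      · simp only [hl, hk, and_self, if_true]
      · have hlk : l < k := Fin.castSucc_lt_castSucc_iff.1 (hl.trans_le (not_lt.1 hk))
        rw [if_pos hl, if_neg fun h' => hk h'.1, h.eq_zero_of_lt hlk]
    · simp only [hl, and_false, if_false]
  exact inf_eq_right.1 (Submodule.eq_of_le_of_finrank_eq inf_le_right (Nat.cast_injective hdim))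

theorem HasOffDiag.finrank_eq (h : HasOffDiag (relPos V V') A) (t : Fin (n + 1)) :
    (Module.finrank F (V.space t) : ℤ) = Module.finrank F (V'.space t) + dimVec A t := by
  rw [finrank_right_eq_sum V V', finrank_left_eq_sum V V', dimVec, ← Finset.sum_add_distrib]
  refine Finset.sum_congr rfl fun k _ => ?_
  rw [← Finset.sum_add_distrib]
  refine Finset.sum_congr rfl fun l _ => ?_
  by_cases hl : l.castSucc < t <;> by_cases hk : k.castSucc < t
  · simp [hl, hk]
  · have hlk : l < k := Fin.castSucc_lt_castSucc_iff.1 (hl.trans_le (not_lt.1 hk))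
    simp [hl, hk, h.eq_zero_of_lt hlk]
  · have hkl : k < l := Fin.castSucc_lt_castSucc_iff.1 (hk.trans_le (not_lt.1 hl))
    simp [hl, hk, not_lt.1 hl, h k l hkl.ne]
  · simp [hl, hk]

theorem hasOffDiag_zero_iff : HasOffDiag (relPos V V') 0 ↔ V = V' := by
  constructor
  · intro h
    refine NStepFlag.ext fun t => (Submodule.eq_of_le_of_finrank_eq (h.space_le t) ?_).symm
    have hdim := h.finrank_eq t
    rw [dimVec_zero, add_zero] at hdim
    exact_mod_cast hdim.symm
  · rintro rfl i j hij
    rw [relPos_self_of_ne V hij, entry_zero, Nat.cast_zero]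

end Flags

/-! ### Coordinate flags -/

section Coordinate

variable (F : Type*) [Field F] {ι : Type*}

/-- The vectors of `F^ι` supported in `S`. -/
def coordSubmodule (S : Set ι) : Submodule F (ι → F) :=
  ⨅ a ∈ Sᶜ, LinearMap.ker (LinearMap.proj a)

variable {F} in
theorem mem_coordSubmodule {S : Set ι} {x : ι → F} :
    x ∈ coordSubmodule F S ↔ ∀ a ∉ S, x a = 0 := by
  simp [coordSubmodule]

theorem coordSubmodule_inf (S T : Set ι) :
    coordSubmodule F S ⊓ coordSubmodule F T = coordSubmodule F (S ∩ T) := by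
  rw [coordSubmodule, coordSubmodule, coordSubmodule, Set.compl_inter, iInf_union]

theorem finrank_coordSubmodule [Fintype ι] (S : Set ι) [DecidablePred (· ∈ S)] :
    Module.finrank F (coordSubmodule F S) = ∑ a, if a ∈ S then 1 else 0 := by
  rw [coordSubmodule, (LinearMap.iInfKerProjEquiv F (fun _ : ι => F) disjoint_compl_right
    (Set.union_compl_self S).ge).finrank_eq, Module.finrank_fintype_fun_eq_card, Finset.sum_boole]
  simp [Fintype.card_subtype]

end Coordinate

section CoordFlag

variable (F : Type) [Field F] {d : ℕ}

/-- The flag of the coordinate subspaces `{x | x_a = 0 unless f a < t}`, for a map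
`f : Fin d → Fin n`. -/
def coordFlag (f : Fin d → Fin n) : NStepFlag F n d where
  space t := coordSubmodule F {a | (f a).castSucc < t}
  mono s t hst x hx := mem_coordSubmodule.2 fun a ha =>
    mem_coordSubmodule.1 hx a fun h => ha (lt_of_lt_of_le h hst)
  bot := eq_bot_iff.2 fun x hx => funext fun a => mem_coordSubmodule.1 hx a (by simp)
  top := eq_top_iff.2 fun _ _ => mem_coordSubmodule.2 fun a ha =>
    (ha (Fin.castSucc_lt_last (f a))).elim

theorem interDim_coordFlag (f g : Fin d → Fin n) (s t : Fin (n + 1)) :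
    interDim (coordFlag F f) (coordFlag F g) s t =
      ∑ a, (if (f a).castSucc < s then 1 else 0) * (if (g a).castSucc < t then 1 else 0) := by
  classical
  rw [interDim, coordFlag, coordFlag, coordSubmodule_inf, finrank_coordSubmodule, Nat.cast_sum]
  refine Finset.sum_congr rfl fun a _ => ?_
  rw [ite_zero_mul_ite_zero, mul_one, Nat.cast_ite, Nat.cast_one, Nat.cast_zero]
  rfl

theorem ite_lt_succ_sub_ite_lt_castSucc (a i : Fin n) :
    (if a.castSucc < i.succ then (1 : ℤ) else 0) - (if a.castSucc < i.castSucc then 1 else 0) =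
      if a = i then 1 else 0 := by
  simp only [Fin.castSucc_lt_castSucc_iff, Fin.castSucc_lt_succ_iff]
  rcases lt_trichotomy a i with h | rfl | h
  · simp [h, h.le, h.ne]
  · simp
  · simp [h.not_ge, h.not_gt, h.ne']

theorem relPos_coordFlag (f g : Fin d → Fin n) (i j : Fin n) :
    relPos (coordFlag F f) (coordFlag F g) i j =
      Fintype.card {a // f a = i ∧ g a = j} := by
  rw [relPos_eq, interDim_coordFlag, interDim_coordFlag, interDim_coordFlag, interDim_coordFlag,
    ← Finset.sum_sub_distrib, ← Finset.sum_sub_distrib, ← Finset.sum_sub_distrib,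
    Fintype.card_subtype, ← Finset.sum_boole]
  refine Finset.sum_congr rfl fun a _ => ?_
  rw [← mul_one (1 : ℤ), ← ite_zero_mul_ite_zero, mul_one, ← ite_lt_succ_sub_ite_lt_castSucc,
    ← ite_lt_succ_sub_ite_lt_castSucc]
  ring

theorem exists_relPos_eq {C : Matrix (Fin n) (Fin n) ℤ} (h : IsTheta d C) :
    ∃ V V' : NStepFlag F n d, relPos V V' = C := by
  have hcard : Fintype.card (Fin d) =
      Fintype.card (Σ p : Fin n × Fin n, Fin (C p.1 p.2).toNat) := by
    simp only [Fintype.card_sigma, Fintype.card_fin]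
    zify
    rw [← h.2, ← Fintype.sum_prod_type' (f := fun i j => C i j)]
    exact Finset.sum_congr rfl fun p _ => (Int.toNat_of_nonneg (h.1 _ _)).symm
  let e := Fintype.equivOfCardEq hcard
  refine ⟨coordFlag F fun a => (e a).1.1, coordFlag F fun a => (e a).1.2, ?_⟩
  ext i j
  have fiber : {a // (e a).1.1 = i ∧ (e a).1.2 = j} ≃ Fin (C i j).toNat :=
    (e.subtypeEquiv fun a => (Prod.ext_iff (y := (i, j))).symm).trans
      (Equiv.sigmaSubtype (i, j))
  rw [relPos_coordFlag, Fintype.card_congr fiber, Fintype.card_fin, Int.toNat_of_nonneg (h.1 _ _)]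

end CoordFlag

/-! ### Counting the one-dimensional enlargements of a subspace -/

section Enlargement

variable {K E : Type*} [Field K] [AddCommGroup E] [Module K E]

theorem sup_span_singleton_eq [FiniteDimensional K E] {U L : Submodule K E} (hUL : U ≤ L)
    (hL : Module.finrank K L = Module.finrank K U + 1) {x : E} (hx : x ∈ L) (hxU : x ∉ U) :
    U ⊔ Submodule.span K {x} = L :=
  Submodule.eq_of_le_of_finrank_eq
    (sup_le hUL ((Submodule.span_singleton_le_iff_mem x L).2 hx))
    ((Submodule.finrank_sup_span_singleton hxU).trans hL.symm)

theorem natCard_mem_notMem [Finite K] [Finite E] {Y X : Submodule K E} (h : Y ≤ X) :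
    (Nat.card {x // x ∈ X ∧ x ∉ Y} : ℤ) =
      (Nat.card K : ℤ) ^ Module.finrank K X - (Nat.card K : ℤ) ^ Module.finrank K Y := by
  have hsplit : Nat.card {x // x ∈ X ∧ x ∉ Y} + Nat.card Y = Nat.card X :=
    Set.ncard_sdiff_add_ncard_of_subset (s := (Y : Set E)) (t := X) h
  rw [Module.natCard_eq_pow_finrank (K := K) (V := X),
    Module.natCard_eq_pow_finrank (K := K) (V := Y)] at hsplit
  exact eq_sub_of_add_eq (mod_cast hsplit)

/-- The subspaces `L` with `U ≤ L ≤ X`, `dim L = dim U + 1` and not `L ≤ Y`. They are the choices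
for the `t`-th space of a flag whose relative position to another flag moves in a given way. -/
def Enlargement (U Y X : Submodule K E) : Type _ :=
  {L : Submodule K E // U ≤ L ∧ Module.finrank K L = Module.finrank K U + 1 ∧ L ≤ X ∧ ¬ L ≤ Y}

/-- The bijection which finds for `x` in `X \ Y` the only `L` such that `x` is in `L \ U`. -/
def sigmaEnlargementEquiv [FiniteDimensional K E] {U Y X : Submodule K E} (hUY : U ≤ Y)
    (hYX : Y ≤ X) :
    {x // x ∈ X ∧ x ∉ Y} ≃ Σ L : Enlargement U Y X, {x // x ∈ L.1 ∧ x ∉ U} where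
  toFun x := ⟨⟨U ⊔ Submodule.span K {x.1}, le_sup_left,
      Submodule.finrank_sup_span_singleton fun h => x.2.2 (hUY h),
      sup_le (hUY.trans hYX) ((Submodule.span_singleton_le_iff_mem _ _).2 x.2.1),
      fun h => x.2.2 (h (Submodule.mem_sup_right (Submodule.mem_span_singleton_self _)))⟩,
    ⟨x.1, Submodule.mem_sup_right (Submodule.mem_span_singleton_self _), fun h => x.2.2 (hUY h)⟩⟩
  invFun y := ⟨y.2.1, y.1.2.2.2.1 y.2.2.1, fun h => y.1.2.2.2.2 (by
    rw [← sup_span_singleton_eq y.1.2.1 y.1.2.2.1 y.2.2.1 y.2.2.2]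
    exact sup_le hUY ((Submodule.span_singleton_le_iff_mem _ _).2 h))⟩
  left_inv _ := rfl
  right_inv := by
    rintro ⟨⟨L, h1, h2, h3, h4⟩, ⟨x, hx, hxU⟩⟩
    obtain rfl := sup_span_singleton_eq h1 h2 hx hxU
    rfl

theorem natCard_enlargement [Finite K] [Finite E] {U Y X : Submodule K E} (hUY : U ≤ Y)
    (hYX : Y ≤ X) {a b : ℕ} (ha : Module.finrank K Y = Module.finrank K U + a)
    (hb : Module.finrank K X = Module.finrank K Y + b) :
    (Nat.card (Enlargement U Y X) : ℤ) =
      (Nat.card K : ℤ) ^ a * ∑ t ∈ Finset.range b, (Nat.card K : ℤ) ^ t := by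
  classical
  have : FiniteDimensional K E := Module.Finite.of_finite
  have : Finite (Enlargement U Y X) := Subtype.finite
  have := Fintype.ofFinite (Enlargement U Y X)
  have hq : (1 : ℤ) < Nat.card K := mod_cast Finite.one_lt_card
  set q : ℤ := (Nat.card K : ℤ)
  have fiber (L : Enlargement U Y X) : (Nat.card {x // x ∈ L.1 ∧ x ∉ U} : ℤ) =
      q ^ Module.finrank K U * (q - 1) := by
    rw [natCard_mem_notMem L.2.1, L.2.2.1]
    ring
  have count : q ^ Module.finrank K X - q ^ Module.finrank K Y =
      Nat.card (Enlargement U Y X) * (q ^ Module.finrank K U * (q - 1)) := by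
    rw [← natCard_mem_notMem hYX, Nat.card_congr (sigmaEnlargementEquiv hUY hYX), Nat.card_sigma,
      Nat.cast_sum, Finset.sum_congr rfl fun L _ => fiber L, Finset.sum_const, Finset.card_univ,
      ← Nat.card_eq_fintype_card, nsmul_eq_mul]
  rw [hb, ha] at count
  have hne : q ^ Module.finrank K U * (q - 1) ≠ 0 :=
    mul_ne_zero (pow_ne_zero _ (by omega)) (by omega)
  apply mul_right_cancel₀ hne
  rw [← count, pow_add, pow_add]
  linear_combination (-q ^ Module.finrank K U * q ^ a) * geom_sum_mul q b

end Enlargement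

/-! ### Flags that differ in one step -/

theorem dimVec_single (p : PosRoot n) (c : ℕ) (t : Fin (n + 1)) :
    dimVec (Pi.single p c) t = if p.1.1.castSucc < t ∧ t ≤ p.1.2.castSucc then (c : ℤ) else 0 := by
  unfold dimVec
  rw [Finset.sum_eq_single p.1.1, Finset.sum_eq_single p.1.2]
  · simp [entry_single]
  · intro l _ hl
    simp [entry_single, hl]
  · simp
  · intro k _ hk
    simp [entry_single, hk]
  · simp

section Step

variable {F : Type} [Field F] {d : ℕ} {h h' : Fin n} {V V' V'' : NStepFlag F n d}

/-- The flag `V''` is obtained from `V'` by enlarging the space at `t` by one dimension. This is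
the relative position given by a simple root. -/
def IsStep (t : Fin (n + 1)) (V'' V' : NStepFlag F n d) : Prop :=
  (∀ u, u ≠ t → V''.space u = V'.space u) ∧ V'.space t ≤ V''.space t ∧
    Module.finrank F (V''.space t) = Module.finrank F (V'.space t) + 1

theorem succ_eq_castSucc_of_val (hh : (h : ℕ) + 1 = h') : h.succ = h'.castSucc := Fin.ext hh

theorem lt_of_val_add_one (hh : (h : ℕ) + 1 = h') : h < h' := by
  rw [Fin.lt_def]; omega

theorem isStep_of_hasOffDiag_ofRoot (hh : (h : ℕ) + 1 = h')
    (H : HasOffDiag (relPos V'' V') (ofRoot (posRoot h h' (lt_of_val_add_one hh)))) :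
    IsStep h'.castSucc V'' V' := by
  have hdim (t : Fin (n + 1)) : (Module.finrank F (V''.space t) : ℤ) =
      Module.finrank F (V'.space t) + if t = h'.castSucc then 1 else 0 := by
    rw [H.finrank_eq t, dimVec_single]
    congr 1
    refine if_congr ?_ rfl rfl
    simp only [Fin.lt_def, Fin.le_def, Fin.ext_iff, Fin.val_castSucc]
    omega
  refine ⟨fun u hu => (Submodule.eq_of_le_of_finrank_eq (H.space_le u) ?_).symm, H.space_le _, ?_⟩
  · have := hdim u
    rw [if_neg hu] at this
    omega
  · have := hdim h'.castSucc
    rw [if_pos rfl] at this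
    omega

theorem IsStep.interDim_eq_interDim_self {t : Fin (n + 1)} (hs : IsStep t V'' V')
    (i j : Fin (n + 1)) :
    interDim V'' V' i j = interDim V' V' i j + if i = t ∧ t < j then 1 else 0 := by
  obtain ⟨hne, hle, hdim⟩ := hs
  by_cases hi : i = t
  · subst hi
    by_cases hj : i < j
    · rw [if_pos ⟨rfl, hj⟩, interDim, interDim, inf_eq_left.2 (V'.mono hj.le), ← hne j hj.ne',
        inf_eq_left.2 (V''.mono hj.le), hdim, Nat.cast_succ]
    · rw [if_neg fun h => hj h.2, interDim, interDim, inf_eq_right.2 (V'.mono (not_lt.1 hj)),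
        inf_eq_right.2 ((V'.mono (not_lt.1 hj)).trans hle), add_zero]
  · rw [if_neg fun h => hi h.1, interDim, interDim, hne i hi, add_zero]

theorem IsStep.hasOffDiag_ofRoot (hh : (h : ℕ) + 1 = h') (hs : IsStep h'.castSucc V'' V') :
    HasOffDiag (relPos V'' V') (ofRoot (posRoot h h' (lt_of_val_add_one hh))) := by
  intro i j hij
  have hself := relPos_self_of_ne V' hij
  have hi : i.succ = h'.castSucc ↔ i = h := by rw [← succ_eq_castSucc_of_val hh, Fin.succ_inj]
  rw [relPos_eq] at hself ⊢
  simp only [hs.interDim_eq_interDim_self, entry_single, Nat.cast_ite, hi, Fin.castSucc_inj,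
    Fin.castSucc_lt_castSucc_iff, Fin.castSucc_lt_succ_iff]
  simp only [Fin.ext_iff, Fin.lt_def, Fin.le_def] at *
  split_ifs <;> omega

theorem hasOffDiag_ofRoot_iff (hh : (h : ℕ) + 1 = h') :
    HasOffDiag (relPos V'' V') (ofRoot (posRoot h h' (lt_of_val_add_one hh))) ↔
      IsStep h'.castSucc V'' V' :=
  ⟨isStep_of_hasOffDiag_ofRoot hh, IsStep.hasOffDiag_ofRoot hh⟩

/-- The space `V'_{t-1} + V_i ∩ V'_t` for the `t`-th step `h'` of `V'`. For `i = 0, …, n` these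
spaces filter the `t`-th step of `V'`, with quotients of the dimensions `relPos V V' i h'`. -/
def layer (V V' : NStepFlag F n d) (h' : Fin n) (i : Fin (n + 1)) : Submodule F (Fin d → F) :=
  V'.space h'.castSucc ⊔ (V.space i ⊓ V'.space h'.succ)

section Layer

variable (V V' : NStepFlag F n d) (h' : Fin n)

theorem layer_mono : Monotone (layer V V' h') :=
  fun _ _ hij => sup_le_sup_left (inf_le_inf_right _ (V.mono hij)) _

theorem layer_zero : layer V V' h' 0 = V'.space h'.castSucc := by
  rw [layer, V.bot, bot_inf_eq, sup_bot_eq]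

theorem layer_last : layer V V' h' (Fin.last n) = V'.space h'.succ := by
  rw [layer, V.top, top_inf_eq, sup_eq_right]
  exact V'.mono Fin.castSucc_lt_succ.le

theorem finrank_layer (i : Fin (n + 1)) :
    (Module.finrank F (layer V V' h' i) : ℤ) = Module.finrank F (V'.space h'.castSucc) +
      (interDim V V' i h'.succ - interDim V V' i h'.castSucc) := by
  rw [layer, inf_comm, finrank_sup_inf_eq, interDim, interDim, inf_comm (V.space i),
    inf_comm (V.space i)]
  ring

theorem finrank_layer_succ (i : Fin n) :
    (Module.finrank F (layer V V' h' i.succ) : ℤ) =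
      Module.finrank F (layer V V' h' i.castSucc) + relPos V V' i h' := by
  rw [finrank_layer, finrank_layer, relPos_eq]
  ring

theorem finrank_layer_eq_sum (i : Fin (n + 1)) :
    (Module.finrank F (layer V V' h' i) : ℤ) = Module.finrank F (V'.space h'.castSucc) +
      ∑ k : Fin n, if k.castSucc < i then relPos V V' k h' else 0 := by
  have telescope := sum_ite_castSucc_lt_sub
    (fun k => (Module.finrank F (layer V V' h' k) : ℤ)) i
  simp only [finrank_layer_succ, add_sub_cancel_left] at telescope
  rw [telescope, layer_zero, add_sub_cancel]

end Layer

theorem IsStep.space_le_space_succ (hs : IsStep h'.castSucc V'' V') :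
    V''.space h'.castSucc ≤ V'.space h'.succ := by
  rw [← hs.1 h'.succ Fin.castSucc_lt_succ.ne']
  exact V''.mono Fin.castSucc_lt_succ.le

open Classical in
theorem IsStep.interDim_eq (hs : IsStep h'.castSucc V'' V') (i j : Fin (n + 1)) :
    interDim V V'' i j = interDim V V' i j +
      if j = h'.castSucc ∧ V''.space h'.castSucc ≤ layer V V' h' i then 1 else 0 := by
  have hle := hs.space_le_space_succ
  obtain ⟨hne, hUL, hdim⟩ := hs
  by_cases hj : j = h'.castSucc
  swap
  · rw [if_neg fun h => hj h.1, interDim, interDim, hne j hj, add_zero]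
  subst hj
  rw [interDim, interDim]
  set L := V''.space h'.castSucc
  set U := V'.space h'.castSucc
  have modular : layer V V' h' i ⊓ L = U ⊔ (V.space i ⊓ L) := by
    rw [layer, sup_inf_assoc_of_le _ hUL, inf_assoc, inf_eq_right.2 hle]
  have dims := Submodule.finrank_sup_add_finrank_inf_eq U (V.space i ⊓ L)
  rw [← modular, inf_left_comm, inf_eq_left.2 hUL] at dims
  by_cases hX : L ≤ layer V V' h' i
  · rw [if_pos ⟨rfl, hX⟩]
    rw [inf_eq_right.2 hX] at dims
    omega
  · rw [if_neg fun h => hX h.2]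
    have hlt := Submodule.finrank_lt_finrank_of_lt
      (lt_of_le_of_ne inf_le_right fun h => hX (inf_eq_right.1 h) : layer V V' h' i ⊓ L < L)
    have hge : Module.finrank F U ≤ Module.finrank F ↥(layer V V' h' i ⊓ L) :=
      Submodule.finrank_mono (le_inf le_sup_left hUL)
    omega

/-- The enlargement from `V'` to `V''` happens in the `k`-th layer. -/
def StepType (V V' V'' : NStepFlag F n d) (h' k : Fin n) : Prop :=
  V''.space h'.castSucc ≤ layer V V' h' k.succ ∧ ¬ V''.space h'.castSucc ≤ layer V V' h' k.castSucc

theorem StepType.space_le_layer_iff {k : Fin n} (hk : StepType V V' V'' h' k) {i : Fin (n + 1)} :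
    V''.space h'.castSucc ≤ layer V V' h' i ↔ k.castSucc < i := by
  constructor
  · exact fun hi => not_le.1 fun hle => hk.2 (hi.trans (layer_mono _ _ _ hle))
  · exact fun hi => hk.1.trans (layer_mono _ _ _ (Fin.castSucc_lt_iff_succ_le.1 hi))

theorem StepType.unique {k l : Fin n} (hk : StepType V V' V'' h' k)
    (hl : StepType V V' V'' h' l) : k = l := by
  have hkl := hl.space_le_layer_iff.1 hk.1
  have hlk := hk.space_le_layer_iff.1 hl.1
  rw [Fin.castSucc_lt_succ_iff] at hkl hlk
  exact hlk.antisymm hkl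

theorem IsStep.existsUnique_stepType (hs : IsStep h'.castSucc V'' V') :
    ∃! k, StepType V V' V'' h' k := by
  suffices h : ∃ k, StepType V V' V'' h' k from
    h.elim fun k hk => ⟨k, hk, fun l hl => hl.unique hk⟩
  by_contra! hne
  have not_le (t : Fin (n + 1)) : ¬ V''.space h'.castSucc ≤ layer V V' h' t := by
    induction t using Fin.induction with
    | zero =>
      rw [layer_zero]
      intro hle
      have := Submodule.finrank_mono hle
      have := hs.2.2
      omega
    | succ k ih => exact fun hle => hne k ⟨hle, ih⟩
  exact not_le (Fin.last n) ((layer_last V V' h').symm ▸ hs.space_le_space_succ)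

/-- The matrix `Z + E_{kh} - E_{kh'}`. -/
def moveMat (Z : Matrix (Fin n) (Fin n) ℤ) (k h h' : Fin n) : Matrix (Fin n) (Fin n) ℤ :=
  fun i j => Z i j + if i = k then (if j = h then 1 else 0) - (if j = h' then 1 else 0) else 0

theorem IsStep.relPos_eq_moveMat (hh : (h : ℕ) + 1 = h') {k : Fin n}
    (hs : IsStep h'.castSucc V'' V') (hk : StepType V V' V'' h' k) :
    relPos V V'' = moveMat (relPos V V') k h h' := by
  classical
  ext i j
  have hj : j.succ = h'.castSucc ↔ j = h := by rw [← succ_eq_castSucc_of_val hh, Fin.succ_inj]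
  rw [moveMat, relPos_eq, relPos_eq, hs.interDim_eq, hs.interDim_eq, hs.interDim_eq,
    hs.interDim_eq]
  simp only [hk.space_le_layer_iff, hj, Fin.castSucc_inj, Fin.castSucc_lt_castSucc_iff,
    Fin.castSucc_lt_succ_iff]
  simp only [Fin.ext_iff, Fin.lt_def, Fin.le_def] at *
  split_ifs <;> omega

/-- The flag obtained from `V'` by replacing the space at `h'.castSucc` by `L`. -/
def replaceFlag (V' : NStepFlag F n d) (hh : (h : ℕ) + 1 = h') (L : Submodule F (Fin d → F))
    (h1 : V'.space h'.castSucc ≤ L) (h2 : L ≤ V'.space h'.succ) : NStepFlag F n d where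
  space := Function.update V'.space h'.castSucc L
  mono := by
    intro a b hab
    rcases eq_or_lt_of_le hab with rfl | hab
    · exact le_rfl
    by_cases ha : a = h'.castSucc
    · subst ha
      rw [Function.update_self, Function.update_of_ne hab.ne']
      exact h2.trans (V'.mono (Fin.castSucc_lt_iff_succ_le.1 hab))
    · rw [Function.update_of_ne ha]
      by_cases hb : b = h'.castSucc
      · subst hb
        rw [Function.update_self]
        exact (V'.mono hab.le).trans h1
      · rw [Function.update_of_ne hb]
        exact V'.mono hab.le
  bot := by
    rw [Function.update_of_ne, V'.bot]
    rw [← succ_eq_castSucc_of_val hh]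
    exact (Fin.succ_ne_zero h).symm
  top := by
    rw [Function.update_of_ne, V'.top]
    exact (Fin.castSucc_lt_last _).ne'

/-- The bijection which sends a flag `V''`, enlarged from `V'` in the `k`-th layer, to its new
subspace. -/
def stepEquiv (hh : (h : ℕ) + 1 = h') (V V' : NStepFlag F n d) (k : Fin n) :
    {V'' : NStepFlag F n d // IsStep h'.castSucc V'' V' ∧ StepType V V' V'' h' k} ≃
      Enlargement (V'.space h'.castSucc) (layer V V' h' k.castSucc) (layer V V' h' k.succ) where
  toFun W := ⟨W.1.space h'.castSucc, W.2.1.2.1, W.2.1.2.2, W.2.2.1, W.2.2.2⟩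
  invFun L :=
    have hle : L.1 ≤ V'.space h'.succ :=
      L.2.2.2.1.trans ((layer_mono V V' h' (Fin.le_last _)).trans (layer_last V V' h').le)
    have hL : (replaceFlag V' hh L.1 L.2.1 hle).space h'.castSucc = L.1 := Function.update_self ..
    ⟨replaceFlag V' hh L.1 L.2.1 hle,
      ⟨fun _ hu => Function.update_of_ne hu _ _, hL.symm ▸ L.2.1, hL.symm ▸ L.2.2.1⟩,
      hL.symm ▸ L.2.2.2.1, hL.symm ▸ L.2.2.2.2⟩
  left_inv W := by
    refine Subtype.ext (NStepFlag.ext fun i => ?_)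
    by_cases hi : i = h'.castSucc
    · subst hi
      exact Function.update_self ..
    · exact (Function.update_of_ne hi _ _).trans (W.2.1.1 i hi).symm
  right_inv L := Subtype.ext (Function.update_self ..)

theorem natCard_stepType [Finite F] (hh : (h : ℕ) + 1 = h') (V V' : NStepFlag F n d) (k : Fin n) :
    (Nat.card {V'' : NStepFlag F n d // IsStep h'.castSucc V'' V' ∧ StepType V V' V'' h' k} : ℤ) =
      (Nat.card F : ℤ) ^ (∑ i, if i < k then relPos V V' i h' else 0).toNat *
        ∑ t ∈ Finset.range (relPos V V' k h').toNat, (Nat.card F : ℤ) ^ t := by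
  have sum_nonneg : 0 ≤ ∑ i, if i < k then relPos V V' i h' else 0 :=
    Finset.sum_nonneg fun i _ => ite_nonneg (relPos_nonneg V V' i h') le_rfl
  have below := finrank_layer_eq_sum V V' h' k.castSucc
  have next := finrank_layer_succ V V' h' k
  have entry_nonneg := relPos_nonneg V V' k h'
  simp only [Fin.castSucc_lt_castSucc_iff] at below
  rw [Nat.card_congr (stepEquiv hh V V' k)]
  refine natCard_enlargement le_sup_left (layer_mono _ _ _ Fin.castSucc_lt_succ.le) ?_ ?_
  · omega
  · omega

end Step

/-! ### Integral combinations of relative positions -/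

theorem infinite_image_odd_primes : ((↑) '' {p : ℕ | p.Prime ∧ p ≠ 2} : Set ℤ).Infinite :=
  (Nat.infinite_setOfPred_prime.sdiff (Set.finite_singleton 2)).image Nat.cast_injective.injOn

theorem eq_of_eval_odd_primes {P Q : ℤ[X]}
    (h : ∀ p : ℕ, p.Prime → p ≠ 2 → P.eval (p : ℤ) = Q.eval (p : ℤ)) : P = Q := by
  refine eq_of_infinite_eval_eq P Q (infinite_image_odd_primes.mono ?_)
  rintro _ ⟨p, hp, rfl⟩
  exact h p hp.1 hp.2

instance (F : Type) [Field F] [Finite F] (n d : ℕ) : Finite (NStepFlag F n d) :=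
  Finite.of_injective (fun V => V.space) fun _ _ h => NStepFlag.ext (congrFun h)

instance (F : Type) [Field F] [Finite F] (n d : ℕ) : Fintype (NStepFlag F n d) := Fintype.ofFinite _

instance (F : Type) [Field F] (n d : ℕ) : DecidableEq (NStepFlag F n d) := Classical.decEq _

open Classical in
/-- The indicator matrix of the pairs of flags whose relative position is upper triangular with
off-diagonal part `A`. The diagonal is left free, so that one matrix product counts the flags for
all structure constants with given off-diagonal parts. -/
def orbitMatrix (F : Type) [Field F] (d : ℕ) (A : KostantPartition n) :
    Matrix (NStepFlag F n d) (NStepFlag F n d) ℤ :=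
  Matrix.of fun V V' => if HasOffDiag (relPos V V') A then 1 else 0

section HallEval

variable (F : Type) [Field F] (d : ℕ)

open Classical in
theorem orbitMatrix_apply (A : KostantPartition n) (V V' : NStepFlag F n d) :
    orbitMatrix F d A V V' = if HasOffDiag (relPos V V') A then 1 else 0 := rfl

/-- The specialization at `q = |F|`, which sends `∑ P_C C` to `∑ P_C(q) orbitMatrix F d C`. -/
def hallEval : (KostantPartition n →₀ ℤ[X]) →+ Matrix (NStepFlag F n d) (NStepFlag F n d) ℤ :=
  Finsupp.liftAddHom fun C =>
    { toFun := fun P => P.eval (Nat.card F : ℤ) • orbitMatrix F d C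
      map_zero' := by rw [eval_zero, zero_smul]
      map_add' := fun P Q => by rw [eval_add, add_smul] }

theorem hallEval_eq_sum (φ : KostantPartition n →₀ ℤ[X]) :
    hallEval F d φ = φ.sum fun C P => P.eval (Nat.card F : ℤ) • orbitMatrix F d C := rfl

theorem hallEval_single (C : KostantPartition n) (P : ℤ[X]) :
    hallEval F d (Finsupp.single C P) = P.eval (Nat.card F : ℤ) • orbitMatrix F d C :=
  Finsupp.liftAddHom_apply_single _ C P

theorem hallEval_single_one (C : KostantPartition n) :
    hallEval F d (Finsupp.single C 1) = orbitMatrix F d C := by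
  rw [hallEval_single, eval_one, one_smul]

theorem hallEval_smul (P : ℤ[X]) (φ : KostantPartition n →₀ ℤ[X]) :
    hallEval F d (P • φ) = P.eval (Nat.card F : ℤ) • hallEval F d φ := by
  induction φ using Finsupp.induction_linear with
  | zero => simp
  | add φ ψ h1 h2 => rw [smul_add, map_add, map_add, smul_add, h1, h2]
  | single C Q =>
    rw [Finsupp.smul_single, hallEval_single, hallEval_single, smul_eq_mul, eval_mul, mul_smul]

theorem hallEval_apply {C : KostantPartition n} {V V' : NStepFlag F n d}
    (h : HasOffDiag (relPos V V') C) (φ : KostantPartition n →₀ ℤ[X]) :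
    hallEval F d φ V V' = (φ C).eval (Nat.card F : ℤ) := by
  classical
  induction φ using Finsupp.induction_linear with
  | zero => simp
  | add φ ψ h1 h2 => rw [map_add, Matrix.add_apply, h1, h2, Finsupp.add_apply, eval_add]
  | single D Q =>
    rw [hallEval_single, Matrix.smul_apply, orbitMatrix_apply, Finsupp.single_apply]
    by_cases hD : D = C
    · subst hD
      rw [if_pos h, if_pos rfl, smul_eq_mul, mul_one]
    · rw [if_neg fun h' => hD (h'.unique h), if_neg hD, smul_zero, eval_zero]

theorem hallEval_apply_eq_zero {V V' : NStepFlag F n d}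
    (h : ∀ C, ¬ HasOffDiag (relPos V V') C) (φ : KostantPartition n →₀ ℤ[X]) :
    hallEval F d φ V V' = 0 := by
  classical
  rw [hallEval_eq_sum, Finsupp.sum, Matrix.sum_apply]
  refine Finset.sum_eq_zero fun C _ => ?_
  rw [Matrix.smul_apply, orbitMatrix_apply, if_neg (h C), smul_zero]

variable {F d} {g : KostantPartition n → KostantPartition n →₀ ℤ[X]}

theorem hallEval_sum_smul (φ : KostantPartition n →₀ ℤ[X]) :
    hallEval F d (φ.sum fun E P => P • g E) =
      φ.sum fun E P => P.eval (Nat.card F : ℤ) • hallEval F d (g E) := by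
  rw [map_finsuppSum]
  exact Finsupp.sum_congr fun E _ => hallEval_smul F d _ _

variable [Finite F] {M : Matrix (NStepFlag F n d) (NStepFlag F n d) ℤ}

theorem hallEval_mul_of_forall (hg : ∀ E, orbitMatrix F d E * M = hallEval F d (g E))
    (φ : KostantPartition n →₀ ℤ[X]) :
    hallEval F d φ * M = hallEval F d (φ.sum fun E P => P • g E) := by
  rw [hallEval_sum_smul, hallEval_eq_sum, Finsupp.sum_mul]
  exact Finsupp.sum_congr fun E _ => by rw [smul_mul_assoc, hg]

theorem mul_hallEval_of_forall (hg : ∀ E, M * orbitMatrix F d E = hallEval F d (g E))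
    (φ : KostantPartition n →₀ ℤ[X]) :
    M * hallEval F d φ = hallEval F d (φ.sum fun E P => P • g E) := by
  rw [hallEval_sum_smul, hallEval_eq_sum, Finsupp.mul_sum]
  exact Finsupp.sum_congr fun E _ => by rw [mul_smul_comm, hg]

end HallEval

/-- The strictly upper triangular matrix `A`. -/
def toMat (A : KostantPartition n) : Matrix (Fin n) (Fin n) ℤ := fun i j => entry A i j

theorem hasOffDiag_toMat (A : KostantPartition n) : HasOffDiag (toMat A) A := fun _ _ _ => rfl

/-- The sum of the entries, which is the least dimension in which `A` is the off-diagonal part of a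
relative position of flags. -/
def size (A : KostantPartition n) : ℕ := ∑ i, ∑ j, entry A i j

theorem isTheta_toMat (A : KostantPartition n) : IsTheta (size A) (toMat A) :=
  ⟨fun _ _ => Nat.cast_nonneg _, by simp only [toMat, size, Nat.cast_sum]⟩

theorem exists_hasOffDiag (F : Type) [Field F] (A : KostantPartition n) :
    ∃ V V' : NStepFlag F n (size A), HasOffDiag (relPos V V') A := by
  obtain ⟨V, V', h⟩ := exists_relPos_eq F (isTheta_toMat A)
  exact ⟨V, V', h ▸ hasOffDiag_toMat A⟩

theorem hallEval_ext {φ ψ : KostantPartition n →₀ ℤ[X]}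
    (h : ∀ (F : Type) [Field F] [Finite F] (d : ℕ), hallEval F d φ = hallEval F d ψ) : φ = ψ := by
  ext1 C
  refine eq_of_eval_odd_primes fun p hp _ => ?_
  have : Fact p.Prime := ⟨hp⟩
  obtain ⟨V, V', hV⟩ := exists_hasOffDiag (ZMod p) C
  have := congrFun (congrFun (h (ZMod p) (size C)) V) V'
  rwa [hallEval_apply _ _ hV, hallEval_apply _ _ hV, Nat.card_zmod] at this

theorem orbitMatrix_mul_apply (F : Type) [Field F] [Finite F] (d : ℕ) (A B : KostantPartition n)
    (V V' : NStepFlag F n d) : (orbitMatrix F d A * orbitMatrix F d B) V V' =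
      Nat.card {V'' : NStepFlag F n d //
        HasOffDiag (relPos V V'') A ∧ HasOffDiag (relPos V'' V') B} := by
  classical
  rw [Matrix.mul_apply, Nat.card_eq_fintype_card, Fintype.card_subtype, ← Finset.sum_boole]
  refine Finset.sum_congr rfl fun W _ => ?_
  rw [orbitMatrix_apply, orbitMatrix_apply, ite_and, ite_mul, one_mul, zero_mul]

/-! ### Multiplication with a simple root element -/

/-- `A - E_{kh} + E_{kh'}` (where `E_{kh}` is omitted if `k = h`). -/
def movePart (A : KostantPartition n) (k h h' : Fin n) : KostantPartition n := fun p =>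
  A p + (if p.1.1 = k ∧ p.1.2 = h' then 1 else 0) - (if p.1.1 = k ∧ p.1.2 = h then 1 else 0)

/-- A unit of the row `k` may be moved from the column `h` to the column `h'`. There is always one
at `k = h`, since the diagonal is free. -/
def CanMove (A : KostantPartition n) (k h : Fin n) : Prop := k = h ∨ 0 < entry A k h

section Move

variable {A : KostantPartition n} {h h' k : Fin n}

theorem lt_of_entry_pos {i j : Fin n} (hA : 0 < entry A i j) : i < j :=
  not_not.1 fun hij => hA.ne' (entry_of_not_lt A hij)

theorem CanMove.le (hk : CanMove A k h) : k ≤ h :=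
  hk.elim le_of_eq fun hA => (lt_of_entry_pos hA).le

theorem CanMove.entry_pos (hk : CanMove A k h) (hkh : k ≠ h) : 0 < entry A k h :=
  hk.resolve_left hkh

theorem entry_movePart (A : KostantPartition n) {i j : Fin n} (hij : i < j) :
    entry (movePart A k h h') i j = entry A i j + (if i = k ∧ j = h' then 1 else 0) -
      (if i = k ∧ j = h then 1 else 0) := by
  rw [entry_of_lt _ hij, entry_of_lt _ hij]
  rfl

theorem movePart_self (A : KostantPartition n) (hlt : h < h') :
    movePart A h h h' = A + ofRoot (posRoot h h' hlt) := by
  refine KostantPartition.ext_entry fun i j hij => ?_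
  rw [entry_movePart _ hij, entry_add, entry_single, if_neg (c := i = h ∧ j = h), Nat.sub_zero]
  rintro ⟨rfl, rfl⟩
  exact lt_irrefl _ hij

theorem movePart_add (A : KostantPartition n) (hkh : k < h) (hkh' : k < h') :
    movePart (A + ofRoot (posRoot k h hkh)) k h h' = A + ofRoot (posRoot k h' hkh') := by
  refine KostantPartition.ext_entry fun i j hij => ?_
  rw [entry_movePart _ hij, entry_add, entry_add, entry_single, entry_single, add_right_comm,
    Nat.add_sub_cancel]

theorem exists_eq_add_ofRoot (hA : 0 < entry A k h) :
    ∃ (hkh : k < h) (B : KostantPartition n), A = B + ofRoot (posRoot k h hkh) := by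
  have hkh := lt_of_entry_pos hA
  refine ⟨hkh, A - ofRoot (posRoot k h hkh), (tsub_add_cancel_of_le fun p => ?_).symm⟩
  obtain rfl | hp := eq_or_ne p (posRoot k h hkh)
  · rw [entry_of_lt] at hA
    simpa using Nat.succ_le_of_lt hA
  · simp [hp]

theorem cast_entry_movePart (hk : CanMove A k h) (hh : h < h') {i j : Fin n} (hij : i ≠ j) :
    (entry (movePart A k h h') i j : ℤ) = entry A i j -
      if i = k then (if j = h then 1 else 0) - (if j = h' then 1 else 0) else 0 := by
  by_cases hlt : i < j
  · have hpos : i = k → j = h → 0 < entry A i j := by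
      rintro rfl rfl
      exact hk.entry_pos hij
    rw [entry_movePart _ hlt]
    split_ifs <;> simp_all
  · have hcol (l : Fin n) (hl : h ≤ l) : i = k → j ≠ l := by
      rintro rfl rfl
      exact hlt (lt_of_le_of_ne (hk.le.trans hl) hij)
    rw [entry_of_not_lt _ hlt, entry_of_not_lt _ hlt]
    by_cases hi : i = k
    · rw [if_pos hi, if_neg (hcol h le_rfl hi), if_neg (hcol h' hh.le hi), sub_zero, sub_zero]
    · rw [if_neg hi, sub_zero]

theorem canMove_of_hasOffDiag_moveMat {Z : Matrix (Fin n) (Fin n) ℤ} (hZ : ∀ i j, 0 ≤ Z i j)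
    (hh : h < h') (H : HasOffDiag (moveMat Z k h h') A) : CanMove A k h := by
  refine or_iff_not_imp_left.2 fun hkh => ?_
  have hkh' := H k h hkh
  rw [moveMat, if_pos rfl, if_pos rfl, if_neg hh.ne] at hkh'
  have := hZ k h
  omega

theorem hasOffDiag_moveMat_iff {Z : Matrix (Fin n) (Fin n) ℤ} (hZ : ∀ i j, 0 ≤ Z i j)
    (hh : h < h') :
    HasOffDiag (moveMat Z k h h') A ↔ CanMove A k h ∧ HasOffDiag Z (movePart A k h h') := by
  rw [← and_iff_right_of_imp (canMove_of_hasOffDiag_moveMat hZ hh)]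
  refine and_congr_right fun hk => forall₃_congr fun i j hij => ?_
  rw [cast_entry_movePart hk hh hij, moveMat, eq_sub_iff_add_eq]

/-- The polynomial `q^{∑_{i < k} a_{ih'}} [a_{kh'} + 1]_q`. -/
def chevCoeff (A : KostantPartition n) (k h' : Fin n) : ℤ[X] :=
  X ^ (∑ i, if i < k then entry A i h' else 0) * ∑ t ∈ Finset.range (entry A k h' + 1), X ^ t

open Classical in
/-- The product of the basis element `A` with the basis element `E_{hh'}`, where `h' = h + 1`
(named after the Chevalley generators of the quantum group). -/
def chevProd (A : KostantPartition n) (h h' : Fin n) : KostantPartition n →₀ ℤ[X] :=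
  ∑ k, if CanMove A k h then Finsupp.single (movePart A k h h') (chevCoeff A k h') else 0

end Move

section Chevalley

variable (F : Type) [Field F] (d : ℕ) {A : KostantPartition n} {h h' k : Fin n}

open Classical in
theorem hallEval_chevProd_apply (hlt : h < h') (V V' : NStepFlag F n d) :
    hallEval F d (chevProd A h h') V V' = ∑ k,
      if HasOffDiag (moveMat (relPos V V') k h h') A then
        (chevCoeff A k h').eval (Nat.card F : ℤ) else 0 := by
  rw [chevProd, map_sum, Matrix.sum_apply]
  refine Finset.sum_congr rfl fun k _ => ?_
  rw [if_congr (hasOffDiag_moveMat_iff (relPos_nonneg V V') hlt) rfl rfl, ite_and]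
  split_ifs with hk hA
  · rw [hallEval_single, Matrix.smul_apply, orbitMatrix_apply, if_pos hA, smul_eq_mul, mul_one]
  · rw [hallEval_single, Matrix.smul_apply, orbitMatrix_apply, if_neg hA, smul_zero]
  · rw [map_zero, Matrix.zero_apply]

variable [Finite F]

open Classical in
theorem orbitMatrix_mul_ofRoot_apply (hh : (h : ℕ) + 1 = h') (V V' : NStepFlag F n d) :
    (orbitMatrix F d A * orbitMatrix F d (ofRoot (posRoot h h' (lt_of_val_add_one hh)))) V V' =
      ∑ k, if HasOffDiag (moveMat (relPos V V') k h h') A then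
        (Nat.card {W : NStepFlag F n d // IsStep h'.castSucc W V' ∧ StepType V V' W h' k} : ℤ)
          else 0 := by
  have summand (W : NStepFlag F n d) : orbitMatrix F d A V W *
      orbitMatrix F d (ofRoot (posRoot h h' (lt_of_val_add_one hh))) W V' = ∑ k,
        if HasOffDiag (moveMat (relPos V V') k h h') A then
          if IsStep h'.castSucc W V' ∧ StepType V V' W h' k then (1 : ℤ) else 0 else 0 := by
    rw [orbitMatrix_apply, orbitMatrix_apply, if_congr (hasOffDiag_ofRoot_iff hh) rfl rfl]
    by_cases hs : IsStep h'.castSucc W V'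
    · obtain ⟨k, hk, hu⟩ := hs.existsUnique_stepType (V := V)
      rw [Fintype.sum_eq_single k fun l hl => ?_, hs.relPos_eq_moveMat hh hk, if_pos hs,
        if_pos (c := _ ∧ _) ⟨hs, hk⟩, mul_one]
      rw [if_neg (c := _ ∧ _) fun h => hl (hu l h.2), ite_self]
    · simp [hs]
  rw [Matrix.mul_apply, Finset.sum_congr rfl fun W _ => summand W, Finset.sum_comm]
  refine Finset.sum_congr rfl fun k _ => ?_
  by_cases hA : HasOffDiag (moveMat (relPos V V') k h h') A
  · simp only [if_pos hA]
    rw [Finset.sum_boole, ← Fintype.card_subtype, ← Nat.card_eq_fintype_card]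
  · simp only [if_neg hA, Finset.sum_const_zero]

theorem natCard_stepType_of_hasOffDiag (hh : (h : ℕ) + 1 = h') {V V' : NStepFlag F n d}
    (hA : HasOffDiag (moveMat (relPos V V') k h h') A) :
    (Nat.card {W : NStepFlag F n d // IsStep h'.castSucc W V' ∧ StepType V V' W h' k} : ℤ) =
      (chevCoeff A k h').eval (Nat.card F : ℤ) := by
  have hlt := lt_of_val_add_one hh
  have hk : k ≤ h := (canMove_of_hasOffDiag_moveMat (relPos_nonneg V V') hlt hA).le
  have at_row : relPos V V' k h' = entry A k h' + 1 := by
    have := hA k h' (hk.trans_lt hlt).ne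
    rw [moveMat, if_pos rfl, if_neg hlt.ne', if_pos rfl] at this
    omega
  have above_row : (∑ i, if i < k then relPos V V' i h' else 0) =
      ((∑ i, if i < k then entry A i h' else 0 : ℕ) : ℤ) := by
    rw [Nat.cast_sum]
    refine Finset.sum_congr rfl fun i _ => ?_
    by_cases hik : i < k
    · have := hA i h' ((hik.trans_le hk).trans hlt).ne
      rw [moveMat, if_neg hik.ne, add_zero] at this
      rw [if_pos hik, if_pos hik, this]
    · rw [if_neg hik, if_neg hik, Nat.cast_zero]
  rw [natCard_stepType hh, at_row, above_row, Int.toNat_natCast, chevCoeff, eval_mul, eval_pow,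
    eval_X, eval_finsetSum]
  simp only [eval_pow, eval_X]
  rfl

theorem orbitMatrix_mul_ofRoot (A : KostantPartition n) (hh : (h : ℕ) + 1 = h') :
    orbitMatrix F d A * orbitMatrix F d (ofRoot (posRoot h h' (lt_of_val_add_one hh))) =
      hallEval F d (chevProd A h h') := by
  classical
  ext V V'
  rw [hallEval_chevProd_apply F d (lt_of_val_add_one hh), orbitMatrix_mul_ofRoot_apply F d hh]
  exact Finset.sum_congr rfl fun k _ =>
    ite_congr rfl (fun hA => natCard_stepType_of_hasOffDiag F d hh hA) fun _ => rfl

end Chevalley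

/-! ### Hall polynomials -/

theorem orbitMatrix_zero (F : Type) [Field F] [Finite F] (d : ℕ) :
    orbitMatrix F d (0 : KostantPartition n) = 1 := by
  classical
  ext V V'
  rw [orbitMatrix_apply, Matrix.one_apply]
  exact if_congr hasOffDiag_zero_iff rfl rfl

/-- The combinations `ψ` such that the products `A * ψ` are given by polynomials in `q`. The theorem
`single_mem_hallSubmodule` says that this is everything; the submodule is the induction predicate of
its proof. -/
def hallSubmodule (n : ℕ) : Submodule ℤ[X] (KostantPartition n →₀ ℤ[X]) where
  carrier := {ψ | ∀ A, ∃ φ, ∀ (F : Type) [Field F] [Finite F] (d : ℕ),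
    orbitMatrix F d A * hallEval F d ψ = hallEval F d φ}
  zero_mem' _ := ⟨0, fun F _ _ d => by rw [map_zero, mul_zero]⟩
  add_mem' hψ hχ A := by
    obtain ⟨φ, hφ⟩ := hψ A
    obtain ⟨φ', hφ'⟩ := hχ A
    exact ⟨φ + φ', fun F _ _ d => by rw [map_add, map_add, mul_add, hφ, hφ']⟩
  smul_mem' P ψ hψ A := by
    obtain ⟨φ, hφ⟩ := hψ A
    exact ⟨P • φ, fun F _ _ d => by rw [hallEval_smul, hallEval_smul, mul_smul_comm, hφ]⟩

theorem single_zero_mem_hallSubmodule : Finsupp.single 0 1 ∈ hallSubmodule n := fun A =>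
  ⟨Finsupp.single A 1, fun F _ _ d => by
    rw [hallEval_single_one, hallEval_single_one, orbitMatrix_zero, mul_one]⟩

theorem chevProd_mem_hallSubmodule {A : KostantPartition n}
    (hA : Finsupp.single A 1 ∈ hallSubmodule n) {h h' : Fin n} (hh : (h : ℕ) + 1 = h') :
    chevProd A h h' ∈ hallSubmodule n := fun B => by
  obtain ⟨φ, hφ⟩ := hA B
  refine ⟨φ.sum fun C P => P • chevProd C h h', fun F _ _ d => ?_⟩
  rw [← orbitMatrix_mul_ofRoot F d A hh, ← mul_assoc, ← hallEval_single_one F d A, hφ]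
  exact hallEval_mul_of_forall (fun C => orbitMatrix_mul_ofRoot F d C hh) φ

theorem dvd_of_orbitMatrix_mul_hallEval_smul {φ ψ : KostantPartition n →₀ ℤ[X]} {D : ℤ[X]}
    (hD : D.Monic) {A : KostantPartition n} (hψ : ∀ (F : Type) [Field F] [Finite F] (d : ℕ),
      orbitMatrix F d A * hallEval F d (D • φ) = hallEval F d ψ) (C : KostantPartition n) :
    D ∣ ψ C := by
  refine dvd_of_infinite_eval_dvd_eval hD (infinite_image_odd_primes.mono ?_)
  rintro _ ⟨p, hp, rfl⟩
  have : Fact p.Prime := ⟨hp.1⟩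
  obtain ⟨V, V', hV⟩ := exists_hasOffDiag (ZMod p) C
  have hval := congrFun₂ (hψ (ZMod p) (size C)) V V'
  rw [hallEval_apply _ _ hV, hallEval_smul, mul_smul_comm, Matrix.smul_apply,
    Nat.card_zmod] at hval
  exact Dvd.intro _ hval

theorem mem_hallSubmodule_of_smul_mem {φ : KostantPartition n →₀ ℤ[X]} {D : ℤ[X]} (hD : D.Monic)
    (hpos : ∀ q : ℤ, 0 < q → D.eval q ≠ 0) (h : D • φ ∈ hallSubmodule n) :
    φ ∈ hallSubmodule n := fun A => by
  obtain ⟨ψ, hψ⟩ := h A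
  have hdvd := dvd_of_orbitMatrix_mul_hallEval_smul hD hψ
  obtain ⟨χ, rfl⟩ : ∃ χ, ψ = D • χ := by
    refine ⟨ψ.mapRange (· /ₘ D) (zero_divByMonic D), Finsupp.ext fun C => ?_⟩
    obtain ⟨Q, hQ⟩ := hdvd C
    rw [Finsupp.smul_apply, Finsupp.mapRange_apply, smul_eq_mul, hQ,
      mul_divByMonic_cancel_left _ hD]
  refine ⟨χ, fun F _ _ d => smul_right_injective _ (hpos (Nat.card F) ?_) ?_⟩
  · exact Nat.cast_pos.2 Nat.card_pos
  · dsimp only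
    rw [← mul_smul_comm, ← hallEval_smul, ← hallEval_smul, hψ]

/-- A measure of the right factor for the construction of the Hall polynomials by induction. Moving
a unit of the row `k` one column to the right adds `n - k` to it. -/
def hallMeasure (A : KostantPartition n) : ℕ :=
  ∑ p : PosRoot n, A p * ((n - (p.1.1 : ℕ)) * ((p.1.2 : ℕ) - (p.1.1 : ℕ)))

theorem hallMeasure_add (A B : KostantPartition n) :
    hallMeasure (A + B) = hallMeasure A + hallMeasure B := by
  simp only [hallMeasure, Pi.add_apply, add_mul, Finset.sum_add_distrib]

theorem hallMeasure_ofRoot (p : PosRoot n) :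
    hallMeasure (ofRoot p) = (n - (p.1.1 : ℕ)) * ((p.1.2 : ℕ) - (p.1.1 : ℕ)) := by
  rw [hallMeasure, Fintype.sum_eq_single p fun q hq => by simp [hq]]
  simp

theorem hallMeasure_movePart {A : KostantPartition n} {k h h' : Fin n} (hh : (h : ℕ) + 1 = h')
    (hk : CanMove A k h) : hallMeasure (movePart A k h h') = hallMeasure A + (n - (k : ℕ)) := by
  have hlt := lt_of_val_add_one hh
  obtain rfl | hA := hk
  · rw [movePart_self A hlt, hallMeasure_add, hallMeasure_ofRoot]
    simp only [← hh, Nat.add_sub_cancel_left, mul_one]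
  · obtain ⟨hkh, B, rfl⟩ := exists_eq_add_ofRoot hA
    rw [movePart_add B hkh (hkh.trans hlt), hallMeasure_add, hallMeasure_add, hallMeasure_ofRoot,
      hallMeasure_ofRoot, add_assoc, add_right_inj]
    simp only [← hh]
    rw [Nat.sub_add_comm (Fin.le_def.1 hkh.le), mul_add, mul_one]

theorem exists_first_row {B : KostantPartition n} (hB : B ≠ 0) :
    ∃ k h', 0 < entry B k h' ∧ ∀ i j, i < k → entry B i j = 0 := by
  have hex : ∃ k, ∃ h', entry B k h' ≠ 0 := by
    by_contra! hzero
    exact hB (KostantPartition.ext_entry fun i j _ => by rw [hzero, entry_zero])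
  obtain ⟨k, ⟨h', hk⟩, hmin⟩ := WellFounded.has_min wellFounded_lt {k | ∃ h', entry B k h' ≠ 0} hex
  exact ⟨k, h', Nat.pos_of_ne_zero hk, fun i j hi => not_not.1 fun hij => hmin i ⟨j, hij⟩ hi⟩

theorem exists_movePart_eq {B : KostantPartition n} (hB : B ≠ 0) :
    ∃ (A : KostantPartition n) (k h h' : Fin n), (h : ℕ) + 1 = h' ∧ CanMove A k h ∧
      movePart A k h h' = B ∧ ∀ i j, i < k → entry A i j = 0 := by
  obtain ⟨k, h', hpos, hmin⟩ := exists_first_row hB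
  obtain ⟨hkh', B, rfl⟩ := exists_eq_add_ofRoot hpos
  simp only [entry_add, Nat.add_eq_zero_iff] at hmin
  obtain ⟨h, hh⟩ : ∃ h : Fin n, (h : ℕ) + 1 = h' :=
    ⟨⟨(h' : ℕ) - 1, by omega⟩, Nat.sub_add_cancel (Nat.one_le_of_lt (Fin.lt_def.1 hkh'))⟩
  have hkh : k ≤ h := Fin.le_def.2 (by omega)
  rcases eq_or_lt_of_le hkh with rfl | hlt
  · exact ⟨B, k, k, h', hh, Or.inl rfl, movePart_self _ _, fun i j hi => (hmin i j hi).1⟩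
  · refine ⟨B + ofRoot (posRoot k h hlt), k, h, h', hh, Or.inr ?_, movePart_add _ _ _,
      fun i j hi => ?_⟩
    · rw [entry_add, entry_single, if_pos ⟨rfl, rfl⟩]
      exact Nat.succ_pos _
    · rw [entry_add, entry_single, (hmin i j hi).1, if_neg fun hik => hi.ne hik.1]

theorem chevCoeff_eq_geom_sum {A : KostantPartition n} {k : Fin n} (h' : Fin n)
    (hmin : ∀ i j, i < k → entry A i j = 0) :
    chevCoeff A k h' = ∑ t ∈ Finset.range (entry A k h' + 1), X ^ t := by
  have hzero : (∑ i, if i < k then entry A i h' else 0) = 0 :=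
    Finset.sum_eq_zero fun i _ => ite_eq_right_iff.2 (hmin i h')
  rw [chevCoeff, hzero, pow_zero, one_mul]

theorem eval_geom_sum_ne_zero (m : ℕ) {q : ℤ} (hq : 0 < q) :
    (∑ t ∈ Finset.range (m + 1), X ^ t : ℤ[X]).eval q ≠ 0 := by
  simp only [eval_finsetSum, eval_pow, eval_X]
  exact (Finset.sum_pos (fun t _ => pow_pos hq t) Finset.nonempty_range_add_one).ne'

/-- The term of `chevProd A h h'` in the first row `k` is a quantum integer times `B`, and all other
terms have a smaller measure than `B`. -/
theorem single_mem_hallSubmodule (B : KostantPartition n) :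
    Finsupp.single B 1 ∈ hallSubmodule n := by
  classical
  induction hm : hallMeasure B using Nat.strong_induction_on generalizing B with | _ m ih
  obtain rfl | hB := eq_or_ne B 0
  · exact single_zero_mem_hallSubmodule
  obtain ⟨A, k, h, h', hh, hk, rfl, hmin⟩ := exists_movePart_eq hB
  rw [hallMeasure_movePart hh hk] at hm
  have row_ge {k' : Fin n} (hc : CanMove A k' h) : k ≤ k' := by
    refine not_lt.1 fun hlt => ?_
    exact (hc.entry_pos (hlt.trans_le hk.le).ne).ne' (hmin k' h hlt)
  have hrest : (∑ k' ∈ Finset.univ.erase k, if CanMove A k' h then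
      Finsupp.single (movePart A k' h h') (chevCoeff A k' h') else 0) ∈ hallSubmodule n := by
    refine Submodule.sum_mem _ fun k' hk' => ?_
    split_ifs with hc
    · have hkk' : k < k' := lt_of_le_of_ne (row_ge hc) (Finset.ne_of_mem_erase hk').symm
      have hsmaller : hallMeasure (movePart A k' h h') < m := by
        rw [hallMeasure_movePart hh hc]
        omega
      rw [← mul_one (chevCoeff A k' h'), ← smul_eq_mul, ← Finsupp.smul_single]
      exact Submodule.smul_mem _ _ (ih _ hsmaller _ rfl)
    · exact Submodule.zero_mem _
  have hchev := chevProd_mem_hallSubmodule (ih _ (by omega) A rfl) hh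
  rw [chevProd, ← Finset.add_sum_erase _ _ (Finset.mem_univ k), if_pos hk,
    Submodule.add_mem_iff_left _ hrest, chevCoeff_eq_geom_sum h' hmin] at hchev
  refine mem_hallSubmodule_of_smul_mem (monic_geom_sum_X (Nat.succ_ne_zero (entry A k h')))
    (fun q => eval_geom_sum_ne_zero _) ?_
  rwa [Finsupp.smul_single, smul_eq_mul, mul_one]

/-- The Hall polynomials of `A` and `B`, as the product of `A` and `B` in the generic Hall
algebra. -/
def hallPoly (A B : KostantPartition n) : KostantPartition n →₀ ℤ[X] :=
  (single_mem_hallSubmodule B A).choose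

theorem orbitMatrix_mul (F : Type) [Field F] [Finite F] (d : ℕ) (A B : KostantPartition n) :
    orbitMatrix F d A * orbitMatrix F d B = hallEval F d (hallPoly A B) := by
  rw [hallPoly, ← (single_mem_hallSubmodule B A).choose_spec F d, hallEval_single_one]

theorem hallPoly_zero_right (A : KostantPartition n) : hallPoly A 0 = Finsupp.single A 1 :=
  hallEval_ext fun F _ _ d => by
    rw [← orbitMatrix_mul, orbitMatrix_zero, mul_one, hallEval_single_one]

theorem hallPoly_zero_left (A : KostantPartition n) : hallPoly 0 A = Finsupp.single A 1 :=
  hallEval_ext fun F _ _ d => by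
    rw [← orbitMatrix_mul, orbitMatrix_zero, one_mul, hallEval_single_one]

theorem hallPoly_ofRoot (A : KostantPartition n) {h h' : Fin n} (hh : (h : ℕ) + 1 = h') :
    hallPoly A (ofRoot (posRoot h h' (lt_of_val_add_one hh))) = chevProd A h h' :=
  hallEval_ext fun F _ _ d => by rw [← orbitMatrix_mul, orbitMatrix_mul_ofRoot F d A hh]

theorem hallPoly_assoc (A B C : KostantPartition n) :
    ((hallPoly A B).sum fun E P => P • hallPoly E C) =
      (hallPoly B C).sum fun E P => P • hallPoly A E :=
  hallEval_ext fun F _ _ d => by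
    rw [← hallEval_mul_of_forall fun E => orbitMatrix_mul F d E C,
      ← mul_hallEval_of_forall fun E => orbitMatrix_mul F d A E, ← orbitMatrix_mul,
      ← orbitMatrix_mul, mul_assoc]

theorem exists_of_hallPoly_ne_zero {A B C : KostantPartition n} (h : hallPoly A B C ≠ 0) :
    ∃ (F : Type) (_ : Field F) (d : ℕ) (V V'' V' : NStepFlag F n d),
      HasOffDiag (relPos V V') C ∧ HasOffDiag (relPos V V'') A ∧ HasOffDiag (relPos V'' V') B := by
  contrapose! h
  refine eq_of_eval_odd_primes fun p hp _ => ?_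
  have : Fact p.Prime := ⟨hp⟩
  obtain ⟨V, V', hV⟩ := exists_hasOffDiag (ZMod p) C
  have hcount := congrFun₂ (orbitMatrix_mul (ZMod p) (size C) A B) V V'
  rw [hallEval_apply _ _ hV, orbitMatrix_mul_apply, Nat.card_zmod] at hcount
  have : IsEmpty {V'' : NStepFlag (ZMod p) n (size C) //
      HasOffDiag (relPos V V'') A ∧ HasOffDiag (relPos V'' V') B} :=
    ⟨fun W => h (ZMod p) inferInstance _ V W.1 V' hV W.2.1 W.2.2⟩
  rw [← hcount, Nat.card_of_isEmpty, Nat.cast_zero, eval_zero]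

/-- The difference `co(A) - ro(A)` of the column sums and the row sums, which does not depend on the
diagonal. -/
def wt (A : KostantPartition n) : Fin n → ℤ := fun i => colSum (toMat A) i - rowSum (toMat A) i

theorem HasOffDiag.eq_add_diagonal {Z : Matrix (Fin n) (Fin n) ℤ} {A : KostantPartition n}
    (h : HasOffDiag Z A) : Z = toMat A + Matrix.diagonal fun i => Z i i := by
  ext i j
  obtain rfl | hij := eq_or_ne i j
  · simp [toMat, entry_of_not_lt]
  · simp [toMat, h i j hij, hij]

theorem rowSum_add_diagonal (Z : Matrix (Fin n) (Fin n) ℤ) (l : Fin n → ℤ) :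
    rowSum (Z + Matrix.diagonal l) = rowSum Z + l := by
  ext i
  simp [rowSum, Finset.sum_add_distrib, Matrix.diagonal_apply]

theorem colSum_add_diagonal (Z : Matrix (Fin n) (Fin n) ℤ) (l : Fin n → ℤ) :
    colSum (Z + Matrix.diagonal l) = colSum Z + l := by
  ext i
  simp [colSum, Finset.sum_add_distrib, Matrix.diagonal_apply]

theorem HasOffDiag.colSum_eq {Z : Matrix (Fin n) (Fin n) ℤ} {A : KostantPartition n}
    (h : HasOffDiag Z A) : colSum Z = rowSum Z + wt A := by
  rw [h.eq_add_diagonal, rowSum_add_diagonal, colSum_add_diagonal]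
  ext i
  simp only [wt, Pi.add_apply]
  ring

theorem wt_of_hallPoly_ne_zero {A B C : KostantPartition n} (h : hallPoly A B C ≠ 0) :
    wt C = wt A + wt B := by
  obtain ⟨F, _, d, V, V'', V', hC, hA, hB⟩ := exists_of_hallPoly_ne_zero h
  ext i
  have eC := congrFun hC.colSum_eq i
  have eA := congrFun hA.colSum_eq i
  have eB := congrFun hB.colSum_eq i
  rw [Pi.add_apply, colSum_relPos, rowSum_relPos] at eA eB eC
  rw [Pi.add_apply]
  omega

theorem dimVec_of_hallPoly_ne_zero {A B C : KostantPartition n} (h : hallPoly A B C ≠ 0)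
    (t : Fin (n + 1)) : dimVec C t = dimVec A t + dimVec B t := by
  obtain ⟨F, _, d, V, V'', V', hC, hA, hB⟩ := exists_of_hallPoly_ne_zero h
  have eC := hC.finrank_eq t
  have eA := hA.finrank_eq t
  have eB := hB.finrank_eq t
  omega

/-! ### The indeterminate `v` -/

theorem transcendental_vv : Transcendental ℤ vv := by
  have hX : Transcendental ℤ (X : ℚ[X]) := transcendental_iff.2 fun P hP => by
    rw [aeval_X_left_eq_map] at hP
    exact (Polynomial.map_eq_zero_iff Int.cast_injective).1 hP
  rw [vv, ← RatFunc.algebraMap_X]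
  exact (transcendental_algebraMap_iff (RatFunc.algebraMap_injective ℚ)).2 hX

theorem vv_ne_zero : vv ≠ 0 := RatFunc.X_ne_zero

theorem vv_zpow_injective : Function.Injective fun k : ℤ => vv ^ k := by
  have hinf : ¬ IsOfFinOrder (Units.mk0 vv vv_ne_zero) := by
    rw [isOfFinOrder_iff_pow_eq_one]
    rintro ⟨m, hm, hpow⟩
    have hone : vv ^ m = 1 := congrArg Units.val hpow
    exact transcendental_vv (IsAlgebraic.of_pow hm (hone ▸ isAlgebraic_one))
  intro a b hab
  exact injective_zpow_iff_not_isOfFinOrder.2 hinf (Units.ext (by simpa using hab))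

theorem aeval_vv_sq_ne_zero {P : ℤ[X]} (hP : P ≠ 0) : aeval (vv ^ 2) P ≠ 0 := by
  exact fun h => hP (transcendental_iff.1 (transcendental_vv.pow two_pos) P h)

/-! ### Stabilization for upper triangular matrices -/

theorem HasOffDiag.add_diagonal {Z : Matrix (Fin n) (Fin n) ℤ} {A : KostantPartition n}
    (h : HasOffDiag Z A) (l : Fin n → ℤ) : HasOffDiag (Z + Matrix.diagonal l) A :=
  fun i j hij => by rw [Matrix.add_apply, Matrix.diagonal_apply_ne _ hij, add_zero, h i j hij]

/-- The upper triangular matrix with off-diagonal part `A` and row sums `t`. -/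
def ofRowSum (A : KostantPartition n) (t : Fin n → ℤ) : ThetaTilde n :=
  ⟨toMat A + Matrix.diagonal (t - rowSum (toMat A)), fun i j hij => by
    rw [((hasOffDiag_toMat A).add_diagonal _) i j hij]
    exact Int.natCast_nonneg _⟩

theorem hasOffDiag_ofRowSum (A : KostantPartition n) (t : Fin n → ℤ) :
    HasOffDiag (ofRowSum A t).1 A :=
  (hasOffDiag_toMat A).add_diagonal _

theorem rowSum_ofRowSum (A : KostantPartition n) (t : Fin n → ℤ) :
    rowSum (ofRowSum A t).1 = t := by
  rw [ofRowSum, rowSum_add_diagonal, add_sub_cancel]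

theorem colSum_ofRowSum (A : KostantPartition n) (t : Fin n → ℤ) :
    colSum (ofRowSum A t).1 = t + wt A := by
  rw [(hasOffDiag_ofRowSum A t).colSum_eq, rowSum_ofRowSum]

theorem eq_val_ofRowSum_iff {Z : Matrix (Fin n) (Fin n) ℤ} {A : KostantPartition n}
    {t : Fin n → ℤ} : Z = (ofRowSum A t).1 ↔ HasOffDiag Z A ∧ rowSum Z = t := by
  refine ⟨?_, fun ⟨hZ, ht⟩ => ?_⟩
  · rintro rfl
    exact ⟨hasOffDiag_ofRowSum A t, rowSum_ofRowSum A t⟩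
  · have hdiag : t - rowSum (toMat A) = fun i => Z i i := by
      conv_lhs => rw [← ht, hZ.eq_add_diagonal, rowSum_add_diagonal, add_sub_cancel_left]
    change Z = toMat A + Matrix.diagonal (t - rowSum (toMat A))
    rw [hdiag]
    exact hZ.eq_add_diagonal

theorem eq_ofRowSum_iff {Z : ThetaTilde n} {A : KostantPartition n} {t : Fin n → ℤ} :
    Z = ofRowSum A t ↔ HasOffDiag Z.1 A ∧ rowSum Z.1 = t :=
  Subtype.ext_iff.trans eq_val_ofRowSum_iff

theorem eq_ofRowSum_sub_wt_iff {Z : ThetaTilde n} {A : KostantPartition n} {t : Fin n → ℤ} :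
    Z = ofRowSum A (t - wt A) ↔ HasOffDiag Z.1 A ∧ colSum Z.1 = t := by
  rw [eq_ofRowSum_iff]
  exact and_congr_right fun hZ => by rw [hZ.colSum_eq, eq_sub_iff_add_eq]

theorem ofRowSum_left_injective (t : Fin n → ℤ) :
    Function.Injective fun A : KostantPartition n => ofRowSum A t := fun A _ h =>
  (hasOffDiag_ofRowSum A t).unique ((eq_ofRowSum_iff.1 h).1)

theorem shift_eq (p : ℕ) (Z : ThetaTilde n) :
    shift p Z = Z.1 + Matrix.diagonal fun _ => (p : ℤ) := by
  rw [shift, Matrix.smul_one_eq_diagonal]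

theorem rowSum_shift (p : ℕ) (Z : ThetaTilde n) :
    rowSum (shift p Z) = rowSum Z.1 + fun _ => (p : ℤ) := by
  rw [shift_eq, rowSum_add_diagonal]

theorem hasOffDiag_shift_iff {p : ℕ} {Z : ThetaTilde n} {A : KostantPartition n} :
    HasOffDiag (shift p Z) A ↔ HasOffDiag Z.1 A :=
  forall₃_congr fun i j hij => by
    rw [shift_eq, Matrix.add_apply, Matrix.diagonal_apply_ne _ hij, add_zero]

theorem shift_ofRowSum (p : ℕ) (A : KostantPartition n) (t : Fin n → ℤ) :
    shift p (ofRowSum A t) = (ofRowSum A (t + fun _ => (p : ℤ))).1 :=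
  eq_val_ofRowSum_iff.2
    ⟨hasOffDiag_shift_iff.2 (hasOffDiag_ofRowSum A t), by rw [rowSum_shift, rowSum_ofRowSum]⟩

/-- In the region `k ≤ i`, `j < m` of the sum `dimDiff`, the entry `(k, m)` is off the diagonal if
`i = j`, and the entry `(i, j)` is below the diagonal if `k = m`. -/
theorem HasOffDiag.mul_add_diagonal {Z : Matrix (Fin n) (Fin n) ℤ} {A : KostantPartition n}
    (hZ : HasOffDiag Z A) (l : Fin n → ℤ) {i j k m : Fin n} (hki : k ≤ i) (hjm : j < m) :
    (Z + Matrix.diagonal l) i j * (Z + Matrix.diagonal l) k m =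
      Z i j * Z k m + if i = j then l i * entry A k m else 0 := by
  rw [Matrix.add_apply, Matrix.add_apply]
  obtain rfl | hij := eq_or_ne i j
  · have hkm : k ≠ m := (hki.trans_lt hjm).ne
    rw [if_pos rfl, Matrix.diagonal_apply_eq, Matrix.diagonal_apply_ne _ hkm, hZ k m hkm]
    ring
  · rw [if_neg hij, Matrix.diagonal_apply_ne _ hij]
    obtain rfl | hkm := eq_or_ne k m
    · rw [hZ i j hij, entry_of_not_lt _ (hjm.trans_le hki).not_gt]
      simp
    · rw [Matrix.diagonal_apply_ne _ hkm]
      ring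

theorem HasOffDiag.dimDiff_add_diagonal {Z : Matrix (Fin n) (Fin n) ℤ} {A : KostantPartition n}
    (hZ : HasOffDiag Z A) (l : Fin n → ℤ) :
    dimDiff (Z + Matrix.diagonal l) = dimDiff Z + ∑ i, l i * dimVec A i.succ := by
  have summand (i j k m : Fin n) : (if k ≤ i ∧ j < m then
      (Z + Matrix.diagonal l) i j * (Z + Matrix.diagonal l) k m else 0) =
      (if k ≤ i ∧ j < m then Z i j * Z k m else 0) +
        if i = j then if k ≤ i ∧ i < m then l i * (entry A k m : ℤ) else 0 else 0 := by
    by_cases hc : k ≤ i ∧ j < m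
    · rw [if_pos hc, if_pos hc, hZ.mul_add_diagonal l hc.1 hc.2]
      refine congrArg _ (if_ctx_congr Iff.rfl (fun hij => ?_) fun _ => rfl)
      rw [if_pos (by rwa [← hij] at hc)]
    · rw [if_neg hc, if_neg hc, zero_add]
      refine (ite_eq_right_iff.2 fun hij => if_neg ?_).symm
      rwa [← hij] at hc
  rw [dimDiff, dimDiff]
  simp only [summand, Finset.sum_add_distrib]
  refine congrArg _ (Finset.sum_congr rfl fun i _ => ?_)
  rw [Fintype.sum_eq_single i fun j hj => by simp only [if_neg hj.symm, Finset.sum_const_zero]]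
  simp only [if_true, dimVec, Finset.mul_sum, mul_ite, mul_zero, Fin.castSucc_lt_succ_iff,
    Fin.succ_le_castSucc_iff]

theorem dimDiff_shift_ofRowSum (p : ℕ) (A : KostantPartition n) (t : Fin n → ℤ) :
    dimDiff (shift p (ofRowSum A t)) =
      dimDiff (ofRowSum A t).1 + ∑ i : Fin n, p * (dimVec A i.succ : ℤ) := by
  rw [shift_eq, (hasOffDiag_ofRowSum A t).dimDiff_add_diagonal]

theorem eventually_nonneg_shift (Z : ThetaTilde n) :
    ∀ᶠ p : ℕ in Filter.atTop, ∀ i j, 0 ≤ shift p Z i j := by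
  filter_upwards [Filter.eventually_ge_atTop (∑ i, (Z.1 i i).natAbs)] with p hp i j
  rw [shift_eq, Matrix.add_apply]
  obtain rfl | hij := eq_or_ne i j
  · have hle : (Z.1 i i).natAbs ≤ ∑ i, (Z.1 i i).natAbs :=
      Finset.single_le_sum (f := fun i => (Z.1 i i).natAbs) (fun _ _ => Nat.zero_le _)
        (Finset.mem_univ i)
    rw [Matrix.diagonal_apply_eq]
    omega
  · rw [Matrix.diagonal_apply_ne _ hij, add_zero]
    exact Z.2 i j hij

theorem sum_shift (p : ℕ) (Z : ThetaTilde n) :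
    ∑ i, ∑ j, shift p Z i j = ∑ i, rowSum Z.1 i + n * p := by
  change ∑ i, rowSum (shift p Z) i = _
  simp [rowSum_shift, Finset.sum_add_distrib]

theorem IsSchurCoeff.unique {d : ℕ} {A B C : Matrix (Fin n) (Fin n) ℤ} (hC : IsTheta d C)
    {x y : Kv} (hx : IsSchurCoeff d A B C x) (hy : IsSchurCoeff d A B C y) : x = y := by
  obtain ⟨P, hP, rfl⟩ := hx
  obtain ⟨Q, hQ, rfl⟩ := hy
  congr 2
  refine eq_of_eval_odd_primes fun p hp h2 => ?_
  have : Fact p.Prime := ⟨hp⟩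
  obtain ⟨V, V', hV⟩ := exists_relPos_eq (ZMod p) hC
  have hchar : ringChar (ZMod p) ≠ 2 := by rwa [ZMod.ringChar_zmod_n]
  have hcount := (hP (ZMod p) hchar V V' hV).trans (hQ (ZMod p) hchar V V' hV).symm
  rwa [Nat.card_zmod] at hcount

theorem infinite_image_vv_zpow_neg (p₀ : ℕ) :
    ((fun p : ℕ => vv ^ (-(p : ℤ))) '' Set.Ici p₀).Infinite := by
  refine (Set.Ici_infinite p₀).image fun a _ b _ hab => ?_
  have := vv_zpow_injective hab
  omega

theorem IsStableProduct.unique {A B : ThetaTilde n} {G G' : ThetaTilde n →₀ Kv[X]}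
    (hG : IsStableProduct A B G) (hG' : IsStableProduct A B G') : G = G' := by
  obtain ⟨p₀, h⟩ := hG
  obtain ⟨p₁, h'⟩ := hG'
  ext1 Z
  by_cases hZ : Z ∈ G.support ∨ Z ∈ G'.support
  · refine eq_of_infinite_eval_eq _ _ ((infinite_image_vv_zpow_neg (max p₀ p₁)).mono ?_)
    rintro _ ⟨p, hp, rfl⟩
    obtain ⟨d, hA, -, hsupp, hcoeff⟩ := h p ((le_max_left _ _).trans hp)
    obtain ⟨d', hA', -, hsupp', hcoeff'⟩ := h' p ((le_max_right _ _).trans hp)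
    obtain rfl : d = d' := by exact_mod_cast hA.2.symm.trans hA'.2
    have hθ : IsTheta d (shift p Z) := hZ.elim (hsupp Z) (hsupp' Z)
    exact (hcoeff Z hθ).unique hθ (hcoeff' Z hθ)
  · rw [not_or, Finsupp.notMem_support_iff, Finsupp.notMem_support_iff] at hZ
    rw [hZ.1, hZ.2]

theorem rowSum_relPos_congr {F : Type} [Field F] {d : ℕ} (V W W' : NStepFlag F n d) :
    rowSum (relPos V W) = rowSum (relPos V W') := by
  ext i
  rw [rowSum_relPos, rowSum_relPos]

theorem rowSum_relPos_eq_colSum {F : Type} [Field F] {d : ℕ} (V W V' : NStepFlag F n d) :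
    rowSum (relPos W V') = colSum (relPos V W) := by
  ext i
  rw [rowSum_relPos, colSum_relPos]

/-- The coefficient of `[Z]` in the product `[X] · [Y]` for upper triangular matrices `X`, `Y` and
`Z` with the off-diagonal parts `A`, `B` and `C`, where `X` and `Z` have the row sums `t` and where
the column sums of `X` are the row sums of `Y`. -/
def upperCoeff (A B C : KostantPartition n) (t : Fin n → ℤ) : Kv :=
  vv ^ (dimDiff (ofRowSum C t).1 - dimDiff (ofRowSum A t).1 -
    dimDiff (ofRowSum B (t + wt A)).1) * aeval (vv ^ 2) (hallPoly A B C)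

/-- The product of two upper triangular basis elements; see `basisMul_ofRowSum`. -/
def upperProd (A B : KostantPartition n) (t : Fin n → ℤ) : ThetaTilde n →₀ Kv :=
  ∑ C ∈ (hallPoly A B).support, Finsupp.single (ofRowSum C t) (upperCoeff A B C t)

theorem upperProd_ofRowSum (A B C : KostantPartition n) (t : Fin n → ℤ) :
    upperProd A B t (ofRowSum C t) = upperCoeff A B C t := by
  classical
  rw [upperProd, Finsupp.finsetSum_apply]
  simp only [Finsupp.single_apply, (ofRowSum_left_injective t).eq_iff]
  rw [Finset.sum_ite_eq', ite_eq_left_iff, Finsupp.notMem_support_iff]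
  intro hC
  rw [upperCoeff, hC, map_zero, mul_zero]

theorem upperProd_eq_zero {A B : KostantPartition n} {t : Fin n → ℤ} {Z : ThetaTilde n}
    (hZ : ∀ C, Z ≠ ofRowSum C t) : upperProd A B t Z = 0 := by
  rw [upperProd, Finsupp.finsetSum_apply]
  exact Finset.sum_eq_zero fun C _ => Finsupp.single_eq_of_ne (hZ C)

theorem exists_eq_ofRowSum_of_mem_support {A B : KostantPartition n} {t : Fin n → ℤ}
    {Z : ThetaTilde n} (hZ : Z ∈ (upperProd A B t).support) : ∃ C, Z = ofRowSum C t := by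
  by_contra! hne
  exact Finsupp.mem_support_iff.1 hZ (upperProd_eq_zero hne)

theorem HasOffDiag.exists_trans {F : Type} [Field F] [Finite F] {d : ℕ} {V W V' : NStepFlag F n d}
    {A B : KostantPartition n} (hA : HasOffDiag (relPos V W) A) (hB : HasOffDiag (relPos W V') B) :
    ∃ C, HasOffDiag (relPos V V') C := by
  by_contra! hne
  have hcount := orbitMatrix_mul_apply F d A B V V'
  rw [orbitMatrix_mul, hallEval_apply_eq_zero F d hne] at hcount
  have : Nonempty {W // HasOffDiag (relPos V W) A ∧ HasOffDiag (relPos W V') B} := ⟨W, hA, hB⟩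
  exact Nat.card_pos.ne' (Nat.cast_eq_zero.1 hcount.symm)

theorem relPos_eq_shift_ofRowSum_iff {F : Type} [Field F] {d p : ℕ} {A B : KostantPartition n}
    {t : Fin n → ℤ} {V W V' : NStepFlag F n d} :
    (relPos V W = shift p (ofRowSum A t) ∧ relPos W V' = shift p (ofRowSum B (t + wt A))) ↔
      (HasOffDiag (relPos V W) A ∧ HasOffDiag (relPos W V') B) ∧
        rowSum (relPos V V') = t + fun _ => (p : ℤ) := by
  rw [shift_ofRowSum, shift_ofRowSum, eq_val_ofRowSum_iff, eq_val_ofRowSum_iff,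
    rowSum_relPos_congr V W V', rowSum_relPos_eq_colSum V W V', and_assoc, and_assoc]
  refine and_congr_right fun hA => ?_
  rw [and_left_comm]
  refine and_congr_right fun _ => and_iff_left_of_imp fun ht => ?_
  rw [hA.colSum_eq, rowSum_relPos_congr V W V', ht, add_right_comm]

theorem isStructurePoly_hallPoly {d p : ℕ} (A B C : KostantPartition n) (t : Fin n → ℤ) :
    IsStructurePoly d (shift p (ofRowSum A t)) (shift p (ofRowSum B (t + wt A)))
      (shift p (ofRowSum C t)) (hallPoly A B C) := fun F _ _ _ V V' hV => by
  rw [shift_ofRowSum p C, eq_val_ofRowSum_iff] at hV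
  rw [← hallEval_apply F d hV.1, ← orbitMatrix_mul, orbitMatrix_mul_apply]
  refine congrArg _ (Nat.card_congr (Equiv.subtypeEquivRight fun W => ?_))
  rw [relPos_eq_shift_ofRowSum_iff, and_iff_left hV.2]

theorem isStructurePoly_zero {d p : ℕ} {A B : KostantPartition n} {t : Fin n → ℤ}
    {Z : ThetaTilde n} (hZ : ∀ C, Z ≠ ofRowSum C t) :
    IsStructurePoly d (shift p (ofRowSum A t)) (shift p (ofRowSum B (t + wt A)))
      (shift p Z) 0 := fun F _ _ _ V V' hV => by
  suffices IsEmpty {W : NStepFlag F n d // relPos V W = shift p (ofRowSum A t) ∧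
      relPos W V' = shift p (ofRowSum B (t + wt A))} by
    rw [eval_zero, Nat.card_of_isEmpty, Nat.cast_zero]
  refine ⟨fun ⟨W, hW⟩ => ?_⟩
  rw [relPos_eq_shift_ofRowSum_iff] at hW
  obtain ⟨⟨hA, hB⟩, ht⟩ := hW
  obtain ⟨C, hC⟩ := hA.exists_trans hB
  rw [hV, rowSum_shift] at ht
  exact hZ C (eq_ofRowSum_iff.2 ⟨hasOffDiag_shift_iff.1 (hV ▸ hC), add_right_cancel ht⟩)

/-- The exponents of `v` do not change under the shift, since dimension vectors are additive. -/
theorem isSchurCoeff_upperProd {d p : ℕ} (A B : KostantPartition n) (t : Fin n → ℤ)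
    (Z : ThetaTilde n) :
    IsSchurCoeff d (shift p (ofRowSum A t)) (shift p (ofRowSum B (t + wt A))) (shift p Z)
      (upperProd A B t Z) := by
  by_cases hZ : ∃ C, Z = ofRowSum C t
  · obtain ⟨C, rfl⟩ := hZ
    refine ⟨hallPoly A B C, isStructurePoly_hallPoly A B C t, ?_⟩
    rw [upperProd_ofRowSum, upperCoeff]
    by_cases h0 : hallPoly A B C = 0
    · rw [h0, map_zero, mul_zero, mul_zero]
    · simp only [dimDiff_shift_ofRowSum, dimVec_of_hallPoly_ne_zero h0, mul_add,
        Finset.sum_add_distrib]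
      congr 2
      ring
  · rw [not_exists] at hZ
    exact ⟨0, isStructurePoly_zero hZ, by rw [upperProd_eq_zero hZ, map_zero, mul_zero]⟩

theorem isStableProduct_upperProd (A B : KostantPartition n) (t : Fin n → ℤ) :
    IsStableProduct (ofRowSum A t) (ofRowSum B (t + wt A))
      ((upperProd A B t).mapRange C C_0) := by
  have hev := (eventually_nonneg_shift (ofRowSum A t)).and
    ((eventually_nonneg_shift (ofRowSum B (t + wt A))).and
      ((Filter.eventually_all_finset (upperProd A B t).support).2 fun Z _ =>
        eventually_nonneg_shift Z))
  obtain ⟨p₀, hp₀⟩ := Filter.eventually_atTop.1 hev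
  refine ⟨p₀, fun p hp => ?_⟩
  obtain ⟨hA, hB, hsupp⟩ := hp₀ p hp
  have hnonneg : 0 ≤ ∑ i, ∑ j, shift p (ofRowSum A t) i j :=
    Finset.sum_nonneg fun i _ => Finset.sum_nonneg fun j _ => hA i j
  have sum_t : ∑ i, (t + wt A) i = ∑ i, t i := by
    rw [← colSum_ofRowSum]
    conv_rhs => rw [← rowSum_ofRowSum A t]
    exact Finset.sum_comm
  refine ⟨_, ⟨hA, (Int.toNat_of_nonneg hnonneg).symm⟩, ⟨hB, ?_⟩, fun Z hZ => ?_, fun Z _ => ?_⟩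
  · rw [Int.toNat_of_nonneg hnonneg, sum_shift, sum_shift, rowSum_ofRowSum, rowSum_ofRowSum, sum_t]
  · have hZ' := Finsupp.support_mapRange hZ
    obtain ⟨C, rfl⟩ := exists_eq_ofRowSum_of_mem_support hZ'
    refine ⟨hsupp _ hZ', ?_⟩
    rw [Int.toNat_of_nonneg hnonneg, sum_shift, sum_shift, rowSum_ofRowSum, rowSum_ofRowSum]
  · rw [Finsupp.mapRange_apply, eval_C]
    exact isSchurCoeff_upperProd A B t Z

theorem basisMul_ofRowSum (A B : KostantPartition n) (t : Fin n → ℤ) :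
    basisMul (ofRowSum A t) (ofRowSum B (t + wt A)) = upperProd A B t := by
  have hG := isStableProduct_upperProd A B t
  have hex : colSum (ofRowSum A t).1 = rowSum (ofRowSum B (t + wt A)).1 ∧
      ∃ G, IsStableProduct (ofRowSum A t) (ofRowSum B (t + wt A)) G :=
    ⟨by rw [colSum_ofRowSum, rowSum_ofRowSum], _, hG⟩
  rw [basisMul, dif_pos hex, hex.2.choose_spec.unique hG]
  ext1 Z
  rw [Finsupp.mapRange_apply, Finsupp.mapRange_apply, eval_C]

theorem basisMul_ofRowSum_of_ne {A B : KostantPartition n} {s t : Fin n → ℤ} (h : t + wt A ≠ s) :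
    basisMul (ofRowSum A t) (ofRowSum B s) = 0 := by
  refine dif_neg fun hex => h ?_
  rw [← colSum_ofRowSum, hex.1, rowSum_ofRowSum]

/-! ### The elements of the completion supported on upper triangular matrices -/

theorem mem_locallyFinite_of_hasOffDiag {A : KostantPartition n} {x : ThetaTilde n → Kv}
    (hx : ∀ Z, x Z ≠ 0 → HasOffDiag Z.1 A) : x ∈ locallyFinite n := fun t =>
  ⟨(Set.finite_singleton (ofRowSum A t)).subset fun Z hZ =>
      eq_ofRowSum_iff.2 ⟨hx Z hZ.2, hZ.1⟩,
    (Set.finite_singleton (ofRowSum A (t - wt A))).subset fun Z hZ =>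
      eq_ofRowSum_sub_wt_iff.2 ⟨hx Z hZ.2, hZ.1⟩⟩

open Classical in
/-- The element `∑_Z v^{ro(Z) · m} e_Z` of the completion, where `Z` runs over the upper triangular
matrices with off-diagonal part `A`, and where `[Z] = v^{-dimDiff Z} e_Z` as in the definition of
the Schur algebras. -/
def upperElem (A : KostantPartition n) (m : Fin n → ℤ) : KHat n :=
  ⟨fun Z => if HasOffDiag Z.1 A then vv ^ (dotProduct (rowSum Z.1) m + dimDiff Z.1) else 0,
    mem_locallyFinite_of_hasOffDiag fun _ hZ => not_not.1 fun h => hZ (if_neg h)⟩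

/-- The coefficient of `[Z]`. -/
def KHat.coeff (Z : ThetaTilde n) : KHat n →ₗ[Kv] Kv where
  toFun ξ := ξ.1 Z
  map_add' _ _ := rfl
  map_smul' _ _ := rfl

theorem KHat.ext_coeff {ξ η : KHat n} (h : ∀ Z, KHat.coeff Z ξ = KHat.coeff Z η) : ξ = η :=
  KHat.ext h

open Classical in
theorem coeff_upperElem (A : KostantPartition n) (m : Fin n → ℤ) (Z : ThetaTilde n) :
    KHat.coeff Z (upperElem A m) =
      if HasOffDiag Z.1 A then vv ^ (dotProduct (rowSum Z.1) m + dimDiff Z.1) else 0 := rfl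

theorem coeff_upperElem_of_hasOffDiag {A : KostantPartition n} {Z : ThetaTilde n}
    (hZ : HasOffDiag Z.1 A) (m : Fin n → ℤ) :
    KHat.coeff Z (upperElem A m) = vv ^ (dotProduct (rowSum Z.1) m + dimDiff Z.1) := if_pos hZ

theorem coeff_upperElem_of_not_hasOffDiag {A : KostantPartition n} {Z : ThetaTilde n}
    (hZ : ¬ HasOffDiag Z.1 A) (m : Fin n → ℤ) : KHat.coeff Z (upperElem A m) = 0 := if_neg hZ

theorem rowPart_upperElem (A : KostantPartition n) (m t : Fin n → ℤ) :
    rowPart t (upperElem A m) =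
      Finsupp.single (ofRowSum A t) (vv ^ (dotProduct t m + dimDiff (ofRowSum A t).1)) := by
  classical
  ext Z
  change (if rowSum Z.1 = t then KHat.coeff Z (upperElem A m) else 0) = _
  by_cases hZ : Z = ofRowSum A t
  · subst hZ
    rw [Finsupp.single_eq_same, if_pos (rowSum_ofRowSum A t),
      coeff_upperElem_of_hasOffDiag (hasOffDiag_ofRowSum A t), rowSum_ofRowSum]
  · rw [Finsupp.single_eq_of_ne hZ, coeff_upperElem, ← ite_and]
    exact if_neg fun h => hZ (eq_ofRowSum_iff.2 h.symm)

theorem colPart_upperElem (A : KostantPartition n) (m t : Fin n → ℤ) :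
    colPart t (upperElem A m) = Finsupp.single (ofRowSum A (t - wt A))
      (vv ^ (dotProduct (t - wt A) m + dimDiff (ofRowSum A (t - wt A)).1)) := by
  classical
  ext Z
  change (if colSum Z.1 = t then KHat.coeff Z (upperElem A m) else 0) = _
  by_cases hZ : Z = ofRowSum A (t - wt A)
  · subst hZ
    rw [Finsupp.single_eq_same, if_pos (by rw [colSum_ofRowSum, sub_add_cancel]),
      coeff_upperElem_of_hasOffDiag (hasOffDiag_ofRowSum A _), rowSum_ofRowSum]
  · rw [Finsupp.single_eq_of_ne hZ, coeff_upperElem, ← ite_and]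
    exact if_neg fun h => hZ (eq_ofRowSum_sub_wt_iff.2 h.symm)

theorem kMul_single (Z Z' : ThetaTilde n) (x y : Kv) :
    kMul (Finsupp.single Z x) (Finsupp.single Z' y) = (x * y) • basisMul Z Z' := by
  simp [kMul, mul_smul]

theorem coeff_upperElem_mul (A B : KostantPartition n) (m k : Fin n → ℤ) (Z : ThetaTilde n) :
    KHat.coeff Z (upperElem A m * upperElem B k) =
      vv ^ (dotProduct (rowSum Z.1) m + dimDiff (ofRowSum A (rowSum Z.1)).1) *
      vv ^ (dotProduct (colSum Z.1 - wt B) k + dimDiff (ofRowSum B (colSum Z.1 - wt B)).1) *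
      basisMul (ofRowSum A (rowSum Z.1)) (ofRowSum B (colSum Z.1 - wt B)) Z := by
  change kMul (rowPart (rowSum Z.1) (upperElem A m)) (colPart (colSum Z.1) (upperElem B k)) Z = _
  rw [rowPart_upperElem, colPart_upperElem, kMul_single, Finsupp.smul_apply, smul_eq_mul]

theorem coeff_upperElem_mul_eq_zero {A B : KostantPartition n} (m k : Fin n → ℤ)
    {Z : ThetaTilde n} (hZ : ∀ C, HasOffDiag Z.1 C → hallPoly A B C = 0) :
    KHat.coeff Z (upperElem A m * upperElem B k) = 0 := by
  rw [coeff_upperElem_mul]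
  by_cases hs : rowSum Z.1 + wt A = colSum Z.1 - wt B
  · rw [← hs, basisMul_ofRowSum]
    by_cases hup : ∃ C, Z = ofRowSum C (rowSum Z.1)
    · obtain ⟨C, hC⟩ := hup
      rw [hC, rowSum_ofRowSum, upperProd_ofRowSum, upperCoeff,
        hZ C (eq_ofRowSum_iff.1 hC).1, map_zero, mul_zero, mul_zero]
    · rw [upperProd_eq_zero (not_exists.1 hup), mul_zero]
  · rw [basisMul_ofRowSum_of_ne hs, Finsupp.zero_apply, mul_zero]

theorem coeff_ofRowSum_upperElem_mul {A B C : KostantPartition n} (h : hallPoly A B C ≠ 0)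
    (m k t : Fin n → ℤ) :
    KHat.coeff (ofRowSum C t) (upperElem A m * upperElem B k) =
      vv ^ dotProduct (wt A) k * (aeval (vv ^ 2) (hallPoly A B C) *
        vv ^ (dotProduct t (m + k) + dimDiff (ofRowSum C t).1)) := by
  rw [coeff_upperElem_mul, rowSum_ofRowSum, colSum_ofRowSum, wt_of_hallPoly_ne_zero h,
    ← add_assoc, add_sub_cancel_right, basisMul_ofRowSum, upperProd_ofRowSum, upperCoeff,
    ← mul_assoc, ← zpow_add₀ vv_ne_zero, ← zpow_add₀ vv_ne_zero, mul_left_comm,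
    ← zpow_add₀ vv_ne_zero, mul_comm (aeval (vv ^ 2) _)]
  congr 2
  rw [add_dotProduct, dotProduct_add]
  ring

theorem upperElem_mul (A B : KostantPartition n) (m k : Fin n → ℤ) :
    upperElem A m * upperElem B k = vv ^ dotProduct (wt A) k •
      (hallPoly A B).sum fun C P => aeval (vv ^ 2) P • upperElem C (m + k) := by
  refine KHat.ext_coeff fun Z => ?_
  rw [map_smul, map_finsuppSum]
  simp only [map_smul, smul_eq_mul]
  by_cases hZ : ∃ C, HasOffDiag Z.1 C ∧ hallPoly A B C ≠ 0
  · obtain ⟨C, hC, h0⟩ := hZ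
    obtain ⟨t, rfl⟩ : ∃ t, Z = ofRowSum C t := ⟨_, eq_ofRowSum_iff.2 ⟨hC, rfl⟩⟩
    rw [coeff_ofRowSum_upperElem_mul h0, Finsupp.sum_eq_single C (fun D _ hD => ?_)
      fun h => (h0 h).elim, coeff_upperElem_of_hasOffDiag hC, rowSum_ofRowSum]
    rw [coeff_upperElem_of_not_hasOffDiag (fun hD' => hD (hD'.unique hC)), mul_zero]
  · push Not at hZ
    rw [coeff_upperElem_mul_eq_zero m k hZ, Finsupp.sum, Finset.sum_eq_zero, mul_zero]
    intro C hC
    rw [coeff_upperElem_of_not_hasOffDiag (fun h => Finsupp.mem_support_iff.1 hC (hZ C h)),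
      mul_zero]

theorem hasOffDiag_iff_eq_add_diagonal {A : ThetaZero n} {B : KostantPartition n}
    (hA : HasOffDiag A.1.1 B) {Z : Matrix (Fin n) (Fin n) ℤ} :
    HasOffDiag Z B ↔ Z = A.1.1 + Matrix.diagonal fun i => Z i i := by
  refine ⟨fun h => ?_, fun h => h ▸ hA.add_diagonal _⟩
  have hzero : (fun i => A.1.1 i i) = 0 := funext A.2
  rw [hA.eq_add_diagonal, hzero, Matrix.diagonal_zero', add_zero]
  exact h.eq_add_diagonal

theorem hatElem_eq_upperElem {A : ThetaZero n} {B : KostantPartition n} (hA : HasOffDiag A.1.1 B)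
    {j m : Fin n → ℤ} (hj : ∀ i, j i = m i + dimVec B i.succ)
    (h0 : dotProduct (rowSum A.1.1) m + dimDiff A.1.1 = 0) : hatElem A j = upperElem B m := by
  classical
  refine KHat.ext_coeff fun Z => ?_
  change (if _ then _ else _) = _
  by_cases hZ : HasOffDiag Z.1 B
  · have hdiag := (hasOffDiag_iff_eq_add_diagonal hA).1 hZ
    rw [coeff_upperElem_of_hasOffDiag hZ, if_pos hdiag]
    have hrow : rowSum Z.1 = rowSum A.1.1 + fun i => Z.1 i i := by
      conv_lhs => rw [hdiag]
      rw [rowSum_add_diagonal]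
    have hdim : dimDiff Z.1 = dimDiff A.1.1 + ∑ i, Z.1 i i * dimVec B i.succ := by
      conv_lhs => rw [hdiag]
      rw [hA.dimDiff_add_diagonal]
    rw [hrow, hdim, add_dotProduct]
    congr 1
    simp only [hj, mul_add, Finset.sum_add_distrib]
    simp only [dotProduct] at h0 ⊢
    linarith
  · rw [coeff_upperElem_of_not_hasOffDiag hZ,
      if_neg fun h => hZ ((hasOffDiag_iff_eq_add_diagonal hA).2 h)]

theorem hatElem_zeroMat (j : Fin n → ℤ) : hatElem (zeroMat n) j = upperElem 0 j := by
  refine hatElem_eq_upperElem (fun i j _ => by simp [zeroMat]) (fun i => by simp [dimVec_zero]) ?_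
  simp [zeroMat, dimDiff, dotProduct, rowSum]

/-- The sum of the unit vectors strictly between `i` and `j`. -/
def between (i j : Fin n) : Fin n → ℤ := fun k => if i < k ∧ k < j then 1 else 0

theorem rowSum_unitMat {i j : Fin n} (hij : i ≠ j) :
    rowSum (unitMat i j hij).1.1 = Pi.single i 1 := by
  ext k
  change ∑ l, Matrix.single i j (1 : ℤ) k l = _
  simp [Matrix.single_apply, Pi.single_apply, ite_and, eq_comm]

theorem dimDiff_unitMat {i j : Fin n} (hij : i ≠ j) : dimDiff (unitMat i j hij).1.1 = 0 := by
  refine Finset.sum_eq_zero fun a _ => Finset.sum_eq_zero fun b _ =>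
    Finset.sum_eq_zero fun c _ => Finset.sum_eq_zero fun d _ => ite_eq_right_iff.2 fun h => ?_
  change Matrix.single i j (1 : ℤ) a b * Matrix.single i j 1 c d = 0
  rw [Matrix.single_apply, Matrix.single_apply, ite_mul, one_mul, zero_mul, ← ite_and]
  exact if_neg fun hc => h.2.ne (hc.1.2.symm.trans hc.2.2)

theorem hatElem_unitMat {i j : Fin n} (hij : i < j) :
    hatElem (unitMat i j hij.ne) (Pi.single i 1) =
      upperElem (ofRoot (posRoot i j hij)) (-between i j) := by
  refine hatElem_eq_upperElem (fun a b _ => ?_) (fun k => ?_) ?_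
  · change Matrix.single i j (1 : ℤ) a b = _
    rw [Matrix.single_apply, entry_single, Nat.cast_ite, Nat.cast_one, Nat.cast_zero]
    simp only [eq_comm]
  · rw [dimVec_single, Pi.single_apply, Pi.neg_apply, between]
    simp only [Fin.castSucc_lt_succ_iff, Fin.succ_le_castSucc_iff]
    simp only [Fin.ext_iff, Fin.lt_def, Fin.le_def] at *
    split_ifs <;> first | rfl | omega
  · rw [dimDiff_unitMat, rowSum_unitMat, single_dotProduct, add_zero]
    simp [between]

theorem tBar_of_lt {i j : Fin n} (hij : i < j) : tBar i j =
    (vv - vv⁻¹) • upperElem (ofRoot (posRoot i j hij)) (-between i j) := by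
  rw [tBar, dif_pos hij, hatElem_unitMat hij, neg_sub]

theorem tBar_self (i : Fin n) : tBar i i = upperElem 0 (Pi.single i 1) := by
  rw [tBar, dif_neg (lt_irrefl i), if_pos rfl, hatElem_zeroMat]

theorem tBar_of_gt {i j : Fin n} (hij : j < i) : tBar i j = 0 := by
  rw [tBar, dif_neg hij.not_gt, if_neg hij.ne']

theorem KHat.one_eq : (1 : KHat n) = upperElem 0 0 := hatElem_zeroMat 0

/-! ### The extended Hall algebra -/

theorem wt_zero : wt (0 : KostantPartition n) = 0 := by
  ext i
  simp [wt, toMat, colSum, rowSum]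

/-- The Hall algebra of the type `A` quiver at `q = v²`, extended by a torus. Its basis is indexed
by a Kostant partition and an element of `ℤ^n`, a cocharacter of the torus; it is an algebraic model
of the span of the elements `upperElem A m` of the completion. -/
def ExtHall (n : ℕ) : Type := (KostantPartition n × (Fin n → ℤ)) →₀ Kv

namespace ExtHall

instance : AddCommGroup (ExtHall n) := inferInstanceAs (AddCommGroup (_ →₀ Kv))

instance : Module Kv (ExtHall n) := inferInstanceAs (Module Kv (_ →₀ Kv))

/-- The basis vector of `ExtHall n` at `(A, m)`, which models `upperElem A m`. -/
def basisElem (A : KostantPartition n) (m : Fin n → ℤ) : ExtHall n := Finsupp.single (A, m) 1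

theorem linearMap_ext {E : Type*} [AddCommMonoid E] [Module Kv E] {f g : ExtHall n →ₗ[Kv] E}
    (h : ∀ A m, f (basisElem A m) = g (basisElem A m)) : f = g :=
  Finsupp.lhom_ext' fun a => LinearMap.ext_ring (h a.1 a.2)

/-- The linear map out of `ExtHall n` with prescribed values on the basis. -/
def lift {E : Type*} [AddCommMonoid E] [Module Kv E] (f : KostantPartition n → (Fin n → ℤ) → E) :
    ExtHall n →ₗ[Kv] E :=
  Finsupp.linearCombination Kv fun a : KostantPartition n × (Fin n → ℤ) => f a.1 a.2

theorem lift_basisElem {E : Type*} [AddCommMonoid E] [Module Kv E]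
    (f : KostantPartition n → (Fin n → ℤ) → E) (A : KostantPartition n) (m : Fin n → ℤ) :
    lift f (basisElem A m) = f A m :=
  (Finsupp.linearCombination_single Kv 1 (A, m)).trans (one_smul Kv _)

/-- The specialization at `q = v²` of an element of the generic Hall algebra, times the element `m`
of the torus. -/
def specialize (m : Fin n → ℤ) (φ : KostantPartition n →₀ ℤ[X]) : ExtHall n :=
  φ.sum fun C P => aeval (vv ^ 2) P • basisElem C m

theorem specialize_single (m : Fin n → ℤ) (C : KostantPartition n) (P : ℤ[X]) :
    specialize m (Finsupp.single C P) = aeval (vv ^ 2) P • basisElem C m :=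
  Finsupp.sum_single_index (by rw [map_zero, zero_smul])

theorem specialize_sum {ι : Type*} (m : Fin n → ℤ) (s : Finset ι)
    (φ : ι → KostantPartition n →₀ ℤ[X]) :
    specialize m (∑ i ∈ s, φ i) = ∑ i ∈ s, specialize m (φ i) :=
  (Finsupp.sum_finsetSum_index (fun _ => by rw [map_zero, zero_smul])
    fun _ _ _ => by rw [map_add, add_smul]).symm

theorem specialize_smul (m : Fin n → ℤ) (P : ℤ[X]) (φ : KostantPartition n →₀ ℤ[X]) :
    specialize m (P • φ) = aeval (vv ^ 2) P • specialize m φ := by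
  rw [specialize, specialize, Finsupp.sum_smul_index fun _ => by rw [map_zero, zero_smul],
    Finsupp.smul_sum]
  simp only [map_mul, mul_smul]

/-- The multiplication of `ExtHall n`: the torus acts on the basis vector at `A` from the right
through the weight of `A`. -/
def mulMap : ExtHall n →ₗ[Kv] ExtHall n →ₗ[Kv] ExtHall n :=
  lift fun A m => lift fun B k => vv ^ dotProduct (wt A) k • specialize (m + k) (hallPoly A B)

theorem mulMap_basisElem (A B : KostantPartition n) (m k : Fin n → ℤ) :
    mulMap (basisElem A m) (basisElem B k) =
      vv ^ dotProduct (wt A) k • specialize (m + k) (hallPoly A B) := by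
  rw [mulMap, lift_basisElem, lift_basisElem]

theorem mulMap_specialize_basisElem {φ : KostantPartition n →₀ ℤ[X]} {w : Fin n → ℤ}
    (hw : ∀ E, φ E ≠ 0 → wt E = w) (C : KostantPartition n) (m k : Fin n → ℤ) :
    mulMap (specialize m φ) (basisElem C k) =
      vv ^ dotProduct w k • specialize (m + k) (φ.sum fun E P => P • hallPoly E C) := by
  rw [specialize, map_finsuppSum, Finsupp.sum, Finsupp.sum, LinearMap.sum_apply, specialize_sum,
    Finset.smul_sum]
  refine Finset.sum_congr rfl fun E hE => ?_
  rw [map_smul, LinearMap.smul_apply, mulMap_basisElem, specialize_smul,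
    hw E (Finsupp.mem_support_iff.1 hE), smul_comm]

theorem mulMap_basisElem_specialize (φ : KostantPartition n →₀ ℤ[X]) (A : KostantPartition n)
    (m k : Fin n → ℤ) : mulMap (basisElem A m) (specialize k φ) =
      vv ^ dotProduct (wt A) k • specialize (m + k) (φ.sum fun E P => P • hallPoly A E) := by
  rw [specialize, map_finsuppSum, Finsupp.sum, Finsupp.sum, specialize_sum, Finset.smul_sum]
  refine Finset.sum_congr rfl fun E _ => ?_
  rw [map_smul, mulMap_basisElem, specialize_smul, smul_comm]

theorem mulMap_assoc (x y z : ExtHall n) : mulMap (mulMap x y) z = mulMap x (mulMap y z) := by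
  have htrilinear : (mulMap.compr₂ mulMap : ExtHall n →ₗ[Kv] ExtHall n →ₗ[Kv] _) =
      (LinearMap.llcomp Kv (ExtHall n) (ExtHall n) (ExtHall n) ∘ₗ mulMap).compl₂ mulMap := by
    refine linearMap_ext fun A m => linearMap_ext fun B k => linearMap_ext fun C l => ?_
    change mulMap (mulMap (basisElem A m) (basisElem B k)) (basisElem C l) =
      mulMap (basisElem A m) (mulMap (basisElem B k) (basisElem C l))
    rw [mulMap_basisElem, mulMap_basisElem, map_smul, map_smul, LinearMap.smul_apply,
      mulMap_basisElem_specialize, mulMap_specialize_basisElem fun E => wt_of_hallPoly_ne_zero,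
      hallPoly_assoc, smul_smul, smul_smul, ← zpow_add₀ vv_ne_zero, ← zpow_add₀ vv_ne_zero,
      add_assoc, dotProduct_add, add_dotProduct]
    congr 2
    ring
  exact LinearMap.congr_fun (LinearMap.congr_fun₂ htrilinear x y) z

theorem one_mulMap (x : ExtHall n) : mulMap (basisElem 0 0) x = x := by
  refine LinearMap.congr_fun (g := LinearMap.id) (linearMap_ext fun A m => ?_) x
  rw [mulMap_basisElem, hallPoly_zero_left, specialize_single, wt_zero, zero_dotProduct, zpow_zero,
    one_smul, map_one, one_smul, zero_add, LinearMap.id_apply]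

theorem mulMap_one (x : ExtHall n) : mulMap x (basisElem 0 0) = x := by
  refine LinearMap.congr_fun (f := mulMap.flip _) (g := LinearMap.id)
    (linearMap_ext fun A m => ?_) x
  rw [LinearMap.flip_apply, mulMap_basisElem, hallPoly_zero_right, specialize_single,
    dotProduct_zero, zpow_zero, one_smul, map_one, one_smul, add_zero, LinearMap.id_apply]

instance : Ring (ExtHall n) :=
  { (inferInstance : AddCommGroup (ExtHall n)) with
    mul := fun x y => mulMap x y
    one := basisElem 0 0
    left_distrib := fun x => map_add (mulMap x)
    right_distrib := LinearMap.map_add₂ mulMap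
    zero_mul := LinearMap.map_zero₂ mulMap
    mul_zero := fun x => map_zero (mulMap x)
    mul_assoc := mulMap_assoc
    one_mul := one_mulMap
    mul_one := mulMap_one }

instance : Algebra Kv (ExtHall n) :=
  Algebra.ofModule (LinearMap.map_smul₂ mulMap) fun c x => map_smul (mulMap x) c

theorem basisElem_mul_basisElem (A B : KostantPartition n) (m k : Fin n → ℤ) :
    basisElem A m * basisElem B k =
      vv ^ dotProduct (wt A) k • specialize (m + k) (hallPoly A B) := mulMap_basisElem A B m k

theorem one_eq : (1 : ExtHall n) = basisElem 0 0 := rfl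

/-! ### The extended Hall algebra inside the completion -/

/-- The embedding of the extended Hall algebra into the completion. -/
def toKHat : ExtHall n →ₗ[Kv] KHat n := lift upperElem

theorem toKHat_basisElem (A : KostantPartition n) (m : Fin n → ℤ) :
    toKHat (basisElem A m) = upperElem A m := lift_basisElem upperElem A m

theorem toKHat_one : toKHat (1 : ExtHall n) = 1 := by
  rw [one_eq, toKHat_basisElem, KHat.one_eq]

theorem toKHat_mul (x y : ExtHall n) : toKHat (x * y) = toKHat x * toKHat y := by
  have hbilinear : (LinearMap.mul Kv (ExtHall n)).compr₂ toKHat =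
      (LinearMap.mul Kv (KHat n) ∘ₗ toKHat).compl₂ toKHat := by
    refine linearMap_ext fun A m => linearMap_ext fun B k => ?_
    change toKHat (basisElem A m * basisElem B k) =
      toKHat (basisElem A m) * toKHat (basisElem B k)
    rw [toKHat_basisElem, toKHat_basisElem, upperElem_mul, basisElem_mul_basisElem, map_smul,
      specialize, map_finsuppSum]
    simp only [map_smul, toKHat_basisElem]
  exact LinearMap.congr_fun₂ hbilinear x y

/-- The character `t ↦ v^{t · m}` of `ℤ^n`, written multiplicatively. -/
def char (m : Fin n → ℤ) : Multiplicative (Fin n → ℤ) →* Kv where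
  toFun t := vv ^ dotProduct t.toAdd m
  map_one' := by rw [toAdd_one, zero_dotProduct, zpow_zero]
  map_mul' s t := by rw [toAdd_mul, add_dotProduct, zpow_add₀ vv_ne_zero]

theorem char_injective : Function.Injective (char (n := n)) := by
  intro m k h
  ext i
  have hi : char m (.ofAdd (Pi.single i 1)) = char k (.ofAdd (Pi.single i 1)) := by rw [h]
  exact vv_zpow_injective (by simpa [char] using hi)

theorem linearIndependent_char :
    LinearIndependent Kv fun m : Fin n → ℤ => (char m : Multiplicative (Fin n → ℤ) → Kv) :=
  (linearIndependent_monoidHom _ Kv).comp _ char_injective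

/-- The component at `A` of an element of `ExtHall n`, an element of the group algebra of the
torus. -/
def torusPart (A : KostantPartition n) : ExtHall n →ₗ[Kv] (Fin n → ℤ) →₀ Kv :=
  Finsupp.lcomapDomain (Prod.mk A) (Prod.mk_right_injective A)

theorem torusPart_basisElem_self (A : KostantPartition n) (m : Fin n → ℤ) :
    torusPart A (basisElem A m) = Finsupp.single m 1 :=
  Finsupp.comapDomain_single _ _ _ (Prod.mk_right_injective A).injOn

theorem torusPart_basisElem_of_ne {A B : KostantPartition n} (h : B ≠ A) (m : Fin n → ℤ) :
    torusPart A (basisElem B m) = 0 :=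
  Finsupp.ext fun _ => Finsupp.single_eq_of_ne fun hB => h (congrArg Prod.fst hB).symm

theorem eq_zero_of_torusPart {x : ExtHall n} (h : ∀ A, torusPart A x = 0) : x = 0 :=
  Finsupp.ext fun a => DFunLike.congr_fun (h a.1) a.2

theorem coeff_toKHat (A : KostantPartition n) (t : Fin n → ℤ) (x : ExtHall n) :
    KHat.coeff (ofRowSum A t) (toKHat x) = vv ^ dimDiff (ofRowSum A t).1 *
      Finsupp.linearCombination Kv
        (fun m => (char m : Multiplicative (Fin n → ℤ) → Kv)) (torusPart A x) (.ofAdd t) := by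
  refine LinearMap.congr_fun (f := KHat.coeff (ofRowSum A t) ∘ₗ toKHat)
    (g := vv ^ dimDiff (ofRowSum A t).1 •
      (LinearMap.proj (φ := fun _ => Kv) (Multiplicative.ofAdd t) ∘ₗ
        Finsupp.linearCombination Kv _ ∘ₗ torusPart A)) (linearMap_ext fun B m => ?_) x
  simp only [LinearMap.comp_apply, LinearMap.smul_apply, LinearMap.proj_apply, smul_eq_mul,
    toKHat_basisElem]
  obtain rfl | hBA := eq_or_ne B A
  · rw [torusPart_basisElem_self, Finsupp.linearCombination_single, one_smul,
      coeff_upperElem_of_hasOffDiag (hasOffDiag_ofRowSum B t), rowSum_ofRowSum,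
      zpow_add₀ vv_ne_zero, mul_comm]
    rfl
  · rw [torusPart_basisElem_of_ne hBA, map_zero, Pi.zero_apply, mul_zero,
      coeff_upperElem_of_not_hasOffDiag fun h => hBA (h.unique (hasOffDiag_ofRowSum A t))]

theorem toKHat_injective : Function.Injective (toKHat (n := n)) := by
  refine (injective_iff_map_eq_zero toKHat).2 fun x hx => eq_zero_of_torusPart fun A => ?_
  refine (injective_iff_map_eq_zero _).1 linearIndependent_char.finsuppLinearCombination_injective
    _ (funext fun t => ?_)
  have hcoeff := coeff_toKHat A t.toAdd x
  rw [hx, map_zero, zero_eq_mul] at hcoeff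
  exact hcoeff.resolve_left (zpow_ne_zero _ vv_ne_zero)

end ExtHall

/-! ### Commutation relations of the root elements -/

theorem induction_of_lt {P : Fin n → Prop} {a b : Fin n} (hab : a < b)
    (succ : ∀ b : Fin n, (a : ℕ) + 1 = b → P b)
    (step : ∀ h b : Fin n, (h : ℕ) + 1 = b → a < h → P h → P b) : P b := by
  induction hm : (b : ℕ) generalizing b with
  | zero => exact absurd hab (by rw [Fin.lt_def, hm]; exact Nat.not_lt_zero _)
  | succ m ih =>
    obtain ⟨h, rfl⟩ : ∃ h : Fin n, (h : ℕ) = m := ⟨⟨m, by have := b.2; omega⟩, rfl⟩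
    rw [Fin.lt_def, hm, Nat.lt_succ_iff] at hab
    obtain hah | hah := hab.eq_or_lt
    · exact succ b (by omega)
    · exact step h b hm.symm hah (ih hah rfl)

/-- The strictly upper triangular part of the matrix unit `E_{ij}`: the indicator of the root
`(i, j)` for `i < j`, and `0` otherwise. -/
def unitPart (i j : Fin n) : KostantPartition n := if h : i < j then ofRoot (posRoot i j h) else 0

theorem unitPart_of_lt {i j : Fin n} (h : i < j) : unitPart i j = ofRoot (posRoot i j h) :=
  dif_pos h

theorem unitPart_self (i : Fin n) : unitPart i i = 0 := dif_neg (lt_irrefl i)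

theorem entry_unitPart_of_lt {i j : Fin n} (h : i < j) (a b : Fin n) :
    entry (unitPart i j) a b = if a = i ∧ b = j then 1 else 0 := by
  rw [unitPart_of_lt h, entry_single]

theorem entry_unitPart_self {i j : Fin n} (h : i < j) : entry (unitPart i j) i j = 1 := by
  rw [entry_unitPart_of_lt h, if_pos ⟨rfl, rfl⟩]

theorem entry_unitPart_of_col_ne {i j a b : Fin n} (h : b ≠ j) : entry (unitPart i j) a b = 0 := by
  by_cases hij : i < j
  · rw [entry_unitPart_of_lt hij, if_neg fun h' => h h'.2]
  · rw [unitPart, dif_neg hij, entry_zero]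

theorem entry_unitPart_of_row_ne {i j a b : Fin n} (h : a ≠ i) : entry (unitPart i j) a b = 0 := by
  by_cases hij : i < j
  · rw [entry_unitPart_of_lt hij, if_neg fun h' => h h'.1]
  · rw [unitPart, dif_neg hij, entry_zero]

namespace ExtHall

/-- The basis vector of `ExtHall n` at `A` with trivial torus part. -/
def hallElem (A : KostantPartition n) : ExtHall n := basisElem A 0

theorem hallElem_zero : (hallElem 0 : ExtHall n) = 1 := rfl

/-- The structure constant `q^{∑_{i < k} a_{ij}} [a_{kj} + 1]_q` of `chevProd` at `q = v²`. -/
def chevScalar (A : KostantPartition n) (k j : Fin n) : Kv := aeval (vv ^ 2) (chevCoeff A k j)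

theorem chevScalar_eq (A : KostantPartition n) (k j : Fin n) : chevScalar A k j =
    (vv ^ 2) ^ (∑ i, if i < k then entry A i j else 0) *
      ∑ t ∈ Finset.range (entry A k j + 1), (vv ^ 2) ^ t := by
  simp [chevScalar, chevCoeff]

theorem chevScalar_ne_zero (A : KostantPartition n) (k j : Fin n) : chevScalar A k j ≠ 0 :=
  aeval_vv_sq_ne_zero <|
    mul_ne_zero (pow_ne_zero _ X_ne_zero) (monic_geom_sum_X (Nat.succ_ne_zero _)).ne_zero

theorem chevScalar_congr {A B : KostantPartition n} {k j : Fin n}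
    (h : ∀ i, i ≤ k → entry A i j = entry B i j) : chevScalar A k j = chevScalar B k j := by
  rw [chevScalar_eq, chevScalar_eq, h k le_rfl]
  congr 2
  exact Finset.sum_congr rfl fun i _ => if_ctx_congr Iff.rfl (fun hi => h i hi.le) fun _ => rfl

theorem chevScalar_eq_one {A : KostantPartition n} {k j : Fin n}
    (h : ∀ i, i ≤ k → entry A i j = 0) : chevScalar A k j = 1 := by
  rw [chevScalar_congr (B := 0) fun i hi => (h i hi).trans (entry_zero i j).symm, chevScalar_eq]
  simp

/-- The element of `ExtHall n` at the root `(i, j)`; it is `1` unless `i < j`. -/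
def rootElem (i j : Fin n) : ExtHall n := hallElem (unitPart i j)

theorem rootElem_self (i : Fin n) : rootElem i i = 1 := by
  rw [rootElem, unitPart_self, hallElem_zero]

section Simple

variable {A : KostantPartition n} {h h' : Fin n}

open Classical in
theorem hallElem_mul_simple (A : KostantPartition n) (hh : (h : ℕ) + 1 = h') :
    hallElem A * rootElem h h' = ∑ k with CanMove A k h,
      chevScalar A k h' • hallElem (movePart A k h h') := by
  rw [hallElem, rootElem, unitPart_of_lt (lt_of_val_add_one hh), hallElem, basisElem_mul_basisElem,
    hallPoly_ofRoot A hh, dotProduct_zero, zpow_zero, one_smul, zero_add, chevProd, specialize_sum,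
    Finset.sum_filter]
  refine Finset.sum_congr rfl fun k _ => ?_
  split_ifs
  · rw [specialize_single, chevScalar, hallElem]
  · rfl

theorem movePart_self_unitPart (A : KostantPartition n) (hlt : h < h') :
    movePart A h h h' = A + unitPart h h' := by rw [movePart_self A hlt, unitPart_of_lt hlt]

theorem movePart_add_unitPart (A : KostantPartition n) {i : Fin n} (hi : i < h) (hi' : i < h') :
    movePart (A + unitPart i h) i h h' = A + unitPart i h' := by
  rw [unitPart_of_lt hi, movePart_add A hi hi', unitPart_of_lt hi']

theorem hallElem_mul_simple_of_col_eq_zero (hh : (h : ℕ) + 1 = h') (hA : ∀ k, entry A k h = 0) :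
    hallElem A * rootElem h h' = chevScalar A h h' • hallElem (A + unitPart h h') := by
  classical
  have hmove : Finset.univ.filter (CanMove A · h) = {h} := by
    ext k
    simp [CanMove, hA]
  rw [hallElem_mul_simple A hh, hmove, Finset.sum_singleton,
    movePart_self_unitPart A (lt_of_val_add_one hh)]

theorem hallElem_add_mul_simple {i : Fin n} (hh : (h : ℕ) + 1 = h') (hi : i < h)
    (hA : ∀ k, k ≠ i → entry A k h = 0) :
    hallElem (A + unitPart i h) * rootElem h h' =
      chevScalar A h h' • hallElem (A + unitPart i h + unitPart h h') +
        chevScalar A i h' • hallElem (A + unitPart i h') := by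
  classical
  have hlt := lt_of_val_add_one hh
  have hscalar (k : Fin n) : chevScalar (A + unitPart i h) k h' = chevScalar A k h' :=
    chevScalar_congr fun a _ => by rw [entry_add, entry_unitPart_of_col_ne hlt.ne', add_zero]
  have hmove : Finset.univ.filter (CanMove (A + unitPart i h) · h) = {h, i} := by
    ext k
    obtain rfl | hk := eq_or_ne k i
    · simp [CanMove, entry_add, entry_unitPart_self hi]
    · simp [CanMove, entry_add, entry_unitPart_of_row_ne hk, hA k hk, hk]
  rw [hallElem_mul_simple _ hh, hmove, Finset.sum_pair hi.ne', hscalar, hscalar,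
    movePart_self_unitPart _ hlt, movePart_add_unitPart A hi (hi.trans hlt)]

theorem hallElem_add_unitPart_mul_simple {i k : Fin n} (hh : (h : ℕ) + 1 = h') (hi : i < h)
    (hk : k < h) (hik : i ≠ k) :
    hallElem (unitPart k h + unitPart i h) * rootElem h h' =
      hallElem (unitPart k h + unitPart i h + unitPart h h') +
        hallElem (unitPart k h + unitPart i h') + hallElem (unitPart i h + unitPart k h') := by
  classical
  have hlt := lt_of_val_add_one hh
  have hscalar (a : Fin n) : chevScalar (unitPart k h + unitPart i h) a h' = 1 :=
    chevScalar_eq_one fun b _ => by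
      rw [entry_add, entry_unitPart_of_col_ne hlt.ne', entry_unitPart_of_col_ne hlt.ne']
  have hmove : Finset.univ.filter (CanMove (unitPart k h + unitPart i h) · h) = {h, i, k} := by
    ext a
    simp only [CanMove, entry_add, entry_unitPart_of_lt hi, entry_unitPart_of_lt hk,
      Finset.mem_filter_univ, Finset.mem_insert, Finset.mem_singleton]
    split_ifs <;> simp_all
  rw [hallElem_mul_simple _ hh, hmove,
    Finset.sum_insert (by simp [hi.ne', hk.ne']),
    Finset.sum_pair hik, hscalar, hscalar, hscalar, one_smul, one_smul, one_smul,
    movePart_self_unitPart _ hlt, movePart_add_unitPart _ hi (hi.trans hlt), ← add_assoc,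
    add_comm (unitPart k h) (unitPart i h), movePart_add_unitPart _ hk (hk.trans hlt)]

end Simple

theorem hallElem_mul_rootElem {A : KostantPartition n} {i j : Fin n} (hij : i < j)
    (hA : ∀ a b, b < j → entry A a b = 0) :
    hallElem A * rootElem i j = chevScalar A i j • hallElem (A + unitPart i j) := by
  refine induction_of_lt (P := fun j => ∀ A : KostantPartition n,
    (∀ a b, b < j → entry A a b = 0) → hallElem A * rootElem i j =
      chevScalar A i j • hallElem (A + unitPart i j)) hij
    (fun j hj A hA => hallElem_mul_simple_of_col_eq_zero hj
      fun k => hA k i (lt_of_val_add_one hj)) (fun h j hj hih ih A hA => ?_) A hA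
  have hhj := lt_of_val_add_one hj
  have hAh (k : Fin n) : entry A k h = 0 := hA k h hhj
  have hroot : rootElem i j = rootElem i h * rootElem h j - rootElem h j * rootElem i h := by
    have hright : rootElem i h * rootElem h j =
        hallElem (unitPart i h + unitPart h j) + rootElem i j := by
      have hmul := hallElem_add_mul_simple (A := 0) hj hih fun k _ => entry_zero k h
      rwa [zero_add, zero_add, chevScalar_eq_one fun k _ => entry_zero k j, one_smul,
        chevScalar_eq_one fun k _ => entry_zero k j, one_smul] at hmul
    have hleft : rootElem h j * rootElem i h = hallElem (unitPart i h + unitPart h j) := by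
      rw [rootElem, ih _ fun a b hb => entry_unitPart_of_col_ne (hb.trans hhj).ne,
        chevScalar_eq_one fun a _ => entry_unitPart_of_col_ne hhj.ne, one_smul, add_comm]
    rw [hright, hleft, add_sub_cancel_left]
  have hadd : hallElem (A + unitPart h j) * rootElem i h =
      hallElem (A + unitPart h j + unitPart i h) := by
    rw [ih _ fun a b hb => by
        rw [entry_add, hA a b (hb.trans hhj), entry_unitPart_of_col_ne (hb.trans hhj).ne],
      chevScalar_eq_one fun a _ => by rw [entry_add, hAh, entry_unitPart_of_col_ne hhj.ne],
      one_smul]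
  rw [hroot, mul_sub, ← mul_assoc, ← mul_assoc, ih A fun a b hb => hA a b (hb.trans hhj),
    chevScalar_eq_one fun a _ => hAh a, one_smul, hallElem_add_mul_simple hj hih fun k _ => hAh k,
    hallElem_mul_simple_of_col_eq_zero hj hAh, smul_mul_assoc, hadd, add_right_comm A,
    add_sub_cancel_left]

theorem rootElem_mul_rootElem_of_col_lt {i a j b : Fin n} (hia : i < a) (hab : a < b) :
    rootElem j b * rootElem i a = hallElem (unitPart j b + unitPart i a) := by
  rw [rootElem, hallElem_mul_rootElem hia fun c d hd => entry_unitPart_of_col_ne (hd.trans hab).ne,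
    chevScalar_eq_one fun c _ => entry_unitPart_of_col_ne hab.ne, one_smul]

theorem rootElem_mul_rootElem_of_row_lt {i j a : Fin n} (hij : i < j) (hja : j < a) :
    rootElem j a * rootElem i a = hallElem (unitPart i a + unitPart j a) := by
  rw [rootElem, hallElem_mul_rootElem (hij.trans hja) fun c d hd => entry_unitPart_of_col_ne hd.ne,
    chevScalar_eq_one fun c hc => entry_unitPart_of_row_ne (hc.trans_lt hij).ne, one_smul, add_comm]

theorem chevScalar_unitPart {i j a : Fin n} (hij : i < j) (hia : i < a) :
    chevScalar (unitPart i a) j a = vv ^ 2 := by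
  rw [chevScalar_eq, entry_unitPart_of_row_ne hij.ne', Finset.sum_eq_single i, if_pos hij,
    entry_unitPart_self hia]
  · simp
  · intro k _ hk
    rw [entry_unitPart_of_row_ne hk, ite_self]
  · simp

theorem chevScalar_unitPart_self {i a : Fin n} (hia : i < a) :
    chevScalar (unitPart i a) i a = 1 + vv ^ 2 := by
  rw [chevScalar_eq, entry_unitPart_self hia, Finset.sum_eq_zero fun k _ =>
    ite_eq_right_iff.2 fun hk => entry_unitPart_of_row_ne hk.ne]
  simp [Finset.sum_range_succ]

theorem rootElem_mul_rootElem_same_col {i j a : Fin n} (hij : i < j) (hja : j < a) :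
    rootElem i a * rootElem j a = vv ^ 2 • (rootElem j a * rootElem i a) := by
  rw [rootElem_mul_rootElem_of_row_lt hij hja, rootElem,
    hallElem_mul_rootElem hja fun c d hd => entry_unitPart_of_col_ne hd.ne,
    chevScalar_unitPart hij (hij.trans hja)]

theorem rootElem_mul_self {i a : Fin n} (hia : i < a) : rootElem i a * rootElem i a =
    (1 + vv ^ 2) • hallElem (unitPart i a + unitPart i a) := by
  rw [← chevScalar_unitPart_self hia]
  exact hallElem_mul_rootElem hia fun c d hd => entry_unitPart_of_col_ne hd.ne

section Commutator

variable {S R : Type*} [CommRing S] [Ring R] [Algebra S R] {x w y s t : R}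

theorem mul_commutator (c e : S) (hw : x * w = c • (w * x) + e • (s * t)) (hy : x * y = y * x)
    (ht : t * y = y * t) :
    x * (w * y - y * w) = c • ((w * y - y * w) * x) + e • ((s * y - y * s) * t) := by
  rw [mul_sub, ← mul_assoc, ← mul_assoc, hw, hy, add_mul, smul_mul_assoc, smul_mul_assoc,
    mul_assoc w, hy, mul_assoc s, ht, mul_assoc y x, hw]
  simp only [mul_add, sub_mul, mul_smul_comm, smul_sub, mul_assoc]
  abel

theorem mul_commutator_of_smul (c : S) (hw : x * w = c • (w * x)) (hy : x * y = y * x) :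
    x * (w * y - y * w) = c • ((w * y - y * w) * x) := by
  simpa using mul_commutator (s := 0) (t := 0) c 0 (by simpa using hw) hy (by simp)

end Commutator

section Relations

variable {i a j b h h' : Fin n}

theorem rootElem_mul_simple (hh : (h : ℕ) + 1 = h') (hi : i < h) :
    rootElem i h * rootElem h h' = rootElem h h' * rootElem i h + rootElem i h' := by
  rw [rootElem_mul_rootElem_of_col_lt hi (lt_of_val_add_one hh), add_comm (unitPart h h')]
  have hmul := hallElem_add_mul_simple (A := 0) hh hi fun k _ => entry_zero k h
  rwa [zero_add, zero_add, chevScalar_eq_one fun k _ => entry_zero k h', one_smul,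
    chevScalar_eq_one fun k _ => entry_zero k h', one_smul] at hmul

theorem rootElem_eq_commutator (hh : (h : ℕ) + 1 = h') (hi : i < h) :
    rootElem i h' = rootElem i h * rootElem h h' - rootElem h h' * rootElem i h := by
  rw [rootElem_mul_simple hh hi, add_sub_cancel_left]

theorem rootElem_comm_simple (hh : (h : ℕ) + 1 = h') (hia : i < a) (hah : a < h) :
    rootElem i a * rootElem h h' = rootElem h h' * rootElem i a := by
  have hlt := lt_of_val_add_one hh
  rw [rootElem_mul_rootElem_of_col_lt hia (hah.trans hlt), rootElem,
    hallElem_mul_simple_of_col_eq_zero hh fun k => entry_unitPart_of_col_ne hah.ne',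
    chevScalar_eq_one fun k _ => entry_unitPart_of_col_ne (hah.trans hlt).ne', one_smul, add_comm]

theorem rootElem_comm_of_lt (hia : i < a) (haj : a < j) (hjb : j < b) :
    rootElem i a * rootElem j b = rootElem j b * rootElem i a := by
  refine induction_of_lt (P := fun b => rootElem i a * rootElem j b = rootElem j b * rootElem i a)
    hjb (fun b hb => rootElem_comm_simple hb hia haj) fun h b hb hjh ih => ?_
  rw [rootElem_eq_commutator hb hjh]
  simpa using mul_commutator_of_smul (1 : Kv) (by simpa using ih)
    (rootElem_comm_simple hb hia (haj.trans hjh))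

theorem rootElem_mul_touching (hia : i < a) (hab : a < b) :
    rootElem i a * rootElem a b = rootElem a b * rootElem i a + rootElem i b := by
  refine induction_of_lt (P := fun b => rootElem i a * rootElem a b =
    rootElem a b * rootElem i a + rootElem i b) hab (fun b hb => rootElem_mul_simple hb hia)
    fun h b hb hah ih => ?_
  rw [rootElem_eq_commutator hb hah, rootElem_eq_commutator hb (hia.trans hah)]
  simpa using mul_commutator (s := rootElem i h) (t := 1) (1 : Kv) 1 (by simpa using ih)
    (rootElem_comm_simple hb hia hah) (by rw [one_mul, mul_one])

theorem rootElem_comm_of_nested_succ (hji : j < i) (hia : i < a) (hab : (a : ℕ) + 1 = b) :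
    rootElem i a * rootElem j b = rootElem j b * rootElem i a := by
  have hlt := lt_of_val_add_one hab
  have hja := hji.trans hia
  have hmul := hallElem_add_unitPart_mul_simple hab hia hja hji.ne'
  have htriple : hallElem (unitPart j a + unitPart i a + unitPart a b) =
      rootElem a b * (rootElem i a * rootElem j a) := by
    rw [← mul_assoc, rootElem_mul_rootElem_of_col_lt hia hlt, hallElem_mul_rootElem hja,
      chevScalar_eq_one, one_smul]
    · congr 1
      abel
    · intro c hc
      rw [entry_add, entry_unitPart_of_col_ne hlt.ne,
        entry_unitPart_of_row_ne (hc.trans_lt hji).ne]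
    · intro c e he
      rw [entry_add, entry_unitPart_of_col_ne (he.trans hlt).ne, entry_unitPart_of_col_ne he.ne]
  rw [htriple, ← rootElem_mul_rootElem_of_row_lt hji hia, add_comm (unitPart j a),
    ← rootElem_mul_rootElem_of_col_lt hja hlt, add_comm (unitPart i a),
    ← rootElem_mul_rootElem_of_col_lt hia hlt] at hmul
  rw [rootElem_eq_commutator hab hja, mul_sub, ← mul_assoc, ← mul_assoc, hmul,
    rootElem_mul_simple hab hia, ← rootElem_eq_commutator hab hja, add_mul, mul_assoc]
  abel

theorem rootElem_comm_of_nested (hji : j < i) (hia : i < a) (hab : a < b) :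
    rootElem i a * rootElem j b = rootElem j b * rootElem i a := by
  refine induction_of_lt (P := fun b => rootElem i a * rootElem j b = rootElem j b * rootElem i a)
    hab (fun b => rootElem_comm_of_nested_succ hji hia) fun h b hb hah ih => ?_
  rw [rootElem_eq_commutator hb (hji.trans (hia.trans hah))]
  simpa using mul_commutator_of_smul (1 : Kv) (by simpa using ih)
    (rootElem_comm_simple hb hia hah)

theorem rootElem_mul_rootElem_same_row_succ (hia : i < a) (hab : (a : ℕ) + 1 = b) :
    rootElem i a * rootElem i b = vv ^ 2 • (rootElem i b * rootElem i a) := by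
  have hlt := lt_of_val_add_one hab
  have htriple : rootElem a b * rootElem i a * rootElem i a =
      (1 + vv ^ 2) • hallElem (unitPart i a + unitPart i a + unitPart a b) := by
    rw [rootElem_mul_rootElem_of_col_lt hia hlt, hallElem_mul_rootElem hia,
      chevScalar_congr (B := unitPart i a), chevScalar_unitPart_self hia, add_assoc,
      add_comm (unitPart a b)]
    · intro c _
      rw [entry_add, entry_unitPart_of_col_ne hlt.ne, zero_add]
    · intro c e he
      rw [entry_add, entry_unitPart_of_col_ne (he.trans hlt).ne, entry_unitPart_of_col_ne he.ne]
  have hmul : hallElem (unitPart i a + unitPart i a) * rootElem a b =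
      hallElem (unitPart i a + unitPart i a + unitPart a b) + rootElem i b * rootElem i a := by
    rw [hallElem_add_mul_simple hab hia fun k hk => entry_unitPart_of_row_ne hk,
      chevScalar_eq_one fun c _ => entry_unitPart_of_col_ne hlt.ne', one_smul,
      chevScalar_eq_one fun c _ => entry_unitPart_of_col_ne hlt.ne', one_smul,
      rootElem_mul_rootElem_of_col_lt hia hlt, add_comm (unitPart i b)]
  have hcomm := rootElem_eq_commutator hab hia
  have hleft : rootElem i a * rootElem i b = (1 + vv ^ 2) • (rootElem i b * rootElem i a) -
      rootElem i b * rootElem i a := by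
    conv_lhs => rw [hcomm, mul_sub, ← mul_assoc, ← mul_assoc, rootElem_mul_self hia, smul_mul_assoc,
      hmul, rootElem_mul_simple hab hia, add_mul, htriple]
    rw [smul_add, add_sub_add_left_eq_sub]
  rw [hleft, add_smul, one_smul, add_sub_cancel_left]

theorem rootElem_mul_rootElem_same_row (hia : i < a) (hab : a < b) :
    rootElem i a * rootElem i b = vv ^ 2 • (rootElem i b * rootElem i a) := by
  refine induction_of_lt (P := fun b => rootElem i a * rootElem i b =
    vv ^ 2 • (rootElem i b * rootElem i a)) hab
    (fun b => rootElem_mul_rootElem_same_row_succ hia) fun h b hb hah ih => ?_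
  rw [rootElem_eq_commutator hb (hia.trans hah)]
  exact mul_commutator_of_smul _ ih (rootElem_comm_simple hb hia hah)

theorem rootElem_mul_crossing_succ (hij : i < j) (hja : j < a) (hab : (a : ℕ) + 1 = b) :
    rootElem i a * rootElem j b = vv ^ 2 • (rootElem j b * rootElem i a) +
      (vv ^ 2 - 1) • (rootElem i b * rootElem j a) := by
  rw [rootElem_eq_commutator hab hja, mul_sub, ← mul_assoc, ← mul_assoc,
    rootElem_mul_rootElem_same_col hij hja, smul_mul_assoc, mul_assoc,
    rootElem_mul_simple hab (hij.trans hja), add_mul, mul_assoc (rootElem a b),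
    rootElem_mul_rootElem_same_col hij hja, mul_add,
    rootElem_comm_of_nested hij hja (lt_of_val_add_one hab)]
  simp only [sub_mul, mul_smul_comm, smul_add, smul_sub, mul_assoc, sub_smul, one_smul]
  abel

theorem rootElem_mul_crossing (hij : i < j) (hja : j < a) (hab : a < b) :
    rootElem i a * rootElem j b = vv ^ 2 • (rootElem j b * rootElem i a) +
      (vv ^ 2 - 1) • (rootElem i b * rootElem j a) := by
  refine induction_of_lt (P := fun b => rootElem i a * rootElem j b =
    vv ^ 2 • (rootElem j b * rootElem i a) + (vv ^ 2 - 1) • (rootElem i b * rootElem j a)) hab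
    (fun b => rootElem_mul_crossing_succ hij hja) fun h b hb hah ih => ?_
  have hia := hij.trans hja
  rw [rootElem_eq_commutator hb (hja.trans hah), rootElem_eq_commutator hb (hia.trans hah)]
  exact mul_commutator _ _ ih (rootElem_comm_simple hb hia hah) (rootElem_comm_simple hb hja hah)

end Relations

end ExtHall

/-! ### The RTT relations of the positive part -/

/-- The RTT relations with parameter `q` between upper triangular arrays of elements, resolved into
the possible relative positions of the indices. -/
structure IsRTT {K R : Type*} [Field K] [Ring R] [Algebra K R] (q : K) (x : Fin n → Fin n → R) :
    Prop where
  zero : ∀ i j, j < i → x i j = 0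
  row : ∀ i a b, a < b → x i a * x i b = q⁻¹ • (x i b * x i a)
  col : ∀ i j a, i < j → x i a * x j a = q⁻¹ • (x j a * x i a)
  comm : ∀ i j a b, a < b → j < i → x i a * x j b = x j b * x i a
  cross : ∀ i j a b, a < b → i < j →
    x i a * x j b = x j b * x i a + (q⁻¹ - q) • (x i b * x j a)

namespace IsRTT

section Rtt

variable {R : Type*} [Ring R] [Algebra Kv R] {q : Kv} {x : Fin n → Fin n → R}

theorem rtt (hx : IsRTT q x) (hq : q ≠ 0) (i a j b : Fin n) :
    powDelta q i j • (x i a * x j b) - powDelta q a b • (x j b * x i a) =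
      ((q - q⁻¹) * (delta (b < a) - delta (i < j))) • (x j a * x i b) := by
  unfold powDelta delta
  rcases lt_trichotomy i j with hij | rfl | hij
  · rw [if_neg hij.ne, if_pos hij]
    rcases lt_trichotomy a b with hab | rfl | hab
    · rw [if_neg hab.ne, if_neg hab.not_gt, hx.cross i j a b hab hij, hx.comm j i a b hab hij]
      simp only [one_smul, add_sub_cancel_left]
      congr 1
      ring
    · rw [if_pos rfl, if_neg (lt_irrefl _), hx.col i j a hij, one_smul, ← sub_smul]
      congr 1
      ring
    · rw [if_neg hab.ne', if_pos hab, hx.comm j i b a hab hij]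
      simp
  · rw [if_pos rfl, if_neg (lt_irrefl _)]
    rcases lt_trichotomy a b with hab | rfl | hab
    · rw [if_neg hab.ne, if_neg hab.not_gt, hx.row i a b hab, smul_smul, mul_inv_cancel₀ hq]
      simp
    · simp
    · rw [if_neg hab.ne', if_pos hab, hx.row i b a hab, one_smul, ← sub_smul]
      congr 1
      ring
  · rw [if_neg hij.ne', if_neg hij.not_gt]
    rcases lt_trichotomy a b with hab | rfl | hab
    · rw [if_neg hab.ne, if_neg hab.not_gt, hx.comm i j a b hab hij]
      simp
    · rw [if_pos rfl, if_neg (lt_irrefl _), hx.col j i a hij, smul_smul, mul_inv_cancel₀ hq]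
      simp
    · rw [if_neg hab.ne', if_pos hab, hx.cross j i b a hab hij, one_smul, one_smul, sub_zero,
        mul_one, sub_add_cancel_left, ← neg_smul, neg_sub]

theorem of_rtt (hq : q ≠ 0) (hzero : ∀ i j, j < i → x i j = 0)
    (hx : ∀ i a j b : Fin n, powDelta q i j • (x i a * x j b) - powDelta q a b • (x j b * x i a) =
      ((q - q⁻¹) * (delta (b < a) - delta (i < j))) • (x j a * x i b)) : IsRTT q x := by
  have hcomm (i j a b : Fin n) (hab : a < b) (hij : j < i) : x i a * x j b = x j b * x i a := by
    have hrel := hx i a j b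
    rw [powDelta, powDelta, delta, delta, if_neg hij.ne', if_neg hab.ne, if_neg hab.not_gt,
      if_neg hij.not_gt] at hrel
    simpa [sub_eq_zero] using hrel
  refine ⟨hzero, fun i a b hab => ?_, fun i j a hij => ?_, hcomm, fun i j a b hab hij => ?_⟩
  · have hrel := hx i a i b
    rw [powDelta, powDelta, delta, delta, if_pos rfl, if_neg hab.ne, if_neg hab.not_gt,
      if_neg (lt_irrefl _), sub_self, mul_zero, zero_smul, sub_eq_zero, one_smul] at hrel
    rw [← hrel, smul_smul, inv_mul_cancel₀ hq, one_smul]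
  · have hrel := hx i a j a
    rw [powDelta, powDelta, delta, delta, if_neg hij.ne, if_pos rfl, if_neg (lt_irrefl _),
      if_pos hij, one_smul, sub_eq_iff_eq_add, ← add_smul] at hrel
    rw [hrel]
    congr 1
    ring
  · have hrel := hx i a j b
    rw [powDelta, powDelta, delta, delta, if_neg hij.ne, if_neg hab.ne, if_neg hab.not_gt,
      if_pos hij, one_smul, one_smul, sub_eq_iff_eq_add, hcomm j i a b hab hij] at hrel
    rw [hrel, add_comm]
    congr 2
    ring

end Rtt

section Field

variable {K R : Type*} [Field K] [Ring R] [Algebra K R] {q : K} {x : Fin n → Fin n → R}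

theorem reflect (hx : IsRTT q x) (hq : q ≠ 0) : IsRTT q⁻¹ fun i j => x j.rev i.rev where
  zero i j h := hx.zero _ _ (Fin.rev_lt_rev.2 h)
  row i a b h := by
    rw [hx.col b.rev a.rev i.rev (Fin.rev_lt_rev.2 h), smul_smul, inv_inv, mul_inv_cancel₀ hq,
      one_smul]
  col i j a h := by
    rw [hx.row a.rev j.rev i.rev (Fin.rev_lt_rev.2 h), smul_smul, inv_inv, mul_inv_cancel₀ hq,
      one_smul]
  comm i j a b hab hji := hx.comm _ _ _ _ (Fin.rev_lt_rev.2 hji) (Fin.rev_lt_rev.2 hab)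
  cross i j a b hab hij := by
    rw [hx.cross b.rev a.rev j.rev i.rev (Fin.rev_lt_rev.2 hij) (Fin.rev_lt_rev.2 hab), inv_inv,
      add_assoc, ← add_smul]
    simp

theorem exists_mul_eq_smul_mul_same_col (hx : IsRTT q x) (hq : q ≠ 0) (i j a : Fin n) :
    ∃ c : K, x i a * x j a = c • (x j a * x i a) := by
  obtain hij | rfl | hij := lt_trichotomy i j
  · exact ⟨_, hx.col i j a hij⟩
  · exact ⟨1, (one_smul _ _).symm⟩
  · exact ⟨q, by rw [hx.col j i a hij, smul_smul, mul_inv_cancel₀ hq, one_smul]⟩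

theorem span_col_mul_span_col_le (hx : IsRTT q x) {a b : Fin n} (hab : a < b) :
    Submodule.span K (Set.range (x · a)) * Submodule.span K (Set.range (x · b)) ≤
      Submodule.span K (Set.range (x · b)) * Submodule.span K (Set.range (x · a)) := by
  rw [Submodule.span_mul_span, Submodule.span_le]
  rintro _ ⟨_, ⟨i, rfl⟩, _, ⟨j, rfl⟩, rfl⟩
  have hmem (k l : Fin n) : x k b * x l a ∈
      Submodule.span K (Set.range (x · b)) * Submodule.span K (Set.range (x · a)) :=
    Submodule.mul_mem_mul (Submodule.subset_span ⟨k, rfl⟩) (Submodule.subset_span ⟨l, rfl⟩)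
  change x i a * x j b ∈ _
  obtain hij | rfl | hij := lt_trichotomy i j
  · rw [hx.cross i j a b hab hij]
    exact add_mem (hmem j i) (Submodule.smul_mem _ _ (hmem i j))
  · rw [hx.row i a b hab]
    exact Submodule.smul_mem _ _ (hmem i i)
  · rw [hx.comm i j a b hab hij]
    exact hmem j i

end Field

end IsRTT

namespace RTTPlus

theorem gen_of_gt (q : Kv) {i j : Fin n} (h : j < i) : gen q i j = 0 := by
  rw [gen, RingQuot.mkAlgHom_rel Kv (RTTPlusRel.zero (q := q) j i h), map_zero]

theorem isRTT_gen {q : Kv} (hq : q ≠ 0) : IsRTT q (gen q : Fin n → Fin n → RTTPlus n q) :=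
  IsRTT.of_rtt hq (fun _ _ h => gen_of_gt q h) fun i a j b => by
    have hrel := RingQuot.mkAlgHom_rel Kv (RTTPlusRel.rtt (q := q) i a j b)
    simp only [map_sub, map_smul, map_mul] at hrel
    exact hrel

section Lift

variable {q : Kv} {R : Type*} [Ring R] [Algebra Kv R] {x : Fin n → Fin n → R}

/-- The algebra homomorphism out of `RTTPlus n q` given by a family of elements of `R` that
satisfies the RTT relations. -/
def lift (hq : q ≠ 0) (hx : IsRTT q x) : RTTPlus n q →ₐ[Kv] R :=
  RingQuot.liftAlgHom Kv ⟨FreeAlgebra.lift Kv fun p => x p.1 p.2, by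
    intro a b h
    cases h with
    | zero i j h => simp [hx.zero j i h]
    | rtt i a j b => simpa using hx.rtt hq i a j b⟩

theorem lift_gen (hq : q ≠ 0) (hx : IsRTT q x) (i j : Fin n) :
    lift hq hx (gen q i j) = x i j := by
  rw [lift, gen, RingQuot.liftAlgHom_mkAlgHom_apply, FreeAlgebra.lift_ι_apply]

end Lift

theorem adjoin_gen (q : Kv) :
    Algebra.adjoin Kv (Set.range fun p : Fin n × Fin n => gen q p.1 p.2) = ⊤ := by
  have h := congrArg (Subalgebra.map (RingQuot.mkAlgHom Kv (RTTPlusRel n q)))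
    (FreeAlgebra.adjoin_range_ι Kv (Fin n × Fin n))
  rw [AlgHom.map_adjoin, Algebra.map_top,
    (AlgHom.range_eq_top _).2 (RingQuot.mkAlgHom_surjective Kv _), ← Set.range_comp] at h
  exact h

theorem algHom_ext {q : Kv} {R : Type*} [Semiring R] [Algebra Kv R] {f g : RTTPlus n q →ₐ[Kv] R}
    (h : ∀ i j, f (gen q i j) = g (gen q i j)) : f = g := by
  refine AlgHom.ext_of_adjoin_eq_top (adjoin_gen q) ?_
  rintro _ ⟨p, rfl⟩
  exact h p.1 p.2

end RTTPlus

/-! ### Ordered monomials -/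

section OrderedMonoid

variable {M ι : Type*} [Monoid M] [Preorder M] [MulLeftMono M] [MulRightMono M]

theorem list_prod_mul_le_mul_list_prod {l : List M} {y : M} (h : ∀ c ∈ l, c * y ≤ y * c) :
    l.prod * y ≤ y * l.prod := by
  induction l with
  | nil => simp
  | cons c l ih =>
    rw [List.forall_mem_cons] at h
    calc (c :: l).prod * y = c * (l.prod * y) := by rw [List.prod_cons, mul_assoc]
      _ ≤ c * (y * l.prod) := mul_le_mul_right (ih h.2) c
      _ = c * y * l.prod := (mul_assoc _ _ _).symm
      _ ≤ y * c * l.prod := mul_le_mul_left h.1 _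
      _ = y * (c :: l).prod := by rw [List.prod_cons, mul_assoc]

theorem list_prod_map_mul_le_of_mem {f g : ι → M} {l : List ι}
    (hl : l.Pairwise fun c c' => f c' * g c ≤ g c * f c') (hfg : ∀ c, f c * g c ≤ f c) {c : ι}
    (hc : c ∈ l) : (l.map f).prod * g c ≤ (l.map f).prod := by
  induction l with
  | nil => simp at hc
  | cons c₀ l ih =>
    rw [List.pairwise_cons] at hl
    rw [List.map_cons, List.prod_cons]
    obtain rfl | hc := List.mem_cons.1 hc
    · calc f c * (l.map f).prod * g c = f c * ((l.map f).prod * g c) := mul_assoc _ _ _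
        _ ≤ f c * (g c * (l.map f).prod) :=
          mul_le_mul_right (list_prod_mul_le_mul_list_prod (List.forall_mem_map.2 hl.1)) _
        _ = f c * g c * (l.map f).prod := (mul_assoc _ _ _).symm
        _ ≤ f c * (l.map f).prod := mul_le_mul_left (hfg c) _
    · rw [mul_assoc]
      exact mul_le_mul_right (ih hl.2 hc) _

end OrderedMonoid

section Spanning

variable {K R ι κ : Type*} [CommSemiring K] [Semiring R] [Algebra K R]

theorem adjoin_le_of_mul_mem {S : Set R} {M : Submodule K R} (h1 : 1 ∈ M)
    (hS : ∀ m ∈ M, ∀ s ∈ S, m * s ∈ M) : Subalgebra.toSubmodule (Algebra.adjoin K S) ≤ M := by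
  rw [Algebra.adjoin_eq_span, Submodule.span_le]
  intro x hx
  induction hx using Submonoid.closure_induction_right with
  | one => exact h1
  | mul_right x _ y hy ih => exact hS x ih y hy

theorem adjoin_mul_le_mul_adjoin {S : Set R} {Y : Submodule K R}
    (hS : Submodule.span K S * Y ≤ Y * Submodule.span K S) :
    Subalgebra.toSubmodule (Algebra.adjoin K S) * Y ≤
      Y * Subalgebra.toSubmodule (Algebra.adjoin K S) := by
  set A := Subalgebra.toSubmodule (Algebra.adjoin K S)
  have hSA : Submodule.span K S ≤ A := Submodule.span_le.2 Algebra.subset_adjoin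
  have hstep : Submodule.span K S * (Y * A) ≤ Y * A := calc
    Submodule.span K S * (Y * A) = Submodule.span K S * Y * A := (mul_assoc _ _ _).symm
    _ ≤ Y * A * A := mul_le_mul_left (hS.trans (mul_le_mul_right hSA Y)) A
    _ = Y * A := by rw [mul_assoc, (Algebra.adjoin K S).isIdempotentElem_toSubmodule]
  have hmonoid : ∀ w ∈ Submonoid.closure S, ∀ z ∈ Y, w * z ∈ Y * A := by
    intro w hw z hz
    induction hw using Submonoid.closure_induction_left with
    | one =>
      rw [one_mul, ← mul_one z]
      exact Submodule.mul_mem_mul hz (Algebra.adjoin K S).one_mem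
    | mul_left s hs w _ ih =>
      rw [mul_assoc]
      exact hstep (Submodule.mul_mem_mul (Submodule.subset_span hs) ih)
  change Subalgebra.toSubmodule (Algebra.adjoin K S) * Y ≤ _
  rw [← Submodule.span_eq Y, Algebra.adjoin_eq_span, Submodule.span_mul_span, Submodule.span_le,
    Submodule.span_eq]
  rintro _ ⟨w, hw, z, hz, rfl⟩
  exact hmonoid w hw z hz

theorem adjoin_iUnion_le_prod_map_adjoin {S : ι → Set R} {l : List ι}
    (hl : l.Pairwise fun c c' => Submodule.span K (S c') * Submodule.span K (S c) ≤
      Submodule.span K (S c) * Submodule.span K (S c')) :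
    Subalgebra.toSubmodule (Algebra.adjoin K (⋃ c ∈ l, S c)) ≤
      (l.map fun c => Subalgebra.toSubmodule (Algebra.adjoin K (S c))).prod := by
  refine adjoin_le_of_mul_mem (Submodule.one_le.1 (List.one_le_prod_of_one_le ?_)) ?_
  · simp
  · intro m hm s hs
    obtain ⟨c, hc, hs⟩ := Set.mem_iUnion₂.1 hs
    refine list_prod_map_mul_le_of_mem (g := fun c => Submodule.span K (S c))
      (hl.imp fun h => ?_) (fun c => ?_) hc (Submodule.mul_mem_mul hm (Submodule.subset_span hs))
    · exact adjoin_mul_le_mul_adjoin h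
    · have hle : Submodule.span K (S c) ≤ Subalgebra.toSubmodule (Algebra.adjoin K (S c)) :=
        Submodule.span_le.2 Algebra.subset_adjoin
      refine (mul_le_mul_right hle _).trans ?_
      rw [(Algebra.adjoin K (S c)).isIdempotentElem_toSubmodule]

theorem adjoin_singleton_eq_span_range_pow (y : R) :
    Subalgebra.toSubmodule (Algebra.adjoin K {y}) =
      Submodule.span K (Set.range fun k : ℕ => y ^ k) := by
  rw [Algebra.adjoin_eq_span, ← Submonoid.powers_eq_closure, Submonoid.coe_powers]

theorem prod_map_span_range_le [Nonempty κ] (f : ι → κ → R) {l : List ι} (hl : l.Nodup) :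
    (l.map fun t => Submodule.span K (Set.range (f t))).prod ≤
      Submodule.span K (Set.range fun M : ι → κ => (l.map fun t => f t (M t)).prod) := by
  classical
  induction l with
  | nil =>
    simp only [List.map_nil, List.prod_nil, Set.range_const]
    exact Submodule.one_eq_span.le
  | cons t l ih =>
    rw [List.nodup_cons] at hl
    rw [List.map_cons, List.prod_cons]
    refine (mul_le_mul_right (ih hl.2) _).trans ?_
    rw [Submodule.span_mul_span]
    refine Submodule.span_mono ?_
    rintro _ ⟨_, ⟨k, rfl⟩, _, ⟨M, rfl⟩, rfl⟩
    refine ⟨Function.update M t k, ?_⟩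
    simp only [List.map_cons, List.prod_cons, Function.update_self]
    congr 2
    exact List.map_congr_left fun s hs =>
      by rw [Function.update_of_ne (ne_of_mem_of_not_mem hs hl.1)]

end Spanning

/-- The ordered monomial in the entries of `x` with the exponents `M a i`, where `a` is the column
and `i` is the row; from left to right the columns decrease and, within a column, the rows
increase. -/
def rttMonomial {R : Type*} [Monoid R] (x : Fin n → Fin n → R) (M : Fin n → Fin n → ℕ) : R :=
  ((List.finRange n).reverse.map fun a => ((List.finRange n).map fun i => x i a ^ M a i).prod).prod

/-- The exponents of the ordered monomials in the entries `x i a` with `i ≤ a`; as in `rttMonomial`,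
the first index of an exponent is the column. -/
abbrev UpperExponent (n : ℕ) : Type :=
  {M : Fin n → Fin n → ℕ // ∀ a i, a < i → M a i = 0}

theorem map_rttMonomial {R S F : Type*} [Monoid R] [Monoid S] [FunLike F R S] [MonoidHomClass F R S]
    (f : F) (x : Fin n → Fin n → R) (M : Fin n → Fin n → ℕ) :
    f (rttMonomial x M) = rttMonomial (fun i a => f (x i a)) M := by
  simp [rttMonomial, map_list_prod, Function.comp_def]

namespace IsRTT

variable {K R : Type*} [Field K] [Ring R] [Algebra K R] {q : K} {x : Fin n → Fin n → R}

theorem rttMonomial_eq_zero (hx : IsRTT q x) {M : Fin n → Fin n → ℕ} {a i : Fin n} (hai : a < i)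
    (hM : M a i ≠ 0) : rttMonomial x M = 0 := by
  refine List.prod_eq_zero (List.mem_map.2 ⟨a, by simp, List.prod_eq_zero
    (List.mem_map.2 ⟨i, by simp, ?_⟩)⟩)
  rw [hx.zero i a hai, zero_pow hM]

theorem span_rttMonomial_le (hx : IsRTT q x) : Submodule.span K (Set.range (rttMonomial x)) ≤
    Submodule.span K (Set.range fun M : UpperExponent n => rttMonomial x M.1) := by
  refine Submodule.span_le.2 ?_
  rintro _ ⟨M, rfl⟩
  by_cases hM : ∀ a i, a < i → M a i = 0
  · exact Submodule.subset_span ⟨⟨M, hM⟩, rfl⟩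
  · push Not at hM
    obtain ⟨a, i, hai, hne⟩ := hM
    rw [hx.rttMonomial_eq_zero hai hne]
    exact Submodule.zero_mem _

theorem adjoin_col_le (hx : IsRTT q x) (hq : q ≠ 0) (a : Fin n) :
    Subalgebra.toSubmodule (Algebra.adjoin K (Set.range (x · a))) ≤ Submodule.span K
      (Set.range fun M : Fin n → ℕ => ((List.finRange n).map fun i => x i a ^ M i).prod) := by
  have hrange : Set.range (x · a) = ⋃ i ∈ List.finRange n, {x i a} := by
    ext y
    simp [eq_comm]
  have hcomm (i j : Fin n) : Submodule.span K {x j a} * Submodule.span K {x i a} ≤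
      Submodule.span K {x i a} * Submodule.span K {x j a} := by
    obtain ⟨c, hc⟩ := hx.exists_mul_eq_smul_mul_same_col hq j i a
    rw [Submodule.span_mul_span, Submodule.span_mul_span, Set.singleton_mul_singleton,
      Set.singleton_mul_singleton, hc, Submodule.span_singleton_le_iff_mem]
    exact Submodule.smul_mem _ c (Submodule.mem_span_singleton_self _)
  rw [hrange]
  refine (adjoin_iUnion_le_prod_map_adjoin (List.pairwise_of_forall hcomm)).trans ?_
  simp only [adjoin_singleton_eq_span_range_pow]
  exact prod_map_span_range_le (fun i (k : ℕ) => x i a ^ k) (List.nodup_finRange n)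

theorem adjoin_le_span_rttMonomial (hx : IsRTT q x) (hq : q ≠ 0) :
    Subalgebra.toSubmodule (Algebra.adjoin K (Set.range fun p : Fin n × Fin n => x p.1 p.2)) ≤
      Submodule.span K (Set.range fun M : UpperExponent n => rttMonomial x M.1) := by
  have hrange : (Set.range fun p : Fin n × Fin n => x p.1 p.2) =
      ⋃ a ∈ (List.finRange n).reverse, Set.range (x · a) := by
    ext y
    simp only [Set.mem_range, Prod.exists, List.mem_reverse, List.mem_finRange, Set.iUnion_true,
      Set.mem_iUnion]
    exact exists_comm
  have hpairwise : (List.finRange n).reverse.Pairwise fun b a =>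
      Submodule.span K (Set.range (x · a)) * Submodule.span K (Set.range (x · b)) ≤
        Submodule.span K (Set.range (x · b)) * Submodule.span K (Set.range (x · a)) :=
    List.pairwise_reverse.2 ((List.pairwise_lt_finRange n).imp hx.span_col_mul_span_col_le)
  rw [hrange]
  refine ((adjoin_iUnion_le_prod_map_adjoin hpairwise).trans ?_).trans hx.span_rttMonomial_le
  refine (List.Forall₂.prod_le_prod' (List.forall₂_map_left_iff.2 (List.forall₂_map_right_iff.2
    (List.forall₂_same.2 fun a _ => hx.adjoin_col_le hq a)))).trans ?_
  exact prod_map_span_range_le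
    (fun a (M : Fin n → ℕ) => ((List.finRange n).map fun i => x i a ^ M i).prod)
    (List.nodup_reverse.2 (List.nodup_finRange n))

end IsRTT

/-! ### The elements `t̄_{ij}` of the extended Hall algebra -/

theorem dotProduct_wt_unitPart {i j : Fin n} (hij : i ≤ j) (m : Fin n → ℤ) :
    dotProduct (wt (unitPart i j)) m = m j - m i := by
  obtain rfl | hij := hij.eq_or_lt
  · rw [unitPart_self, wt_zero, zero_dotProduct, sub_self]
  have hwt : wt (unitPart i j) = Pi.single j 1 - Pi.single i 1 := by
    ext k
    simp [wt, colSum, rowSum, toMat, entry_unitPart_of_lt hij, Pi.single_apply, ite_and]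
  rw [hwt, sub_dotProduct, single_one_dotProduct, single_one_dotProduct]

theorem vv_sub_inv_ne_zero : vv - vv⁻¹ ≠ 0 := by
  intro h
  have hpow : vv ^ (1 : ℤ) = vv ^ (-1 : ℤ) := by rwa [zpow_one, zpow_neg_one, ← sub_eq_zero]
  exact absurd (vv_zpow_injective hpow) (by norm_num)

/-- The torus exponent of `t̄_{ij}` for `i ≤ j`: the unit vector at `i` when `i = j`, and minus the
indicator of the open interval `(i, j)` otherwise. -/
def tbarWeight (i j : Fin n) : Fin n → ℤ := if i = j then Pi.single i 1 else -between i j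

theorem tbarWeight_self (i : Fin n) : tbarWeight i i = Pi.single i 1 := if_pos rfl

theorem tbarWeight_of_ne {i j : Fin n} (hij : i ≠ j) : tbarWeight i j = -between i j := if_neg hij

theorem tbarWeight_of_lt_left {i j k : Fin n} (hki : k < i) : tbarWeight i j k = 0 := by
  unfold tbarWeight
  split_ifs
  · exact Pi.single_eq_of_ne hki.ne _
  · simp [between, hki.not_gt]

theorem tbarWeight_of_right_lt {i j k : Fin n} (hjk : j < k) : tbarWeight i j k = 0 := by
  unfold tbarWeight
  split_ifs with hij
  · exact Pi.single_eq_of_ne (hij ▸ hjk.ne') _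
  · simp [between, hjk.not_gt]

theorem tbarWeight_left {i j : Fin n} (hij : i ≠ j) : tbarWeight i j i = 0 := by
  simp [tbarWeight_of_ne hij, between]

theorem tbarWeight_right {i j : Fin n} (hij : i ≠ j) : tbarWeight i j j = 0 := by
  simp [tbarWeight_of_ne hij, between]

theorem tbarWeight_between {i j k : Fin n} (hik : i < k) (hkj : k < j) : tbarWeight i j k = -1 := by
  simp [tbarWeight_of_ne (hik.trans hkj).ne, between, hik, hkj]

theorem tbarWeight_add_swap {i j a b : Fin n} (hij : i < j) (hja : j ≤ a) (hab : a < b) :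
    tbarWeight i a + tbarWeight j b = tbarWeight i b + tbarWeight j a := by
  rw [tbarWeight_of_ne (hij.trans_le hja).ne, tbarWeight_of_ne (hja.trans_lt hab).ne,
    tbarWeight_of_ne (hij.trans (hja.trans_lt hab)).ne]
  ext k
  obtain rfl | hja := hja.eq_or_lt
  · rw [tbarWeight_self]
    simp only [between, Pi.add_apply, Pi.neg_apply, Pi.single_apply, Fin.ext_iff, Fin.lt_def] at *
    split_ifs <;> omega
  · rw [tbarWeight_of_ne hja.ne]
    simp only [between, Pi.add_apply, Pi.neg_apply, Fin.lt_def] at *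
    split_ifs <;> omega

/-- The coefficient of `t̄_{ij}` at its basis vector. -/
def tbarScalar (i j : Fin n) : Kv := if i < j then vv - vv⁻¹ else if i = j then 1 else 0

theorem tbarScalar_of_lt {i j : Fin n} (hij : i < j) : tbarScalar i j = vv - vv⁻¹ := if_pos hij

theorem tbarScalar_self (i : Fin n) : tbarScalar i i = 1 := by
  rw [tbarScalar, if_neg (lt_irrefl i), if_pos rfl]

theorem tbarScalar_ne_zero {i j : Fin n} (hij : i ≤ j) : tbarScalar i j ≠ 0 := by
  obtain rfl | hij := hij.eq_or_lt
  · rw [tbarScalar_self]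
    exact one_ne_zero
  · rw [tbarScalar_of_lt hij]
    exact vv_sub_inv_ne_zero

namespace ExtHall

/-- The basis vector of `ExtHall n` at the zero matrix with torus part `m`. -/
def torusElem (m : Fin n → ℤ) : ExtHall n := basisElem 0 m

theorem torusElem_mul_basisElem (m k : Fin n → ℤ) (A : KostantPartition n) :
    torusElem m * basisElem A k = basisElem A (m + k) := by
  rw [torusElem, basisElem_mul_basisElem, hallPoly_zero_left, specialize_single, wt_zero,
    zero_dotProduct]
  simp

theorem basisElem_mul_torusElem (m k : Fin n → ℤ) (A : KostantPartition n) :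
    basisElem A k * torusElem m = vv ^ dotProduct (wt A) m • basisElem A (k + m) := by
  rw [torusElem, basisElem_mul_basisElem, hallPoly_zero_right, specialize_single]
  simp

theorem torusElem_mul_hallElem (m : Fin n → ℤ) (A : KostantPartition n) :
    torusElem m * hallElem A = basisElem A m := by
  rw [hallElem, torusElem_mul_basisElem, add_zero]

theorem hallElem_mul_torusElem (m : Fin n → ℤ) (A : KostantPartition n) :
    hallElem A * torusElem m = vv ^ dotProduct (wt A) m • (torusElem m * hallElem A) := by
  rw [hallElem, basisElem_mul_torusElem, zero_add, ← torusElem_mul_hallElem, hallElem]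

theorem torusElem_mul_torusElem (m k : Fin n → ℤ) :
    (torusElem m * torusElem k : ExtHall n) = torusElem (m + k) := torusElem_mul_basisElem m k 0

/-- The element of `ExtHall n` whose image under `toKHat` is `tBar i j`. -/
def tbar (i j : Fin n) : ExtHall n := tbarScalar i j • (torusElem (tbarWeight i j) * rootElem i j)

theorem tbar_of_gt {i j : Fin n} (h : j < i) : tbar i j = 0 := by
  rw [tbar, tbarScalar, if_neg h.not_gt, if_neg h.ne', zero_smul]

theorem toKHat_tbar (i j : Fin n) : toKHat (tbar i j) = tBar i j := by
  obtain hij | rfl | hij := lt_trichotomy i j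
  · rw [tbar, rootElem, torusElem_mul_hallElem, map_smul, toKHat_basisElem, tBar_of_lt hij,
      tbarScalar_of_lt hij, tbarWeight_of_ne hij.ne, unitPart_of_lt hij]
  · rw [tbar, rootElem, torusElem_mul_hallElem, map_smul, toKHat_basisElem, tBar_self,
      tbarScalar_self, tbarWeight_self, unitPart_self, one_smul]
  · rw [tbar_of_gt hij, map_zero, tBar_of_gt hij]

/-! ### The RTT relations in the extended Hall algebra -/

section Relations

variable {i j a b : Fin n}

theorem tbar_mul_tbar (hia : i ≤ a) (j b : Fin n) : tbar i a * tbar j b =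
    (tbarScalar i a * tbarScalar j b * vv ^ (tbarWeight j b a - tbarWeight j b i)) •
      (torusElem (tbarWeight i a + tbarWeight j b) * (rootElem i a * rootElem j b)) := by
  have hmove : rootElem i a * torusElem (tbarWeight j b) =
      vv ^ (tbarWeight j b a - tbarWeight j b i) •
        (torusElem (tbarWeight j b) * rootElem i a) := by
    rw [rootElem, hallElem_mul_torusElem, dotProduct_wt_unitPart hia]
  rw [tbar, tbar, smul_mul_smul_comm, mul_assoc, ← mul_assoc (rootElem i a), hmove, smul_mul_assoc,
    mul_smul_comm, smul_smul, ← torusElem_mul_torusElem]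
  simp only [mul_assoc]

theorem tbar_mul_tbar_eq_smul (hia : i ≤ a) (hjb : j ≤ b) {c d : Kv}
    (hroot : rootElem i a * rootElem j b = c • (rootElem j b * rootElem i a))
    (hscalar : vv ^ (tbarWeight j b a - tbarWeight j b i) * c =
      vv ^ (tbarWeight i a b - tbarWeight i a j) * d) :
    tbar i a * tbar j b = d • (tbar j b * tbar i a) := by
  rw [tbar_mul_tbar hia, tbar_mul_tbar hjb, hroot, mul_smul_comm, smul_smul, smul_smul, mul_assoc,
    hscalar, add_comm (tbarWeight i a)]
  congr 1
  ring

theorem tbar_mul_tbar_comm (hia : i ≤ a) (hjb : j ≤ b)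
    (hroot : rootElem i a * rootElem j b = rootElem j b * rootElem i a)
    (hja : tbarWeight j b a = tbarWeight j b i) (hib : tbarWeight i a b = tbarWeight i a j) :
    tbar i a * tbar j b = tbar j b * tbar i a := by
  rw [tbar_mul_tbar_eq_smul hia hjb (c := 1) (d := 1) (by rw [hroot, one_smul])
    (by rw [hja, hib, sub_self, sub_self]), one_smul]

theorem tbar_mul_tbar_same_row (hab : a < b) :
    tbar i a * tbar i b = vv • (tbar i b * tbar i a) := by
  obtain hia | rfl | hia := lt_trichotomy i a
  · refine tbar_mul_tbar_eq_smul hia.le (hia.trans hab).le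
      (rootElem_mul_rootElem_same_row hia hab) ?_
    rw [tbarWeight_between hia hab, tbarWeight_left (hia.trans hab).ne,
      tbarWeight_of_right_lt hab, tbarWeight_left hia.ne]
    have := vv_ne_zero
    simp [field]
  · refine tbar_mul_tbar_eq_smul (c := 1) le_rfl hab.le (by simp [rootElem_self]) ?_
    rw [tbarWeight_of_right_lt hab, tbarWeight_self, Pi.single_eq_same]
    simp [vv_ne_zero]
  · rw [tbar_of_gt hia, zero_mul, mul_zero, smul_zero]

theorem tbar_mul_tbar_same_col (hij : i < j) :
    tbar i a * tbar j a = vv • (tbar j a * tbar i a) := by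
  obtain hja | rfl | hja := lt_trichotomy j a
  · refine tbar_mul_tbar_eq_smul (hij.trans hja).le hja.le
      (rootElem_mul_rootElem_same_col hij hja) ?_
    rw [tbarWeight_right hja.ne, tbarWeight_of_lt_left hij,
      tbarWeight_right (hij.trans hja).ne, tbarWeight_between hij hja]
    simp [pow_two]
  · refine tbar_mul_tbar_eq_smul (c := 1) hij.le le_rfl (by simp [rootElem_self]) ?_
    rw [tbarWeight_of_lt_left hij, tbarWeight_self, Pi.single_eq_same]
    simp
  · rw [tbar_of_gt hja, zero_mul, mul_zero, smul_zero]

theorem tbar_comm_of_nested (hji : j < i) (hab : a < b) :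
    tbar i a * tbar j b = tbar j b * tbar i a := by
  obtain hai | hia := lt_or_ge a i
  · rw [tbar_of_gt hai, zero_mul, mul_zero]
  have hroot : rootElem i a * rootElem j b = rootElem j b * rootElem i a := by
    obtain rfl | hia := hia.eq_or_lt
    · rw [rootElem_self, one_mul, mul_one]
    · exact rootElem_comm_of_nested hji hia hab
  refine tbar_mul_tbar_comm hia ((hji.trans_le hia).trans hab).le hroot ?_ ?_
  · rw [tbarWeight_between (hji.trans_le hia) hab, tbarWeight_between hji (hia.trans_lt hab)]
  · rw [tbarWeight_of_right_lt hab, tbarWeight_of_lt_left hji]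

theorem tbar_comm_of_disjoint (hia : i ≤ a) (haj : a < j) (hjb : j ≤ b) :
    tbar i a * tbar j b = tbar j b * tbar i a := by
  have hroot : rootElem i a * rootElem j b = rootElem j b * rootElem i a := by
    obtain rfl | hia := hia.eq_or_lt
    · rw [rootElem_self, one_mul, mul_one]
    obtain rfl | hjb := hjb.eq_or_lt
    · rw [rootElem_self, one_mul, mul_one]
    · exact rootElem_comm_of_lt hia haj hjb
  refine tbar_mul_tbar_comm hia hjb hroot ?_ ?_
  · rw [tbarWeight_of_lt_left haj, tbarWeight_of_lt_left (hia.trans_lt haj)]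
  · rw [tbarWeight_of_right_lt (haj.trans_le hjb), tbarWeight_of_right_lt haj]

theorem tbar_mul_touching (hia : i < a) (hab : a < b) : tbar i a * tbar a b =
    tbar a b * tbar i a + (vv - vv⁻¹) • (tbar i b * tbar a a) := by
  rw [tbar_mul_tbar hia.le, tbar_mul_tbar hab.le, tbar_mul_tbar (hia.trans hab).le,
    rootElem_mul_touching hia hab, rootElem_self, mul_one, add_comm (tbarWeight a b),
    ← tbarWeight_add_swap hia le_rfl hab, tbarWeight_left hab.ne, tbarWeight_right hia.ne,
    tbarWeight_of_lt_left hia, tbarWeight_of_right_lt hab, tbarWeight_of_right_lt hab,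
    tbarWeight_of_lt_left hia, tbarScalar_of_lt hia, tbarScalar_of_lt hab,
    tbarScalar_of_lt (hia.trans hab), tbarScalar_self, mul_add, smul_add, smul_smul]
  congr 2
  ring

theorem tbar_mul_crossing (hij : i < j) (hja : j < a) (hab : a < b) : tbar i a * tbar j b =
    tbar j b * tbar i a + (vv - vv⁻¹) • (tbar i b * tbar j a) := by
  have hia := hij.trans hja
  have hjb := hja.trans hab
  rw [tbar_mul_tbar hia.le, tbar_mul_tbar hjb.le, tbar_mul_tbar (hia.trans hab).le,
    rootElem_mul_crossing hij hja hab, add_comm (tbarWeight j b),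
    ← tbarWeight_add_swap hij hja.le hab, tbarWeight_between hja hab, tbarWeight_of_lt_left hij,
    tbarWeight_of_right_lt hab, tbarWeight_between hij hja, tbarWeight_of_right_lt hab,
    tbarWeight_of_lt_left hij, tbarScalar_of_lt hia, tbarScalar_of_lt hjb,
    tbarScalar_of_lt (hia.trans hab), tbarScalar_of_lt hja, mul_add, smul_add, mul_smul_comm,
    mul_smul_comm, smul_smul, smul_smul, smul_smul]
  have := vv_ne_zero
  congr 2 <;> simp only [zero_sub, sub_zero, sub_self, neg_neg, zpow_neg, zpow_one, zpow_zero] <;>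
    field_simp

theorem tbar_mul_tbar_cross (hab : a < b) (hij : i < j) : tbar i a * tbar j b =
    tbar j b * tbar i a + (vv - vv⁻¹) • (tbar i b * tbar j a) := by
  obtain hai | hia := lt_or_ge a i
  · rw [tbar_of_gt hai, tbar_of_gt (hai.trans hij), zero_mul, mul_zero, mul_zero, smul_zero,
      add_zero]
  obtain hbj | hjb := lt_or_ge b j
  · rw [tbar_of_gt hbj, tbar_of_gt (hab.trans hbj), zero_mul, mul_zero, mul_zero, smul_zero,
      add_zero]
  obtain haj | rfl | hja := lt_trichotomy a j
  · rw [tbar_of_gt haj, mul_zero, smul_zero, add_zero, tbar_comm_of_disjoint hia haj hjb]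
  · exact tbar_mul_touching hij hab
  · exact tbar_mul_crossing hij hja hab

theorem isRTT_tbar : IsRTT vv⁻¹ (tbar : Fin n → Fin n → ExtHall n) where
  zero _ _ h := tbar_of_gt h
  row _ _ _ hab := by rw [inv_inv, tbar_mul_tbar_same_row hab]
  col _ _ _ hij := by rw [inv_inv, tbar_mul_tbar_same_col hij]
  comm _ _ _ _ hab hji := tbar_comm_of_nested hji hab
  cross _ _ _ _ hab hij := by rw [inv_inv, tbar_mul_tbar_cross hab hij]

end Relations

/-! ### Ordered monomials in the `t̄_{ij}` -/

/-- Nonzero multiples of the basis vector of `ExtHall n` at the index `k`. -/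
def IsBasisMultiple (x : ExtHall n) (k : KostantPartition n × (Fin n → ℤ)) : Prop :=
  ∃ c : Kv, c ≠ 0 ∧ x = c • basisElem k.1 k.2

/-- The index of the basis vector proportional to `t̄_{ij}`. -/
def tbarIndex (i j : Fin n) : KostantPartition n × (Fin n → ℤ) := (unitPart i j, tbarWeight i j)

/-- The columns of `A` to the left of column `a` vanish, so that multiplying `A` on the right by
a root element in column `a` or further right only adds an entry. -/
def VanishesLeftOf (A : KostantPartition n) (a : Fin n) : Prop := ∀ i b, b < a → entry A i b = 0

theorem VanishesLeftOf.add_smul_unitPart {A : KostantPartition n} {a : Fin n}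
    (hA : VanishesLeftOf A a) (k : ℕ) (i : Fin n) :
    VanishesLeftOf (A + k • unitPart i a) a := by
  intro c b hb
  induction k with
  | zero => rw [zero_smul, add_zero, hA c b hb]
  | succ k ih => rw [succ_nsmul, ← add_assoc, entry_add, ih, entry_unitPart_of_col_ne hb.ne]

theorem exists_hallElem_mul_rootElem {A : KostantPartition n} {i a : Fin n} (hia : i ≤ a)
    (hA : VanishesLeftOf A a) :
    ∃ e : Kv, e ≠ 0 ∧ hallElem A * rootElem i a = e • hallElem (A + unitPart i a) := by
  obtain rfl | hia := hia.eq_or_lt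
  · exact ⟨1, one_ne_zero, by rw [rootElem_self, unitPart_self, mul_one, add_zero, one_smul]⟩
  · exact ⟨_, chevScalar_ne_zero _ _ _, hallElem_mul_rootElem hia hA⟩

namespace IsBasisMultiple

variable {x : ExtHall n} {k : KostantPartition n × (Fin n → ℤ)} {i a : Fin n}

theorem mul_tbar (hx : IsBasisMultiple x k) (hia : i ≤ a) (hk : VanishesLeftOf k.1 a) :
    IsBasisMultiple (x * tbar i a) (k + tbarIndex i a) := by
  obtain ⟨c, hc, rfl⟩ := hx
  obtain ⟨e, he, hmul⟩ := exists_hallElem_mul_rootElem hia hk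
  refine ⟨c * tbarScalar i a * vv ^ dotProduct (wt k.1) (tbarWeight i a) * e,
    mul_ne_zero (mul_ne_zero (mul_ne_zero hc (tbarScalar_ne_zero hia))
      (zpow_ne_zero _ vv_ne_zero)) he, ?_⟩
  rw [tbar, smul_mul_smul_comm, ← mul_assoc, basisElem_mul_torusElem, smul_mul_assoc,
    ← torusElem_mul_hallElem, mul_assoc, hmul, mul_smul_comm, torusElem_mul_hallElem, smul_smul,
    smul_smul]
  rfl

theorem mul_tbar_pow (hx : IsBasisMultiple x k) (hk : VanishesLeftOf k.1 a) {N : ℕ}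
    (hN : a < i → N = 0) : IsBasisMultiple (x * tbar i a ^ N) (k + N • tbarIndex i a) := by
  obtain hai | hia := lt_or_ge a i
  · rwa [hN hai, pow_zero, mul_one, zero_smul, add_zero]
  clear hN
  induction N with
  | zero => rwa [pow_zero, mul_one, zero_smul, add_zero]
  | succ N ih =>
    rw [pow_succ, ← mul_assoc, succ_nsmul, ← add_assoc]
    exact ih.mul_tbar hia (hk.add_smul_unitPart N i)

theorem mul_column (hx : IsBasisMultiple x k) (hk : VanishesLeftOf k.1 a) {N : Fin n → ℕ}
    (hN : ∀ i, a < i → N i = 0) (l : List (Fin n)) :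
    IsBasisMultiple (x * (l.map fun i => tbar i a ^ N i).prod)
        (k + (l.map fun i => N i • tbarIndex i a).sum) ∧
      VanishesLeftOf (k + (l.map fun i => N i • tbarIndex i a).sum).1 a := by
  induction l generalizing x k with
  | nil => simpa using ⟨hx, hk⟩
  | cons i l ih =>
    simp only [List.map_cons, List.prod_cons, List.sum_cons]
    rw [← mul_assoc, ← add_assoc]
    exact ih (hx.mul_tbar_pow hk (hN i)) (hk.add_smul_unitPart _ i)

theorem mul_columns (hx : IsBasisMultiple x k) {M : Fin n → Fin n → ℕ}
    (hM : ∀ a i, a < i → M a i = 0) {l : List (Fin n)} (l' : List (Fin n))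
    (hl : l.Pairwise (· > ·)) (hk : ∀ a ∈ l, VanishesLeftOf k.1 a) :
    IsBasisMultiple (x * (l.map fun a => (l'.map fun i => tbar i a ^ M a i).prod).prod)
      (k + (l.map fun a => (l'.map fun i => M a i • tbarIndex i a).sum).sum) := by
  induction l generalizing x k with
  | nil => simpa using hx
  | cons a l ih =>
    obtain ⟨hal, hl⟩ := List.pairwise_cons.1 hl
    simp only [List.map_cons, List.prod_cons, List.sum_cons]
    rw [← mul_assoc, ← add_assoc]
    obtain ⟨hxa, hka⟩ := hx.mul_column (hk a List.mem_cons_self) (hM a) l'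
    exact ih hxa hl fun b hb c d hd => hka c d (hd.trans (hal b hb))

end IsBasisMultiple

/-- The index of the basis vector proportional to the ordered monomial with exponents `M`. -/
def monomialIndex (M : Fin n → Fin n → ℕ) : KostantPartition n × (Fin n → ℤ) :=
  ∑ a, ∑ i, M a i • tbarIndex i a

theorem isBasisMultiple_rttMonomial (M : UpperExponent n) :
    IsBasisMultiple (rttMonomial tbar M.1) (monomialIndex M.1) := by
  have hone : IsBasisMultiple (1 : ExtHall n) 0 := ⟨1, one_ne_zero, (one_smul _ _).symm⟩
  have hprod := hone.mul_columns M.2 (List.finRange n)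
    (List.pairwise_reverse.2 (List.pairwise_lt_finRange n)) fun a _ i b _ => entry_zero i b
  have hindex : ((List.finRange n).reverse.map fun a =>
      ((List.finRange n).map fun i => M.1 a i • tbarIndex i a).sum).sum = monomialIndex M.1 := by
    rw [List.map_reverse, List.sum_reverse]
    simp only [monomialIndex, Fin.sum_univ_def]
  rwa [one_mul, zero_add, hindex] at hprod

theorem unitPart_apply_posRoot (j b : Fin n) {i a : Fin n} (hia : i < a) :
    unitPart j b (posRoot i a hia) = if j = i ∧ b = a then 1 else 0 := by
  rw [← entry_of_lt (unitPart j b) hia]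
  split_ifs with h
  · rw [h.1, h.2, entry_unitPart_self hia]
  · obtain hj | hb := not_and_or.1 h
    · exact entry_unitPart_of_row_ne (Ne.symm hj)
    · exact entry_unitPart_of_col_ne (Ne.symm hb)

theorem monomialIndex_fst_apply (M : Fin n → Fin n → ℕ) {i a : Fin n} (hia : i < a) :
    (monomialIndex M).1 (posRoot i a hia) = M a i := by
  simp [monomialIndex, tbarIndex, Prod.fst_sum, Finset.sum_apply, unitPart_apply_posRoot, ite_and]

theorem monomialIndex_snd (M : Fin n → Fin n → ℕ) :
    (monomialIndex M).2 =
      (fun a => (M a a : ℤ)) + ∑ b, ∑ i, if i = b then 0 else M b i • tbarWeight i b := by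
  have hsplit (b i : Fin n) : M b i • tbarWeight i b =
      (if i = b then (Pi.single b (M b b : ℤ) : Fin n → ℤ) else 0) +
        if i = b then 0 else M b i • tbarWeight i b := by
    split_ifs with hib
    · rw [hib, tbarWeight_self, add_zero, ← Pi.single_smul, nsmul_one]
    · rw [zero_add]
  simp only [monomialIndex, tbarIndex, Prod.snd_sum, Prod.smul_snd]
  rw [Finset.sum_congr rfl fun b _ => Finset.sum_congr rfl fun i _ => hsplit b i]
  simp only [Finset.sum_add_distrib, Finset.sum_ite_eq', Finset.mem_univ, if_true]
  rw [Finset.univ_sum_single]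

theorem monomialIndex_injective :
    Function.Injective fun M : UpperExponent n => monomialIndex M.1 := by
  rintro ⟨M, hM⟩ ⟨M', hM'⟩ h
  change monomialIndex M = monomialIndex M' at h
  have hoff (a i : Fin n) (hia : i ≠ a) : M a i = M' a i := by
    obtain hlt | hlt := lt_or_gt_of_ne hia
    · rw [← monomialIndex_fst_apply M hlt, h, monomialIndex_fst_apply M' hlt]
    · rw [hM a i hlt, hM' a i hlt]
  have hweight : (∑ b, ∑ i, if i = b then 0 else M b i • tbarWeight i b) =
      ∑ b, ∑ i, if i = b then 0 else M' b i • tbarWeight i b :=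
    Finset.sum_congr rfl fun b _ => Finset.sum_congr rfl fun i _ =>
      if_ctx_congr Iff.rfl (fun _ => rfl) fun hib => by rw [hoff b i hib]
  have hdiag : (fun a => (M a a : ℤ)) = fun a => (M' a a : ℤ) := by
    have hsnd := congrArg Prod.snd h
    rwa [monomialIndex_snd, monomialIndex_snd, hweight, add_left_inj] at hsnd
  ext a i
  obtain rfl | hia := eq_or_ne i a
  · exact Nat.cast_injective (congrFun hdiag i)
  · exact hoff a i hia

theorem linearIndependent_rttMonomial :
    LinearIndependent Kv fun M : UpperExponent n => rttMonomial tbar M.1 := by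
  choose c hc hM using isBasisMultiple_rttMonomial (n := n)
  have hbasis : LinearIndependent Kv fun k : KostantPartition n × (Fin n → ℤ) =>
      basisElem k.1 k.2 := Finsupp.linearIndependent_single_one Kv _
  have hmul := (hbasis.comp _ monomialIndex_injective).units_smul fun M => Units.mk0 (c M) (hc M)
  convert hmul using 1
  funext M
  exact hM M

end ExtHall

namespace RTTPlus

theorem span_rttMonomial_gen {q : Kv} (hq : q ≠ 0) : Submodule.span Kv
    (Set.range fun M : UpperExponent n => rttMonomial (gen q) M.1) = ⊤ := by
  refine top_le_iff.1 (le_of_eq_of_le ?_ ((isRTT_gen hq).adjoin_le_span_rttMonomial hq))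
  rw [adjoin_gen, Algebra.top_toSubmodule]

/-! ### The isomorphism with the subalgebra `U` -/

/-- The algebra homomorphism from `RTTPlus n v⁻¹` to the extended Hall algebra that sends the
generators to the elements `ExtHall.tbar i j`. -/
def toExtHall (n : ℕ) : RTTPlus n vv⁻¹ →ₐ[Kv] ExtHall n :=
  lift (inv_ne_zero vv_ne_zero) ExtHall.isRTT_tbar

theorem toExtHall_gen (i j : Fin n) : toExtHall n (gen vv⁻¹ i j) = ExtHall.tbar i j :=
  lift_gen _ _ _ _

theorem toExtHall_injective : Function.Injective (toExtHall n) := by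
  refine (injective_iff_map_eq_zero _).2 fun x hx => ?_
  have hspan : x ∈ Submodule.span Kv
      (Set.range fun M : UpperExponent n => rttMonomial (gen vv⁻¹) M.1) := by
    rw [span_rttMonomial_gen (inv_ne_zero vv_ne_zero)]
    exact Submodule.mem_top
  obtain ⟨l, rfl⟩ := Finsupp.mem_span_range_iff_exists_finsupp.1 hspan
  have hcoeff : l = 0 := by
    refine linearIndependent_iff.1 ExtHall.linearIndependent_rttMonomial l ?_
    rw [← hx, Finsupp.linearCombination_apply, map_finsuppSum]
    refine Finsupp.sum_congr fun M _ => ?_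
    simp only [map_smul, map_rttMonomial, toExtHall_gen]
  rw [hcoeff, Finsupp.sum_zero_index]

/-- The homomorphism from `RTTPlus n v⁻¹` to the completed algebra that sends the generators to the
elements `tBar i j`. It is encoded as a non-unital homomorphism because the target carries no
bundled unital algebra structure; `toKHat_one` says that it preserves the unit. -/
def toKHat (n : ℕ) : RTTPlus n vv⁻¹ →ₙₐ[Kv] KHat n where
  toFun x := ExtHall.toKHat (toExtHall n x)
  map_smul' c x := by rw [map_smul, map_smul, MonoidHom.id_apply]
  map_zero' := by rw [map_zero, map_zero]
  map_add' x y := by rw [map_add, map_add]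
  map_mul' x y := by rw [map_mul, ExtHall.toKHat_mul]

theorem toKHat_apply (x : RTTPlus n vv⁻¹) : toKHat n x = ExtHall.toKHat (toExtHall n x) := rfl

theorem toKHat_one : toKHat n 1 = 1 := by rw [toKHat_apply, map_one, ExtHall.toKHat_one]

theorem toKHat_gen (i j : Fin n) : toKHat n (gen vv⁻¹ i j) = tBar i j := by
  rw [toKHat_apply, toExtHall_gen, ExtHall.toKHat_tbar]

theorem toKHat_injective : Function.Injective (toKHat n) :=
  ExtHall.toKHat_injective.comp toExtHall_injective

theorem toKHat_mem_calU (x : RTTPlus n vv⁻¹) : toKHat n x ∈ calU n := by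
  have hx : x ∈ Algebra.adjoin Kv (Set.range fun p : Fin n × Fin n => gen vv⁻¹ p.1 p.2) := by
    rw [adjoin_gen]
    exact Algebra.mem_top
  induction hx using Algebra.adjoin_induction with
  | mem x hx =>
    obtain ⟨p, rfl⟩ := hx
    rw [toKHat_gen]
    exact NonUnitalAlgebra.subset_adjoin Kv (Or.inr ⟨p, rfl⟩)
  | algebraMap c =>
    rw [Algebra.algebraMap_eq_smul_one, map_smul, toKHat_one]
    exact SMulMemClass.smul_mem c (NonUnitalAlgebra.subset_adjoin Kv (Or.inl rfl))
  | add x y _ _ hx hy =>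
    rw [map_add]
    exact add_mem hx hy
  | mul x y _ _ hx hy =>
    rw [map_mul]
    exact mul_mem hx hy

theorem calU_le_range_toKHat : calU n ≤ NonUnitalAlgHom.range (toKHat n) := by
  refine NonUnitalAlgebra.adjoin_le ?_
  rintro _ (rfl | ⟨p, rfl⟩)
  · exact ⟨1, toKHat_one⟩
  · exact ⟨gen vv⁻¹ p.1 p.2, toKHat_gen _ _⟩

/-- The linear isomorphism of `RTTPlus n v⁻¹` with `calU n` underlying the isomorphism of algebras
`x_{ij} ↦ t̄_{ij}`. -/
def equivCalU (n : ℕ) : RTTPlus n vv⁻¹ ≃ₗ[Kv] calU n :=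
  LinearEquiv.ofBijective (NonUnitalAlgHom.codRestrict (toKHat n) (calU n) toKHat_mem_calU :
    RTTPlus n vv⁻¹ →ₗ[Kv] calU n)
    ⟨fun _ _ h => toKHat_injective (congrArg Subtype.val h), fun u => by
      obtain ⟨x, hx⟩ := calU_le_range_toKHat u.2
      exact ⟨x, Subtype.ext hx⟩⟩

theorem equivCalU_mul (x y : RTTPlus n vv⁻¹) :
    equivCalU n (x * y) = equivCalU n x * equivCalU n y := Subtype.ext (map_mul (toKHat n) x y)

theorem coe_equivCalU_one : (equivCalU n 1 : KHat n) = 1 := toKHat_one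

theorem coe_equivCalU_gen (i j : Fin n) :
    (equivCalU n (gen vv⁻¹ i j) : KHat n) = tBar i j := toKHat_gen i j

end RTTPlus

/-! ### The isomorphism with the positive part of `U_v(gl_n)` -/

theorem UPlus.isRTT_tbar : IsRTT vv (UPlus.tbar : Fin n → Fin n → UPlus n) :=
  IsRTT.of_rtt vv_ne_zero
    (fun i j hji => Subtype.ext <| by
      have hrel := RingQuot.mkAlgHom_rel Kv (UvRel.tbar_zero j i hji)
      rwa [map_zero] at hrel)
    fun i a j b => Subtype.ext <| by
      have hrel := RingQuot.mkAlgHom_rel Kv (UvRel.bb i a j b)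
      simp only [map_sub, map_smul, map_mul] at hrel
      exact hrel

theorem UPlus.isRTT_tbar_rev :
    IsRTT vv⁻¹ fun i j : Fin n => (UPlus.tbar j.rev i.rev : UPlus n) :=
  UPlus.isRTT_tbar.reflect vv_ne_zero

/-- The retraction of `U_v(gl_n)` onto its positive part, followed by the identification of the
latter with `RTTPlus n v⁻¹`. It sends every `t_{ij}` to `0`, which is compatible with the mixed
relations because each of their terms contains a factor `t_{ij}`. -/
def UvGl.toRTTPlus (n : ℕ) : UvGl n →ₐ[Kv] RTTPlus n vv⁻¹ :=
  RingQuot.liftAlgHom Kv ⟨FreeAlgebra.lift Kv fun g => match g with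
    | .t _ _ => 0
    | .tbar i j => RTTPlus.gen vv⁻¹ j.rev i.rev, by
    have hx : IsRTT vv fun i j : Fin n => RTTPlus.gen vv⁻¹ j.rev i.rev := by
      simpa only [inv_inv] using (RTTPlus.isRTT_gen (n := n) (inv_ne_zero vv_ne_zero)).reflect
        (inv_ne_zero vv_ne_zero)
    intro a b h
    cases h with
    | t_zero i j h => simp [RTTGen.T]
    | tbar_zero i j h => simpa [RTTGen.Tb] using hx.zero j i h
    | tt i a j b => simp [RTTGen.T]
    | bb i a j b => simpa [RTTGen.Tb] using hx.rtt vv_ne_zero i a j b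
    | bt i a j b => simp [RTTGen.T]⟩

theorem UvGl.toRTTPlus_tbar (i j : Fin n) :
    UvGl.toRTTPlus n (UvGl.tbar i j) = RTTPlus.gen vv⁻¹ j.rev i.rev := by
  rw [UvGl.toRTTPlus, UvGl.tbar, RingQuot.liftAlgHom_mkAlgHom_apply, RTTGen.Tb,
    FreeAlgebra.lift_ι_apply]

namespace RTTPlus

/-- The homomorphism `x_{ij} ↦ t̄_{n+1-j,n+1-i}` to the positive part of `U_v(gl_n)`. -/
def toUPlus (n : ℕ) : RTTPlus n vv⁻¹ →ₐ[Kv] UPlus n :=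
  lift (inv_ne_zero vv_ne_zero) UPlus.isRTT_tbar_rev

theorem toUPlus_gen (i j : Fin n) : toUPlus n (gen vv⁻¹ i j) = UPlus.tbar j.rev i.rev :=
  lift_gen _ _ _ _

theorem toUPlus_gen_rev (i j : Fin n) : toUPlus n (gen vv⁻¹ j.rev i.rev) = UPlus.tbar i j := by
  rw [toUPlus_gen, Fin.rev_rev, Fin.rev_rev]

theorem toUPlus_surjective : Function.Surjective (toUPlus n) := by
  have hrange : UPlus n ≤ ((UPlus n).val.comp (toUPlus n)).range := by
    refine Algebra.adjoin_le ?_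
    rintro _ ⟨⟨i, j⟩, rfl⟩
    exact ⟨gen vv⁻¹ j.rev i.rev, congrArg Subtype.val (toUPlus_gen_rev i j)⟩
  intro y
  obtain ⟨x, hx⟩ := hrange y.2
  exact ⟨x, Subtype.ext hx⟩

theorem toRTTPlus_toUPlus (x : RTTPlus n vv⁻¹) : UvGl.toRTTPlus n (toUPlus n x) = x := by
  have hcomp : ((UvGl.toRTTPlus n).comp (UPlus n).val).comp (toUPlus n) = AlgHom.id Kv _ := by
    refine algHom_ext fun i j => ?_
    rw [AlgHom.comp_apply, toUPlus_gen, AlgHom.comp_apply]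
    refine (UvGl.toRTTPlus_tbar j.rev i.rev).trans ?_
    rw [Fin.rev_rev, Fin.rev_rev, AlgHom.id_apply]
  exact DFunLike.congr_fun hcomp x

theorem toUPlus_injective : Function.Injective (toUPlus n) := fun x y h => by
  rw [← toRTTPlus_toUPlus x, h, toRTTPlus_toUPlus]

/-- The algebra isomorphism `x_{ij} ↦ t̄_{n+1-j,n+1-i}` onto the positive part of `U_v(gl_n)`. -/
def equivUPlus (n : ℕ) : RTTPlus n vv⁻¹ ≃ₐ[Kv] UPlus n :=
  AlgEquiv.ofBijective (toUPlus n) ⟨toUPlus_injective, toUPlus_surjective⟩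

theorem equivUPlus_symm_tbar (i j : Fin n) :
    (equivUPlus n).symm (UPlus.tbar i j) = gen vv⁻¹ j.rev i.rev :=
  (AlgEquiv.symm_apply_eq _).2 (toUPlus_gen_rev i j).symm

end RTTPlus

end

theorem mainTheorem1 (n : ℕ) (hn : 0 < n) :
    (∃ Ψ : UPlus n ≃ₗ[Kv] calU n,
      (∀ x y : UPlus n, Ψ (x * y) = Ψ x * Ψ y) ∧ ((Ψ 1 : calU n) : KHat n) = 1 ∧
      ∀ i j : Fin n, ((Ψ (UPlus.tbar i j) : calU n) : KHat n) = tBar j.rev i.rev) ∧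
    (∃ Φ : RTTPlus n vv⁻¹ ≃ₗ[Kv] calU n,
      (∀ x y : RTTPlus n vv⁻¹, Φ (x * y) = Φ x * Φ y) ∧ ((Φ 1 : calU n) : KHat n) = 1 ∧
      ∀ i j : Fin n, ((Φ (RTTPlus.gen vv⁻¹ i j) : calU n) : KHat n) = tBar i j) := by
  refine ⟨⟨(RTTPlus.equivUPlus n).symm.toLinearEquiv.trans (RTTPlus.equivCalU n),
    fun x y => ?_, ?_, fun i j => ?_⟩,
    ⟨RTTPlus.equivCalU n, RTTPlus.equivCalU_mul, RTTPlus.coe_equivCalU_one,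
      RTTPlus.coe_equivCalU_gen⟩⟩ <;>
    simp only [LinearEquiv.trans_apply, AlgEquiv.toLinearEquiv_apply]
  · rw [map_mul, RTTPlus.equivCalU_mul]
  · rw [map_one, RTTPlus.coe_equivCalU_one]
  · rw [RTTPlus.equivUPlus_symm_tbar, RTTPlus.coe_equivCalU_gen]
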